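/- Let $\Gamma$ be a group of orientation-preserving isometries of hyperbolic space $\mathbb H^3$ acting freely and properly discontinuously with compact quotient, so that $M=\Gamma\backslash\mathbb H^3$ is a closed oriented hyperbolic $3$-manifold, and let $SM=\Gamma\backslash S\mathbb H^3$ be its unit sphere bundle, with geodesic flow $\phi_t$. For $v\in S_x\mathbb H^3$ write $\xi=(\xi_H,\xi_V)$ for the horizontal and vertical components of $\xi\in T_vS\mathbb H^3$, and let $i(v):T_x\mathbb H^3\to T_x\mathbb H^3$ be the linear map that kills $v$ and rotates $v^\perp$ by $\pi/2$ according to the orientation. Put $\alpha_v(\xi)=\langle v,\xi_H\rangle$ and $J_v(\xi_H,\xi_V)=(i(v)\xi_V,\,i(v)\xi_H)$. Then $\alpha$ and $J$ descend to $SM$, where $\alpha$ is a contact form (the canonical one), and $\psi(\xi,\eta):=d\alpha(J\xi,\eta)$ defines a smooth $2$-form on $SM$, invariant under $\phi_t$, such that: 1. $\psi$ is closed but not exact: $d\psi=0$, and there is no smooth $1$-form $\beta$ on $SM$ with $d\beta=\psi$; 2. the $4$-form $\psi^2=\psi\wedge\psi$ is exact; 3. $(SM,\psi)$ is a stable Hamiltonian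 structure with stabilizing $1$-form $\alpha$: $\psi$ is closed, its kernel is one-dimensional at every point, $\alpha$ does not vanish on $\ker\psi$, and $\ker\psi\subset\ker d\alpha$; 4. its Reeb vector field is the Reeb vector field $R$ of $\alpha$, that is, the generator of $\phi_t$: $\alpha(R)=1$, $i_R\,d\alpha=0$ and $i_R\psi=0$. -/

import Mathlib

open scoped Manifold ContDiff

noncomputable section

/-! ### Differential forms on manifolds without boundary -/

section DiffForms

variable {E : Type*} [NormedAddCommGroup E] [NormedSpace ℝ E]
  {H : Type*} [TopologicalSpace H] (I : ModelWithCorners ℝ E H)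
  {M : Type*} [TopologicalSpace M] [ChartedSpace H M]

/-- A (not necessarily smooth) differential `k`-form on `M`. -/
abbrev DiffForm (M : Type*) [TopologicalSpace M] [ChartedSpace H M] (k : ℕ) : Type _ :=
  ∀ x : M, TangentSpace I x [⋀^Fin k]→L[ℝ] ℝ

variable {I}

namespace DiffForm

/-- The expression of a form in the preferred chart at `x`: its pullback under the inverse chart. -/
def inChart {k : ℕ} (θ : DiffForm I M k) (x : M) : E → E [⋀^Fin k]→L[ℝ] ℝ := fun y =>
  (θ ((extChartAt I x).symm y)).compContinuousLinearMap
    (mfderiv 𝓘(ℝ, E) I (extChartAt I x).symm y)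

/-- A form is smooth if all its chart expressions are. -/
def IsSmooth {k : ℕ} (θ : DiffForm I M k) : Prop :=
  ∀ x : M, ContDiffOn ℝ ∞ (θ.inChart x) (extChartAt I x).target

/-- The exterior derivative, computed at `x` in the preferred chart at `x`. -/
def d {k : ℕ} (θ : DiffForm I M k) : DiffForm I M (k + 1) := fun x =>
  (extDeriv (θ.inChart x) (extChartAt I x x)).compContinuousLinearMap
    (mfderiv I 𝓘(ℝ, E) (extChartAt I x) x)

/-- `θ` is exact: it has a smooth primitive. -/
def IsExact {k : ℕ} (θ : DiffForm I M (k + 1)) : Prop :=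
  ∃ β : DiffForm I M k, β.IsSmooth ∧ β.d = θ

/-- `θ` is closed. -/
def IsClosed {k : ℕ} (θ : DiffForm I M k) : Prop := θ.d = 0

/-- The pullback `f^* θ`. -/
def pullback {k : ℕ} {E' : Type*} [NormedAddCommGroup E'] [NormedSpace ℝ E']
    {H' : Type*} [TopologicalSpace H'] {I' : ModelWithCorners ℝ E' H'}
    {N : Type*} [TopologicalSpace N] [ChartedSpace H' N]
    (f : N → M) (θ : DiffForm I M k) : DiffForm I' N k := fun x =>
  (θ (f x)).compContinuousLinearMap (mfderiv I' I f x)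

end DiffForm

section AltTensor

variable {V : Type*} {k l : ℕ}

lemma update_castAdd_castAdd (v : Fin (k + l) → V) (i : Fin k) (z : V) :
    (fun j => Function.update v (Fin.castAdd l i) z (Fin.castAdd l j))
      = Function.update (fun j => v (Fin.castAdd l j)) i z :=
  Function.update_comp_eq_of_injective v (Fin.castAdd_injective k l) i z

lemma update_castAdd_natAdd (v : Fin (k + l) → V) (i : Fin k) (z : V) :
    (fun j => Function.update v (Fin.castAdd l i) z (Fin.natAdd k j))
      = fun j => v (Fin.natAdd k j) := by
  funext j
  exact Function.update_of_ne (fun h => by simp [Fin.ext_iff] at h; omega) _ _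

lemma update_natAdd_natAdd (v : Fin (k + l) → V) (i : Fin l) (z : V) :
    (fun j => Function.update v (Fin.natAdd k i) z (Fin.natAdd k j))
      = Function.update (fun j => v (Fin.natAdd k j)) i z :=
  Function.update_comp_eq_of_injective v (Fin.natAdd_injective l k) i z

lemma update_natAdd_castAdd (v : Fin (k + l) → V) (i : Fin l) (z : V) :
    (fun j => Function.update v (Fin.natAdd k i) z (Fin.castAdd l j))
      = fun j => v (Fin.castAdd l j) := by
  funext j
  exact Function.update_of_ne (fun h => by simp [Fin.ext_iff] at h; omega) _ _

/-- The product `(v₁, …, v_{k+l}) ↦ a(v₁, …, v_k) b(v_{k+1}, …, v_{k+l})`. -/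
def altTensor [AddCommGroup V] [Module ℝ V] [TopologicalSpace V]
    (a : V [⋀^Fin k]→L[ℝ] ℝ) (b : V [⋀^Fin l]→L[ℝ] ℝ) :
    ContinuousMultilinearMap ℝ (fun _ : Fin (k + l) => V) ℝ where
  toFun v := a (fun i => v (Fin.castAdd l i)) * b (fun j => v (Fin.natAdd k j))
  map_update_add' := by
    intro inst v i x y
    obtain rfl : inst = instDecidableEqFin (k + l) := Subsingleton.elim _ _
    induction i using Fin.addCases with
    | left i =>
      simp only [update_castAdd_castAdd, update_castAdd_natAdd, a.map_update_add, add_mul]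
    | right i =>
      simp only [update_natAdd_natAdd, update_natAdd_castAdd, b.map_update_add, mul_add]
  map_update_smul' := by
    intro inst v i c x
    obtain rfl : inst = instDecidableEqFin (k + l) := Subsingleton.elim _ _
    induction i using Fin.addCases with
    | left i =>
      simp only [update_castAdd_castAdd, update_castAdd_natAdd, a.map_update_smul, smul_eq_mul,
        mul_assoc]
    | right i =>
      simp only [update_natAdd_natAdd, update_natAdd_castAdd, b.map_update_smul, smul_eq_mul]
      ring
  cont := by
    have ha : Continuous fun v : Fin (k + l) → V => a (fun i => v (Fin.castAdd l i)) :=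
      a.cont.comp (continuous_pi fun i => continuous_apply _)
    have hb : Continuous fun v : Fin (k + l) → V => b (fun j => v (Fin.natAdd k j)) :=
      b.cont.comp (continuous_pi fun i => continuous_apply _)
    exact ha.mul hb

end AltTensor

/-- The wedge product of alternating forms,
`(a ∧ b)(v₁, …, v_{k+l}) = 1/(k! l!) ∑_σ sign(σ) a(v_{σ1}, …, v_{σk}) b(v_{σ(k+1)}, …)`. -/
def altWedge {V : Type*} [AddCommGroup V] [Module ℝ V] [TopologicalSpace V] {k l : ℕ}
    (a : V [⋀^Fin k]→L[ℝ] ℝ) (b : V [⋀^Fin l]→L[ℝ] ℝ) : V [⋀^Fin (k + l)]→L[ℝ] ℝ :=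
  ((k.factorial * l.factorial : ℝ)⁻¹) • ContinuousMultilinearMap.alternatization (altTensor a b)

namespace DiffForm

/-- The wedge product of differential forms. -/
def wedge {k l : ℕ} (θ : DiffForm I M k) (η : DiffForm I M l) : DiffForm I M (k + l) :=
  fun x => altWedge (θ x) (η x)

/-- The kernel `{ξ | θ(ξ, ·, …, ·) = 0}` of a form at a point. -/
def kernel {k : ℕ} (θ : DiffForm I M (k + 1)) (x : M) : Submodule ℝ E :=
  LinearMap.ker (ContinuousAlternatingMap.curryLeft (E := E) (θ x)).toLinearMap

/-- A Hamiltonian structure: a smooth closed 2-form with one-dimensional kernels. -/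
structure IsHamiltonianStructure (θ : DiffForm I M 2) : Prop where
  smooth : θ.IsSmooth
  closed : θ.IsClosed
  finrank_kernel : ∀ x, Module.finrank ℝ (θ.kernel x) = 1

/-- `l` is a stabilizing 1-form for the Hamiltonian structure `θ`: it is smooth, it does not vanish
on `ker θ`, and `ker θ ⊆ ker dl`. -/
structure IsStabilizing (θ : DiffForm I M 2) (l : DiffForm I M 1) : Prop where
  smooth : l.IsSmooth
  ne_zero_on_kernel : ∀ x, ∃ ξ ∈ θ.kernel x, l x ![ξ] ≠ 0
  kernel_le : ∀ x, θ.kernel x ≤ l.d.kernel x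

/-- `l` is a contact form: it is smooth, nowhere zero, and `dl` is nondegenerate on `ker l`. -/
structure IsContact (l : DiffForm I M 1) : Prop where
  smooth : l.IsSmooth
  ne_zero : ∀ x, l x ≠ 0
  nondegenerate : ∀ (x : M) (ξ : TangentSpace I x), l x ![ξ] = 0 →
    (∀ η : TangentSpace I x, l x ![η] = 0 → l.d x ![ξ, η] = 0) → ξ = 0

/-- `R` is the Reeb vector field of `(θ, l)`: `l(R) = 1` and `i_R θ = 0`. The Reeb vector field
of a contact form `l` is that of `(dl, l)`. -/
def IsReeb (θ : DiffForm I M 2) (l : DiffForm I M 1) (R : ∀ x : M, TangentSpace I x) : Prop :=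
  ∀ x, l x ![R x] = 1 ∧ R x ∈ θ.kernel x

end DiffForm

end DiffForms

/-! ### The hyperboloid model of hyperbolic 3-space -/

/-- `ℝ⁴`, which carries the Lorentz form. -/
abbrev R4 : Type := Fin 4 → ℝ

/-- The Lorentz form `-x₀y₀ + x₁y₁ + x₂y₂ + x₃y₃`. -/
def lorentz (x y : R4) : ℝ := -(x 0 * y 0) + x 1 * y 1 + x 2 * y 2 + x 3 * y 3

/-- The Lorentz form in its second argument. -/
def lorentzCLM (x : R4) : R4 →L[ℝ] ℝ :=
  LinearMap.toContinuousLinearMap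
    { toFun := lorentz x
      map_add' := fun y z => by simp only [lorentz, Pi.add_apply]; ring
      map_smul' := fun c y => by
        simp only [lorentz, Pi.smul_apply, smul_eq_mul, RingHom.id_apply]; ring }

/-- Hyperbolic 3-space: the upper sheet of the hyperboloid `⟨x, x⟩ = -1`. Its tangent space at `x`
is the Lorentz-orthogonal complement of `x`, on which the Lorentz form is the hyperbolic metric. -/
def Hyp3 : Type := {x : R4 // lorentz x x = -1 ∧ 0 < x 0}

instance : TopologicalSpace Hyp3 := inferInstanceAs (TopologicalSpace (Subtype _))

/-- The group `SO⁺(1,3)` of orientation-preserving isometries of hyperbolic space: the matrices of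
determinant one which preserve the Lorentz form and the upper sheet of the hyperboloid. -/
def HypIsom : Subgroup (Matrix.SpecialLinearGroup (Fin 4) ℝ) where
  carrier := {A | (∀ x y, lorentz (A.1.mulVec x) (A.1.mulVec y) = lorentz x y) ∧
    ∀ x, lorentz x x = -1 → 0 < x 0 → 0 < A.1.mulVec x 0}
  one_mem' := by simp
  mul_mem' := by
    rintro A B ⟨hA, hA'⟩ ⟨hB, hB'⟩
    refine ⟨fun x y => ?_, fun x hx hx0 => ?_⟩
    · simp only [Matrix.SpecialLinearGroup.coe_mul, ← Matrix.mulVec_mulVec, hA, hB]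
    · simp only [Matrix.SpecialLinearGroup.coe_mul, ← Matrix.mulVec_mulVec]
      exact hA' _ (by rw [hB, hx]) (hB' _ hx hx0)
  inv_mem' := by
    rintro A ⟨hA, hA'⟩
    have hinv : ∀ x : R4, A.1.mulVec ((A⁻¹).1.mulVec x) = x := fun x => by
      rw [Matrix.mulVec_mulVec, ← Matrix.SpecialLinearGroup.coe_mul, mul_inv_cancel,
        Matrix.SpecialLinearGroup.coe_one, Matrix.one_mulVec]
    have h1 : ∀ x y, lorentz ((A⁻¹).1.mulVec x) ((A⁻¹).1.mulVec y) = lorentz x y :=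
      fun x y => by rw [← hA, hinv, hinv]
    refine ⟨h1, fun x hx hx0 => ?_⟩
    by_contra hneg
    set y := (A⁻¹).1.mulVec x with hy
    have hyy : lorentz y y = -1 := by rw [hy, h1, hx]
    have hy0 : y 0 ≠ 0 := by
      intro h0
      simp only [lorentz, h0] at hyy
      nlinarith [sq_nonneg (y 1), sq_nonneg (y 2), sq_nonneg (y 3)]
    have hlt : 0 < (-y) 0 := by
      simp only [Pi.neg_apply]
      have : y 0 < 0 := lt_of_le_of_ne (not_lt.mp hneg) hy0
      linarith
    have hny : lorentz (-y) (-y) = -1 := by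
      rw [← hyy]; simp only [lorentz, Pi.neg_apply]; ring
    have h2 := hA' (-y) hny hlt
    rw [Matrix.mulVec_neg, hinv, Pi.neg_apply] at h2
    linarith

instance : MulAction HypIsom Hyp3 where
  smul A x := ⟨A.1.1.mulVec x.1, by rw [A.2.1, x.2.1], A.2.2 _ x.2.1 x.2.2⟩
  one_smul x := Subtype.ext (Matrix.one_mulVec x.1)
  mul_smul A B x := Subtype.ext (Matrix.mulVec_mulVec x.1 A.1.1 B.1.1).symm

/-! ### The unit sphere bundle of hyperbolic space -/

/-- The unit sphere bundle `SH³`: pairs `(x, v)` with `x` in hyperbolic space and `v` a unit tangent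
vector at `x`. -/
def SHyp3 : Type := {p : R4 × R4 // (lorentz p.1 p.1 = -1 ∧ 0 < p.1 0) ∧
  lorentz p.1 p.2 = 0 ∧ lorentz p.2 p.2 = 1}

instance : TopologicalSpace SHyp3 := inferInstanceAs (TopologicalSpace (Subtype _))

instance : T2Space SHyp3 := inferInstanceAs (T2Space (Subtype _))

namespace SHyp3

/-- The foot point `x` of `(x, v)`. -/
def foot (q : SHyp3) : R4 := q.1.1

/-- The vector `v` of `(x, v)`. -/
def vec (q : SHyp3) : R4 := q.1.2

/-- The foot-point projection `SH³ → H³`. -/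
def proj (q : SHyp3) : Hyp3 := ⟨q.1.1, q.2.1⟩

instance : MulAction HypIsom SHyp3 where
  smul A q := ⟨(A.1.1.mulVec q.1.1, A.1.1.mulVec q.1.2),
    ⟨by rw [A.2.1, q.2.1.1], A.2.2 _ q.2.1.1 q.2.1.2⟩,
    by rw [A.2.1, q.2.2.1], by rw [A.2.1, q.2.2.2]⟩
  one_smul q := Subtype.ext (Prod.ext (Matrix.one_mulVec q.1.1) (Matrix.one_mulVec q.1.2))
  mul_smul A B q := Subtype.ext (Prod.ext (Matrix.mulVec_mulVec q.1.1 A.1.1 B.1.1).symm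
    (Matrix.mulVec_mulVec q.1.2 A.1.1 B.1.1).symm)

instance : ContinuousConstSMul HypIsom SHyp3 where
  continuous_const_smul A := by
    refine Continuous.subtype_mk ?_ _
    exact ((Continuous.matrix_mulVec continuous_const
      (continuous_fst.comp continuous_subtype_val)).prodMk
      (Continuous.matrix_mulVec continuous_const (continuous_snd.comp continuous_subtype_val)))

instance (Γ : Subgroup HypIsom) : ContinuousConstSMul Γ SHyp3 where
  continuous_const_smul γ := continuous_const_smul (γ : HypIsom)

lemma continuous_proj : Continuous proj :=
  Continuous.subtype_mk (continuous_fst.comp continuous_subtype_val) _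

lemma proj_smul (A : HypIsom) (q : SHyp3) : proj (A • q) = A • proj q := rfl

instance (Γ : Subgroup HypIsom) [ProperlyDiscontinuousSMul Γ Hyp3] :
    ProperlyDiscontinuousSMul Γ SHyp3 where
  finite_disjoint_inter_image {K L} hK hL := by
    refine (ProperlyDiscontinuousSMul.finite_disjoint_inter_image (Γ := Γ)
      (hK.image continuous_proj) (hL.image continuous_proj)).subset ?_
    rintro γ ⟨_, ⟨q, hq, rfl⟩, hL'⟩
    exact ⟨γ • proj q, ⟨proj q, ⟨q, hq, rfl⟩, rfl⟩, ⟨γ • q, hL', rfl⟩⟩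

instance (Γ : Subgroup HypIsom) [IsCancelSMul Γ Hyp3] : IsCancelSMul Γ SHyp3 where
  left_cancel' a _ _ h := smul_left_cancel a h
  right_cancel' a b q h := IsCancelSMul.right_cancel a b (proj q) (congrArg proj h)

/-! The smooth structure on `SH³`. A unit vector `(x, v)` is determined by the spatial part of `x`
in `ℝ³` and by the direction in `S²` of the spatial part of the light-like vector `x + v`, i.e. the
endpoint at infinity of its geodesic. This is a diffeomorphism of the submanifold `SH³` of
`ℝ⁴ × ℝ⁴` onto `ℝ³ × S²`. -/

/-- The unit sphere in `ℝ³`. -/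
abbrev S2 : Type := Metric.sphere (0 : EuclideanSpace ℝ (Fin 3)) 1

/-- The point of the hyperboloid with spatial part `y`. -/
def liftPt (y : EuclideanSpace ℝ (Fin 3)) : R4 :=
  ![√(1 + (y 0 ^ 2 + y 1 ^ 2 + y 2 ^ 2)), y 0, y 1, y 2]

/-- The light-like vector `(1, n)`. -/
def lightPt (n : EuclideanSpace ℝ (Fin 3)) : R4 := ![1, n 0, n 1, n 2]

/-- The spatial part of a vector. -/
def spatial (x : R4) : EuclideanSpace ℝ (Fin 3) := !₂[x 1, x 2, x 3]

lemma sphere_coords (n : S2) : n.1 0 ^ 2 + n.1 1 ^ 2 + n.1 2 ^ 2 = 1 := by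
  have h : ‖n.1‖ = 1 := mem_sphere_zero_iff_norm.mp n.2
  have h2 : ‖n.1‖ ^ 2 = 1 := by rw [h]; norm_num
  rw [EuclideanSpace.norm_sq_eq, Fin.sum_univ_three] at h2
  simpa using h2

lemma lorentz_liftPt (y : EuclideanSpace ℝ (Fin 3)) : lorentz (liftPt y) (liftPt y) = -1 := by
  have h := Real.mul_self_sqrt (show 0 ≤ 1 + (y 0 ^ 2 + y 1 ^ 2 + y 2 ^ 2) by positivity)
  simp only [lorentz, liftPt, Matrix.cons_val]
  linarith

lemma liftPt_pos (y : EuclideanSpace ℝ (Fin 3)) : 0 < liftPt y 0 :=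
  Real.sqrt_pos.mpr (by positivity)

lemma lorentz_lightPt (n : S2) : lorentz (lightPt n.1) (lightPt n.1) = 0 := by
  have h := sphere_coords n
  simp only [lorentz, lightPt, Matrix.cons_val]
  linarith

lemma lorentz_liftPt_lightPt (y : EuclideanSpace ℝ (Fin 3)) (n : S2) :
    lorentz (liftPt y) (lightPt n.1) < 0 := by
  have hn := sphere_coords n
  have hlt : y 0 * n.1 0 + y 1 * n.1 1 + y 2 * n.1 2 <
      √(1 + (y 0 ^ 2 + y 1 ^ 2 + y 2 ^ 2)) := by
    refine Real.lt_sqrt_of_sq_lt ?_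
    have h1 : (y 0 * n.1 0 + y 1 * n.1 1 + y 2 * n.1 2) ^ 2 ≤
        (y 0 ^ 2 + y 1 ^ 2 + y 2 ^ 2) * (n.1 0 ^ 2 + n.1 1 ^ 2 + n.1 2 ^ 2) := by
      nlinarith [sq_nonneg (y 0 * n.1 1 - y 1 * n.1 0), sq_nonneg (y 0 * n.1 2 - y 2 * n.1 0),
        sq_nonneg (y 1 * n.1 2 - y 2 * n.1 1)]
    rw [hn] at h1
    linarith
  simp only [lorentz, liftPt, lightPt, Matrix.cons_val]
  linarith

lemma add_pos (q : SHyp3) : 0 < q.foot 0 + q.vec 0 := by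
  obtain ⟨⟨x, v⟩, ⟨hx, hx0⟩, hxv, hv⟩ := q
  simp only [foot, vec]
  simp only [lorentz] at hx hxv hv hx0
  by_contra hneg
  have hN : v 0 + x 0 ≤ 0 := by linarith
  have h1 : (v 0 + x 0) ^ 2 = (v 1 + x 1) ^ 2 + (v 2 + x 2) ^ 2 + (v 3 + x 3) ^ 2 := by nlinarith
  have h2 : x 1 * (v 1 + x 1) + x 2 * (v 2 + x 2) + x 3 * (v 3 + x 3) = x 0 * (v 0 + x 0) - 1 := by
    nlinarith
  have h3 : (x 1 * (v 1 + x 1) + x 2 * (v 2 + x 2) + x 3 * (v 3 + x 3)) ^ 2 ≤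
      (x 1 ^ 2 + x 2 ^ 2 + x 3 ^ 2) *
        ((v 1 + x 1) ^ 2 + (v 2 + x 2) ^ 2 + (v 3 + x 3) ^ 2) := by
    nlinarith [sq_nonneg (x 1 * (v 2 + x 2) - x 2 * (v 1 + x 1)),
      sq_nonneg (x 1 * (v 3 + x 3) - x 3 * (v 1 + x 1)),
      sq_nonneg (x 2 * (v 3 + x 3) - x 3 * (v 2 + x 2))]
  have h4 : x 1 ^ 2 + x 2 ^ 2 + x 3 ^ 2 = x 0 ^ 2 - 1 := by nlinarith
  rw [h2, h4, ← h1] at h3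
  have h5 : x 0 * (v 0 + x 0) ≤ 0 := mul_nonpos_of_nonneg_of_nonpos hx0.le hN
  nlinarith [sq_nonneg (v 0 + x 0)]

/-- The endpoint at infinity of the geodesic of `(x, v)`. -/
def direction (q : SHyp3) : S2 :=
  ⟨(q.foot 0 + q.vec 0)⁻¹ • spatial (q.foot + q.vec), by
    have hpos := q.add_pos
    obtain ⟨⟨x, v⟩, ⟨hx, hx0⟩, hxv, hv⟩ := q
    simp only [foot, vec] at hpos ⊢
    simp only [lorentz] at hx hxv hv
    have h1 : (x 1 + v 1) ^ 2 + (x 2 + v 2) ^ 2 + (x 3 + v 3) ^ 2 = (x 0 + v 0) ^ 2 := by nlinarith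
    have h2 : ‖spatial (x + v)‖ = x 0 + v 0 := by
      rw [EuclideanSpace.norm_eq, Fin.sum_univ_three]
      simp only [spatial, Real.norm_eq_abs, sq_abs]
      simp [h1, hpos.le]
    rw [mem_sphere_zero_iff_norm, norm_smul, h2, norm_inv, Real.norm_of_nonneg hpos.le,
      inv_mul_cancel₀ hpos.ne']⟩

/-- The unit vector with given spatial part of its foot point and given endpoint at infinity. -/
def ofCoords (p : EuclideanSpace ℝ (Fin 3) × S2) : SHyp3 :=
  ⟨(liftPt p.1,
    (-(lorentz (liftPt p.1) (lightPt p.2.1)))⁻¹ • lightPt p.2.1 - liftPt p.1),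
    ⟨lorentz_liftPt p.1, liftPt_pos p.1⟩, by
      have h1 := lorentz_liftPt p.1
      have h3 := lorentz_liftPt_lightPt p.1 p.2
      set c := lorentz (liftPt p.1) (lightPt p.2.1) with hc
      have : lorentz (liftPt p.1) ((-c)⁻¹ • lightPt p.2.1 - liftPt p.1) =
          (-c)⁻¹ * c - lorentz (liftPt p.1) (liftPt p.1) := by
        rw [hc]; simp only [lorentz, Pi.sub_apply, Pi.smul_apply, smul_eq_mul]; ring
      change lorentz (liftPt p.1) ((-c)⁻¹ • lightPt p.2.1 - liftPt p.1) = 0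
      rw [this, h1, inv_neg, neg_mul, inv_mul_cancel₀ h3.ne]
      ring, by
      have h1 := lorentz_liftPt p.1
      have h2 := lorentz_lightPt p.2
      have h3 := lorentz_liftPt_lightPt p.1 p.2
      set c := lorentz (liftPt p.1) (lightPt p.2.1) with hc
      have : lorentz ((-c)⁻¹ • lightPt p.2.1 - liftPt p.1)
          ((-c)⁻¹ • lightPt p.2.1 - liftPt p.1) =
          (-c)⁻¹ ^ 2 * lorentz (lightPt p.2.1) (lightPt p.2.1) - 2 * ((-c)⁻¹ * c) +
            lorentz (liftPt p.1) (liftPt p.1) := by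
        rw [hc]; simp only [lorentz, Pi.sub_apply, Pi.smul_apply, smul_eq_mul]; ring
      change lorentz ((-c)⁻¹ • lightPt p.2.1 - liftPt p.1)
          ((-c)⁻¹ • lightPt p.2.1 - liftPt p.1) = 1
      rw [this, h1, h2, inv_neg, neg_mul, inv_mul_cancel₀ h3.ne]
      ring⟩

lemma liftPt_spatial (x : R4) (hx : lorentz x x = -1) (hx0 : 0 < x 0) :
    liftPt (spatial x) = x := by
  simp only [lorentz] at hx
  have h : √(1 + (x 1 ^ 2 + x 2 ^ 2 + x 3 ^ 2)) = x 0 := by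
    rw [show 1 + (x 1 ^ 2 + x 2 ^ 2 + x 3 ^ 2) = x 0 ^ 2 by nlinarith, Real.sqrt_sq hx0.le]
  funext i
  fin_cases i <;> simp [liftPt, spatial, h]

lemma lightPt_direction (q : SHyp3) :
    lightPt q.direction.1 = (q.foot 0 + q.vec 0)⁻¹ • (q.foot + q.vec) := by
  have h := q.add_pos.ne'
  funext i
  fin_cases i <;> simp [lightPt, direction, spatial, h]

/-- The identification of `SH³` with `ℝ³ × S²`. -/
def coords : (EuclideanSpace ℝ (Fin 3) × S2) ≃ₜ SHyp3 where
  toFun := ofCoords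
  invFun q := (spatial q.foot, q.direction)
  left_inv p := by
    have h3 := lorentz_liftPt_lightPt p.1 p.2
    refine Prod.ext ?_ (Subtype.ext ?_)
    · ext i
      fin_cases i <;> simp [spatial, ofCoords, foot, liftPt]
    · set c := lorentz (liftPt p.1) (lightPt p.2.1) with hc
      have hs : (ofCoords p).foot + (ofCoords p).vec = (-c)⁻¹ • lightPt p.2.1 := by
        simp only [ofCoords, foot, vec, ← hc]; abel
      have h0 : (ofCoords p).foot 0 + (ofCoords p).vec 0 = (-c)⁻¹ := by
        have := congrFun hs 0
        simpa [lightPt] using this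
      simp only [direction, h0, hs]
      ext i
      fin_cases i <;> simp [spatial, lightPt, h3.ne]
  right_inv q := by
    have hpos := q.add_pos
    have hx := liftPt_spatial q.foot q.2.1.1 q.2.1.2
    refine Subtype.ext (Prod.ext hx ?_)
    have hc : lorentz q.foot ((q.foot 0 + q.vec 0)⁻¹ • (q.foot + q.vec)) =
        -(q.foot 0 + q.vec 0)⁻¹ := by
      have h1 : lorentz q.foot q.foot = -1 := q.2.1.1
      have h2 : lorentz q.foot q.vec = 0 := q.2.2.1
      have : lorentz q.foot ((q.foot 0 + q.vec 0)⁻¹ • (q.foot + q.vec)) =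
          (q.foot 0 + q.vec 0)⁻¹ * (lorentz q.foot q.foot + lorentz q.foot q.vec) := by
        simp only [lorentz, Pi.add_apply, Pi.smul_apply, smul_eq_mul]; ring
      rw [this, h1, h2]; ring
    change (-(lorentz (liftPt (spatial q.foot)) (lightPt q.direction.1)))⁻¹ •
      lightPt q.direction.1 - liftPt (spatial q.foot) = q.vec
    rw [hx, lightPt_direction, hc, neg_neg, inv_inv, smul_smul, mul_inv_cancel₀ hpos.ne', one_smul]
    abel
  continuous_toFun := by
    have hl : Continuous fun p : EuclideanSpace ℝ (Fin 3) × S2 => liftPt p.1 := by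
      refine continuous_pi fun i => ?_
      fin_cases i <;> simp only [liftPt] <;> simp <;> fun_prop
    have hn : Continuous fun p : EuclideanSpace ℝ (Fin 3) × S2 => lightPt p.2.1 := by
      refine continuous_pi fun i => ?_
      fin_cases i <;> simp only [lightPt] <;> simp <;> fun_prop
    have hc : Continuous fun p : EuclideanSpace ℝ (Fin 3) × S2 =>
        lorentz (liftPt p.1) (lightPt p.2.1) := by
      simp only [lorentz]; fun_prop
    have hi : Continuous fun p : EuclideanSpace ℝ (Fin 3) × S2 =>
        (-(lorentz (liftPt p.1) (lightPt p.2.1)))⁻¹ :=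
      hc.neg.inv₀ fun p => (neg_pos.mpr (lorentz_liftPt_lightPt p.1 p.2)).ne'
    exact Continuous.subtype_mk (hl.prodMk ((hi.smul hn).sub hl)) _
  continuous_invFun := by
    have hf : Continuous foot := continuous_fst.comp continuous_subtype_val
    have hv : Continuous vec := continuous_snd.comp continuous_subtype_val
    have hs : Continuous spatial :=
      (PiLp.continuous_toLp 2 _).comp (continuous_pi fun i => by
        fin_cases i <;> simp <;> fun_prop)
    have hi : Continuous fun q : SHyp3 => (q.foot 0 + q.vec 0)⁻¹ :=
      Continuous.inv₀ (by fun_prop) fun q => q.add_pos.ne'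
    have hd : Continuous direction := Continuous.subtype_mk (hi.smul (hs.comp (hf.add hv))) _
    exact (hs.comp hf).prodMk hd

end SHyp3

/-- The model vector space `ℝ³ × ℝ²`. -/
abbrev E5 : Type := EuclideanSpace ℝ (Fin 3) × EuclideanSpace ℝ (Fin 2)

/-- The model space of the charts. -/
abbrev H5 : Type := ModelProd (EuclideanSpace ℝ (Fin 3)) (EuclideanSpace ℝ (Fin 2))

/-- The model with corners of boundaryless 5-manifolds modelled on `ℝ³ × ℝ²`. -/
abbrev I5 : ModelWithCorners ℝ E5 H5 := (𝓡 3).prod (𝓡 2)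

instance : ChartedSpace H5 SHyp3 := SHyp3.coords.chartedSpace

instance : LocallyCompactSpace SHyp3 :=
  SHyp3.coords.symm.isClosedEmbedding.locallyCompactSpace

namespace SHyp3

/-- The horizontal component `ξ_H ∈ T_x H³` of `ξ ∈ T_{(x,v)} SH³`: its image under the differential
of the foot-point projection. -/
def hor (q : SHyp3) : TangentSpace I5 q →L[ℝ] R4 := mfderiv I5 𝓘(ℝ, R4) foot q

/-- The vertical component `ξ_V ∈ T_x H³` of `ξ ∈ T_{(x,v)} SH³`: the covariant derivative of `v`
along `ξ`, i.e. the derivative of `v` in `ℝ⁴` projected to `T_x H³ = x^⊥`. -/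
def ver (q : SHyp3) : TangentSpace I5 q →L[ℝ] R4 :=
  (ContinuousLinearMap.id ℝ R4 + (lorentzCLM q.foot).smulRight q.foot).comp
    (mfderiv I5 𝓘(ℝ, R4) vec q)

/-- The rotation `i(v) : T_x H³ → T_x H³`, given by `⟨i(v)w, y⟩ = det(x, v, w, y)`: it kills `v` and
rotates `v^⊥` by `π/2` according to the orientation of `H³` (a basis `e₁, e₂, e₃` of `T_x H³` is
positive if `det(x, e₁, e₂, e₃) > 0`). -/
def rot (q : SHyp3) (w : R4) : R4 := fun k =>
  (if k = 0 then -1 else 1) * Matrix.det (Matrix.of ![q.foot, q.vec, w, Pi.single k 1])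

/-- The endomorphism `J(ξ_H, ξ_V) = (i(v)ξ_V, i(v)ξ_H)` of `T_{(x,v)} SH³`. -/
def J (q : SHyp3) (ξ : TangentSpace I5 q) : TangentSpace I5 q :=
  Function.invFun (fun η : TangentSpace I5 q => (q.hor η, q.ver η))
    (q.rot (q.ver ξ), q.rot (q.hor ξ))

/-- The canonical 1-form of `SH³`: `α_{(x,v)}(ξ) = ⟨v, ξ_H⟩`. -/
def alpha : DiffForm I5 SHyp3 1 := fun q =>
  ContinuousAlternatingMap.ofSubsingleton ℝ (TangentSpace I5 q) ℝ (0 : Fin 1)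
    ((lorentzCLM q.vec).comp q.hor)

/-- The unit vector `(x, -v)`. -/
def neg (q : SHyp3) : SHyp3 :=
  ⟨(q.1.1, -q.1.2), q.2.1, by
    have h := q.2.2.1
    simp only [lorentz, Pi.neg_apply] at h ⊢; linarith, by
    have h := q.2.2.2
    simp only [lorentz, Pi.neg_apply] at h ⊢; linarith⟩

/-- The geodesic flow of hyperbolic space: the unit speed geodesic with initial vector `(x, v)` is
`t ↦ cosh(t) x + sinh(t) v`. -/
def geodesicFlow (t : ℝ) (q : SHyp3) : SHyp3 :=
  ⟨(Real.cosh t • q.foot + Real.sinh t • q.vec, Real.sinh t • q.foot + Real.cosh t • q.vec), by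
    have hpos := q.add_pos
    have hpos' := q.neg.add_pos
    obtain ⟨⟨x, v⟩, ⟨hx, hx0⟩, hxv, hv⟩ := q
    simp only [foot, vec, neg, Pi.neg_apply] at hpos hpos' ⊢
    have hcs := Real.cosh_sq t
    have key : ∀ a b c d : ℝ, lorentz (a • x + b • v) (c • x + d • v) =
        a * c * lorentz x x + (a * d + b * c) * lorentz x v + b * d * lorentz v v := by
      intro a b c d
      simp only [lorentz, Pi.add_apply, Pi.smul_apply, smul_eq_mul]; ring
    simp only at hx hxv hv hx0
    refine ⟨⟨?_, ?_⟩, ?_, ?_⟩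
    · rw [key, hx, hxv, hv]; nlinarith
    · simp only [Pi.add_apply, Pi.smul_apply, smul_eq_mul]
      rw [Real.cosh_eq, Real.sinh_eq]
      have h1 := mul_pos (Real.exp_pos t) hpos
      have h2 := mul_pos (Real.exp_pos (-t)) hpos'
      linarith
    · rw [key, hx, hxv, hv]; ring
    · rw [key, hx, hxv, hv]; nlinarith⟩

lemma geodesicFlow_smul (t : ℝ) (A : HypIsom) (q : SHyp3) :
    geodesicFlow t (A • q) = A • geodesicFlow t q := by
  refine Subtype.ext (Prod.ext ?_ ?_)
  · change Real.cosh t • A.1.1.mulVec q.1.1 + Real.sinh t • A.1.1.mulVec q.1.2 =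
      A.1.1.mulVec (Real.cosh t • q.1.1 + Real.sinh t • q.1.2)
    rw [Matrix.mulVec_add, Matrix.mulVec_smul, Matrix.mulVec_smul]
  · change Real.sinh t • A.1.1.mulVec q.1.1 + Real.cosh t • A.1.1.mulVec q.1.2 =
      A.1.1.mulVec (Real.sinh t • q.1.1 + Real.cosh t • q.1.2)
    rw [Matrix.mulVec_add, Matrix.mulVec_smul, Matrix.mulVec_smul]

end SHyp3

/-! ### The unit sphere bundle of a hyperbolic 3-manifold -/

/-- The hyperbolic 3-manifold `M = Γ \ H³`. -/
abbrev HypManifold (Γ : Subgroup HypIsom) : Type := MulAction.orbitRel.Quotient Γ Hyp3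

/-- The unit sphere bundle `SM = Γ \ SH³` of `M = Γ \ H³`. When `Γ` acts freely and properly
discontinuously on `H³` it is a 5-manifold, with the charts induced by those of `SH³`. -/
abbrev SM (Γ : Subgroup HypIsom) : Type := MulAction.orbitRel.Quotient Γ SHyp3

namespace SM

variable (Γ : Subgroup HypIsom)

/-- The covering map `SH³ → SM`. -/
def cover (q : SHyp3) : SM Γ := Quotient.mk _ q

/-- The geodesic flow of `M`. -/
def geodesicFlow (t : ℝ) : SM Γ → SM Γ :=
  Quotient.map' (SHyp3.geodesicFlow t) (by
    rintro _ q ⟨γ, rfl⟩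
    exact ⟨γ, (SHyp3.geodesicFlow_smul t γ.1 q).symm⟩)

variable [ProperlyDiscontinuousSMul Γ Hyp3] [IsCancelSMul Γ Hyp3]

/-- The lift of a tangent vector of `SM` at `y` to the (chosen) point of `SH³` above `y`. -/
def lift (y : SM Γ) : TangentSpace I5 y →L[ℝ] TangentSpace I5 (Quotient.out y) :=
  ContinuousLinearMap.inverse (mfderiv I5 I5 (cover Γ) (Quotient.out y))

/-- The canonical contact form of `SM`: the 1-form whose pullback to `SH³` is the canonical 1-form.
It does not depend on the choice of the lifts, as `Γ` acts by isometries. -/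
def alpha : DiffForm I5 (SM Γ) 1 := fun y =>
  (SHyp3.alpha (Quotient.out y)).compContinuousLinearMap (lift Γ y)

/-- The endomorphism `J` of the tangent bundle of `SM` induced by that of `SH³`. It does not depend
on the choice of the lifts, as `Γ` acts by orientation-preserving isometries. -/
def J (y : SM Γ) (ξ : TangentSpace I5 y) : TangentSpace I5 y :=
  mfderiv I5 I5 (cover Γ) (Quotient.out y) (SHyp3.J (Quotient.out y) (lift Γ y ξ))

/-- The infinitesimal generator of the geodesic flow. -/
def geodesicField (y : SM Γ) : TangentSpace I5 y :=
  mfderiv 𝓘(ℝ, ℝ) I5 (fun t : ℝ => geodesicFlow Γ t y) 0 (1 : ℝ)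

end SM

end

/-! In the hyperboloid model every object on `SH³` is the restriction of a polynomial one on `ℝ⁴ ×
ℝ⁴`. The contact form is `α = ⟨v, dx⟩`, and `ψ` is the restriction of `det(x, v, dx, dx) - det(x, v,
dv, dv)`. Indeed `⟨i(v)w, y⟩ = det(x, v, w, y)` turns `dα(Jξ, η)` into `det(x, v, ξ_H, η_H) - det(x,
v, ξ_V, η_V)` (`psi_eq_d_alpha_J`), and replacing `ξ_V` by `dv(ξ)` only adds a multiple of `x`,
which the determinant kills.

Elements of `SO⁺(1,3)` preserve the Lorentz form and the determinant, and the geodesic flow mixes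
`x` and `v` by a hyperbolic rotation. Hence `α`, `J` and `ψ` are `Γ`-invariant and descend, and `ψ`
is flow-invariant. Identities between forms on `SM` can be tested on `SH³`, because the covering and
its differentials are surjective (`form_ext`).

For the identities on `SH³`, take a Lorentz frame `(x, v, e₁, e₂)` of determinant one. A tangent
vector has five coordinates, `ξ_H = (0, a, h₁, h₂)` and `ξ_V = (0, 0, v₁, v₂)`, in which `dα = v₁∧h₁
+ v₂∧h₂` and `ψ = h₁∧h₂ - v₁∧v₂`. Both have square `-2 h₁∧h₂∧v₁∧v₂`, so `ψ∧ψ = dα∧dα = d(α∧dα)` is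
exact (`d_alpha_wedge_d_alpha`). The equation `dψ = 0` is also a polynomial identity in these
coordinates (`d_psi`).

The generator of the flow is `(ξ_H, ξ_V) = (v, 0)`. Pairing a vector of `ker ψ` with rotations of
its own components and using that the Lorentz form is positive on `x^⊥` shows that `ker ψ` is
spanned by this generator (`eq_smul_geodesicField`). The generator also lies in `ker dα` and
satisfies `α = 1`, which gives the stable Hamiltonian structure and the Reeb field.

Finally, a primitive of `ψ` on `SM` would pull back to one on `SH³`. On the fibre over the base
point `ψ` restricts, up to sign, to the area form of the unit sphere, whose integral `4π` would
vanish by Stokes (`d_ne_psi`). -/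

noncomputable section

/-! ### Calculus of forms in charts: smoothness and `d` under pullback -/

section FormCalculus

open Filter Topology

variable {E : Type*} [NormedAddCommGroup E] [NormedSpace ℝ E]
  {H : Type*} [TopologicalSpace H] {I : ModelWithCorners ℝ E H}
  {M : Type*} [TopologicalSpace M] [ChartedSpace H M]
  {E' : Type*} [NormedAddCommGroup E'] [NormedSpace ℝ E']
  {H' : Type*} [TopologicalSpace H'] {I' : ModelWithCorners ℝ E' H'}
  {N : Type*} [TopologicalSpace N] [ChartedSpace H' N]
  {E'' : Type*} [NormedAddCommGroup E''] [NormedSpace ℝ E'']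
  {H'' : Type*} [TopologicalSpace H''] {I'' : ModelWithCorners ℝ E'' H''}
  {P : Type*} [TopologicalSpace P] [ChartedSpace H'' P] {k : ℕ}

/-- Evaluation on all tuples of basis vectors is an injective linear map into a finite-dimensional
space. Its left inverse is therefore continuous and recovers the form smoothly from finitely many
scalar functions. -/
lemma contDiffAt_alternating_iff [FiniteDimensional ℝ E] {n : ℕ∞ω}
    {F : E' → E [⋀^Fin k]→L[ℝ] ℝ} {y : E'} :
    ContDiffAt ℝ n F y ↔ ∀ v : Fin k → E, ContDiffAt ℝ n (fun y' => F y' v) y := by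
  constructor
  · intro h v
    exact (ContinuousAlternatingMap.apply ℝ E ℝ v).contDiff.contDiffAt.comp y h
  · intro h
    let b := Module.finBasis ℝ E
    let ev : (E [⋀^Fin k]→L[ℝ] ℝ) →ₗ[ℝ]
        ((Fin k → Fin (Module.finrank ℝ E)) → ℝ) :=
      { toFun := fun A s => A (fun i => b (s i))
        map_add' := fun _ _ => rfl
        map_smul' := fun _ _ => rfl }
    have hinj : LinearMap.ker ev = ⊥ := by
      rw [LinearMap.ker_eq_bot]
      intro A B hAB
      have : A.toAlternatingMap = B.toAlternatingMap := by
        refine AlternatingMap.coe_multilinearMap_injective ?_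
        refine Module.Basis.ext_multilinear (fun _ => b) fun s => ?_
        exact congrFun hAB s
      exact ContinuousAlternatingMap.toAlternatingMap_injective this
    obtain ⟨l, hl⟩ := ev.exists_leftInverse_of_injective hinj
    have hF : F = fun y' => LinearMap.toContinuousLinearMap l (ev (F y')) :=
      funext fun y' => (congrArg (fun T => T (F y')) hl).symm
    rw [hF]
    refine (LinearMap.toContinuousLinearMap l).contDiff.contDiffAt.comp y ?_
    rw [contDiffAt_pi]
    exact fun s => h _

lemma ContDiffAt.compContinuousLinearMap_alternating [FiniteDimensional ℝ E'] {n : ℕ∞ω}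
    {F : E'' → E [⋀^Fin k]→L[ℝ] ℝ} {g : E'' → E' →L[ℝ] E} {y : E''}
    (hF : ContDiffAt ℝ n F y) (hg : ContDiffAt ℝ n g y) :
    ContDiffAt ℝ n (fun y' => (F y').compContinuousLinearMap (g y')) y := by
  rw [contDiffAt_alternating_iff]
  intro v
  have h1 := (AnalyticOnNhd.contDiff (n := n)
    (ContinuousMultilinearMap.analyticOnNhd_uncurry_compContinuousLinearMap (𝕜 := ℝ)
    (Fm := fun _ : Fin k => E') (Em := fun _ : Fin k => E) (G := ℝ) (t := Set.univ)))
  have h2 : ContDiffAt ℝ n (fun y' => ((fun _ : Fin k => g y'),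
      ContinuousAlternatingMap.toContinuousMultilinearMapCLM ℝ (F y'))) y :=
    (contDiffAt_pi.2 fun _ => hg).prodMk
      (ContDiffAt.comp (g := ContinuousAlternatingMap.toContinuousMultilinearMapCLM ℝ) y
        (ContinuousLinearMap.contDiff _).contDiffAt hF)
  exact (ContinuousMultilinearMap.apply ℝ (fun _ : Fin k => E') ℝ v).contDiff.contDiffAt.comp y
    (h1.contDiffAt.comp y h2)

namespace DiffForm

/-- A form is smooth at `x` if its expression in the preferred chart at `x` is smooth at `x`. -/
def SmoothAt (θ : DiffForm I M k) (x : M) : Prop :=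
  ContDiffAt ℝ ∞ (θ.inChart x) (extChartAt I x x)

@[ext] lemma ext_apply {θ η : DiffForm I M k} (h : ∀ x v, θ x v = η x v) : θ = η :=
  funext fun x => ContinuousAlternatingMap.ext (h x)

lemma pullback_apply (f : N → M) (θ : DiffForm I M k) (x : N)
    (v : Fin k → TangentSpace I' x) :
    (θ.pullback f : DiffForm I' N k) x v = θ (f x) (fun i => mfderiv I' I f x (v i)) := rfl

lemma pullback_id (θ : DiffForm I M k) : (θ.pullback id : DiffForm I M k) = θ := by
  ext x v
  rw [pullback_apply, mfderiv_id]
  rfl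

lemma pullback_comp_at {f : N → M} {g : P → N} (θ : DiffForm I M k) {x : P}
    (hf : MDifferentiableAt I' I f (g x)) (hg : MDifferentiableAt I'' I' g x) :
    (θ.pullback (f ∘ g) : DiffForm I'' P k) x =
      ((θ.pullback f : DiffForm I' N k).pullback g : DiffForm I'' P k) x := by
  refine ContinuousAlternatingMap.ext fun v => ?_
  rw [pullback_apply, pullback_apply, pullback_apply, mfderiv_comp x hf hg]
  rfl

lemma pullback_congr {f g : N → M} (θ : DiffForm I M k) {x : N} (h : f =ᶠ[𝓝 x] g) :
    (θ.pullback f : DiffForm I' N k) x = (θ.pullback g : DiffForm I' N k) x := by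
  have h1 := h.mfderiv_eq (I := I') (I' := I)
  refine ContinuousAlternatingMap.ext fun v => ?_
  rw [pullback_apply, pullback_apply]
  have h2 : f x = g x := h.self_of_nhds
  -- The two differentials land in tangent spaces at `f x` and `g x`, which are equal only
  -- propositionally; the base points are generalized so that the equality can be eliminated.
  have key : ∀ (a b : M) (L : TangentSpace I' x →L[ℝ] TangentSpace I a)
      (L' : TangentSpace I' x →L[ℝ] TangentSpace I b), a = b → HEq L L' →
      θ a (fun i => L (v i)) = θ b (fun i => L' (v i)) := by
    rintro a _ L L' rfl h
    rw [eq_of_heq h]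
  exact key _ _ _ _ h2 (heq_of_eq h1)

section Smooth

variable [I.Boundaryless] [IsManifold I ∞ M]

lemma mdifferentiableAt_extChartAt_symm {x : M} {y : E} (hy : y ∈ (extChartAt I x).target) :
    MDifferentiableAt 𝓘(ℝ, E) I (extChartAt I x).symm y := by
  have : IsManifold I 1 M := IsManifold.of_le (n := ∞) (by simp)
  have h := mdifferentiableWithinAt_extChartAt_symm (I := I) hy
  rwa [I.range_eq_univ, mdifferentiableWithinAt_univ] at h

lemma contMDiffAt_extChartAt_symm {x : M} {y : E} (hy : y ∈ (extChartAt I x).target) :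
    ContMDiffAt 𝓘(ℝ, E) I ∞ (extChartAt I x).symm y := by
  have h := contMDiffWithinAt_extChartAt_symm_range (n := ∞) (I := I) x hy
  rwa [I.range_eq_univ, contMDiffWithinAt_univ] at h

/-- A form is recovered from its chart expression. -/
lemma apply_eq_inChart (θ : DiffForm I M k) {x z : M} (hz : z ∈ (extChartAt I x).source) :
    θ z = (θ.inChart x (extChartAt I x z)).compContinuousLinearMap
      (mfderiv I 𝓘(ℝ, E) (extChartAt I x) z) := by
  have hM : IsManifold I 1 M := IsManifold.of_le (n := ∞) (by simp)
  have hd : MDifferentiableAt I 𝓘(ℝ, E) (extChartAt I x) z :=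
    mdifferentiableAt_extChartAt (by rwa [← extChartAt_source I])
  have hs : MDifferentiableAt 𝓘(ℝ, E) I (extChartAt I x).symm (extChartAt I x z) :=
    mdifferentiableAt_extChartAt_symm ((extChartAt I x).map_source hz)
  have h1 := θ.pullback_comp_at (I'' := I) hs hd
  have h2 : ((extChartAt I x).symm ∘ extChartAt I x) =ᶠ[𝓝 z] id :=
    eventuallyEq_of_mem (extChartAt_source_mem_nhds' hz) fun w hw => (extChartAt I x).left_inv hw
  have h3 := θ.pullback_congr (I' := I) h2
  rw [pullback_id] at h3
  exact h3.symm.trans h1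

variable [I'.Boundaryless] [IsManifold I' ∞ N]

/-- Near `y` the form `θ` can be read in the single fixed chart at `z` by `apply_eq_inChart`, and
the chain rule merges the three differentials into that of the coordinate expression of `f`. This
reduces questions about pullbacks on manifolds to vector spaces. -/
lemma inChart_pullback_eventuallyEq (θ : DiffForm I M k) {f : N → M} {x : N} {y : E'} {z : M}
    (hy : y ∈ (extChartAt I' x).target)
    (hf : ContMDiffAt I' I ∞ f ((extChartAt I' x).symm y))
    (hz : f ((extChartAt I' x).symm y) ∈ (extChartAt I z).source) :
    (θ.pullback f : DiffForm I' N k).inChart x =ᶠ[𝓝 y]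
      fun y' => (θ.inChart z ((extChartAt I z ∘ f ∘ (extChartAt I' x).symm) y')
        ).compContinuousLinearMap
          (fderiv ℝ (extChartAt I z ∘ f ∘ (extChartAt I' x).symm) y') := by
  have hM : IsManifold I 1 M := IsManifold.of_le (n := ∞) (by simp)
  have hN : IsManifold I' 1 N := IsManifold.of_le (n := ∞) (by simp)
  have hc : ContinuousAt (extChartAt I' x).symm y :=
    (contMDiffAt_extChartAt_symm hy).continuousAt
  have h1 : ∀ᶠ y' in 𝓝 y, ContMDiffAt I' I 1 f ((extChartAt I' x).symm y') :=
    hc.eventually ((contMDiffAt_iff_contMDiffAt_nhds (by simp)).1 (hf.of_le (by simp)))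
  have h2 : ∀ᶠ y' in 𝓝 y, f ((extChartAt I' x).symm y') ∈ (extChartAt I z).source :=
    (ContinuousAt.comp (g := f) hf.continuousAt hc).eventually
      ((isOpen_extChartAt_source z).mem_nhds hz)
  have h3 : ∀ᶠ y' in 𝓝 y, y' ∈ (extChartAt I' x).target :=
    (isOpen_extChartAt_target x).mem_nhds hy
  filter_upwards [h1, h2, h3] with y' a b c
  have d1 : MDifferentiableAt I' I f ((extChartAt I' x).symm y') := a.mdifferentiableAt (by simp)
  have d2 : MDifferentiableAt 𝓘(ℝ, E') I' (extChartAt I' x).symm y' :=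
    mdifferentiableAt_extChartAt_symm c
  have d3 : MDifferentiableAt I 𝓘(ℝ, E) (extChartAt I z) (f ((extChartAt I' x).symm y')) :=
    mdifferentiableAt_extChartAt (by rwa [← extChartAt_source I])
  have e1 := mfderiv_comp y' d3 (d1.comp y' d2)
  have e2 := mfderiv_comp y' d1 d2
  refine ContinuousAlternatingMap.ext fun v => ?_
  have e3 : ∀ w : E', fderiv ℝ (extChartAt I z ∘ f ∘ (extChartAt I' x).symm) y' w =
      mfderiv I 𝓘(ℝ, E) (extChartAt I z) (f ((extChartAt I' x).symm y'))
        (mfderiv I' I f ((extChartAt I' x).symm y')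
          (mfderiv 𝓘(ℝ, E') I' (extChartAt I' x).symm y' w)) := fun w => by
    rw [← mfderiv_eq_fderiv]
    exact (congrArg (fun L => L w) e1).trans (by rw [e2])

  have e4 := congrArg (fun a => a fun i => mfderiv I' I f ((extChartAt I' x).symm y')
          (mfderiv 𝓘(ℝ, E') I' (extChartAt I' x).symm y' (v i))) (θ.apply_eq_inChart b)
  refine Eq.trans e4 ?_
  change θ.inChart z _ _ = θ.inChart z _ _
  congr 1
  funext i
  exact (e3 (v i)).symm

omit [I.Boundaryless] in
lemma contDiffAt_chart_comp {f : N → M} {x : N} {y : E'} {z : M}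
    (hy : y ∈ (extChartAt I' x).target)
    (hf : ContMDiffAt I' I ∞ f ((extChartAt I' x).symm y))
    (hz : f ((extChartAt I' x).symm y) ∈ (extChartAt I z).source) :
    ContDiffAt ℝ ∞ (extChartAt I z ∘ f ∘ (extChartAt I' x).symm) y := by
  rw [← contMDiffAt_iff_contDiffAt]
  have hM : IsManifold I ∞ M := inferInstance
  exact (contMDiffAt_extChartAt' (by rwa [← extChartAt_source I])).comp y
    (hf.comp y (contMDiffAt_extChartAt_symm hy))


lemma contDiffAt_inChart_pullback [FiniteDimensional ℝ E'] {θ : DiffForm I M k} {f : N → M}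
    {x : N} {y : E'} {z : M} (hy : y ∈ (extChartAt I' x).target)
    (hf : ContMDiffAt I' I ∞ f ((extChartAt I' x).symm y))
    (hz : f ((extChartAt I' x).symm y) ∈ (extChartAt I z).source)
    (hθ : ContDiffAt ℝ ∞ (θ.inChart z) (extChartAt I z (f ((extChartAt I' x).symm y)))) :
    ContDiffAt ℝ ∞ ((θ.pullback f : DiffForm I' N k).inChart x) y := by
  refine ContDiffAt.congr_of_eventuallyEq ?_ (θ.inChart_pullback_eventuallyEq hy hf hz)
  have hg := contDiffAt_chart_comp hy hf hz
  exact (ContDiffAt.comp y (by exact hθ) hg).compContinuousLinearMap_alternating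
    (hg.fderiv_right (by simp))

lemma SmoothAt.pullback [FiniteDimensional ℝ E'] {θ : DiffForm I M k} {f : N → M} {x : N}
    (hθ : θ.SmoothAt (f x)) (hf : ContMDiffAt I' I ∞ f x) :
    (θ.pullback f : DiffForm I' N k).SmoothAt x := by
  have hx : (extChartAt I' x).symm (extChartAt I' x x) = x := extChartAt_to_inv x
  refine contDiffAt_inChart_pullback (z := f x) (mem_extChartAt_target x) ?_ ?_ ?_
  · rwa [hx]
  · rw [hx]; exact mem_extChartAt_source (f x)
  · rw [hx]; exact hθ

/-- The exterior derivative commutes with pullbacks. -/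
lemma SmoothAt.d_pullback {θ : DiffForm I M k} {f : N → M} {x : N}
    (hθ : θ.SmoothAt (f x)) (hf : ContMDiffAt I' I ∞ f x) :
    (θ.pullback f : DiffForm I' N k).d x = (θ.d.pullback f : DiffForm I' N (k + 1)) x := by
  have hM : IsManifold I 1 M := IsManifold.of_le (n := ∞) (by simp)
  have hN : IsManifold I' 1 N := IsManifold.of_le (n := ∞) (by simp)
  have hx : (extChartAt I' x).symm (extChartAt I' x x) = x := extChartAt_to_inv x
  have hy := mem_extChartAt_target (I := I') x
  have hf' : ContMDiffAt I' I ∞ f ((extChartAt I' x).symm (extChartAt I' x x)) := by rwa [hx]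
  have hz : f ((extChartAt I' x).symm (extChartAt I' x x)) ∈ (extChartAt I (f x)).source := by
    rw [hx]; exact mem_extChartAt_source (f x)
  have hg := contDiffAt_chart_comp hy hf' hz
  have hgx : (extChartAt I (f x) ∘ f ∘ (extChartAt I' x).symm) (extChartAt I' x x) =
      extChartAt I (f x) (f x) := by simp only [Function.comp_apply, hx]
  have hθ' : DifferentiableAt ℝ (θ.inChart (f x))
      ((extChartAt I (f x) ∘ f ∘ (extChartAt I' x).symm) (extChartAt I' x x)) := by
    rw [hgx]; exact ContDiffAt.differentiableAt hθ (by simp)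
  have h1 := (θ.inChart_pullback_eventuallyEq hy hf' hz).extDeriv_eq
  -- Naturality of `extDeriv` between vector spaces, applied to the coordinate expression of `f`.
  -- What remains is the chain rule identifying its differential, after the chart at `x`, with that
  -- of the chart at `f x` composed with `f`.
  rw [extDeriv_pullback hθ' hg (by simpa using ENat.LEInfty.out), hgx] at h1
  have hcx : MDifferentiableAt I' 𝓘(ℝ, E') (extChartAt I' x) x :=
    mdifferentiableAt_extChartAt (mem_chart_source _ x)
  have hgd : MDifferentiableAt 𝓘(ℝ, E') 𝓘(ℝ, E)
      (extChartAt I (f x) ∘ f ∘ (extChartAt I' x).symm) (extChartAt I' x x) :=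
    (hg.differentiableAt (by simp)).mdifferentiableAt
  have hcf : MDifferentiableAt I 𝓘(ℝ, E) (extChartAt I (f x)) (f x) :=
    mdifferentiableAt_extChartAt (mem_chart_source _ (f x))
  have e1 := mfderiv_comp x hgd hcx
  have e2 := mfderiv_comp x hcf (hf.mdifferentiableAt (by simp))
  have e3 : ((extChartAt I (f x) ∘ f ∘ (extChartAt I' x).symm) ∘ extChartAt I' x) =ᶠ[𝓝 x]
      (extChartAt I (f x) ∘ f) :=
    eventuallyEq_of_mem (extChartAt_source_mem_nhds (I := I') x) fun w hw => by
      simp only [Function.comp_apply, (extChartAt I' x).left_inv hw]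
  have e4 := e1.symm.trans ((e3.mfderiv_eq (I := I') (I' := 𝓘(ℝ, E))).trans e2)
  rw [mfderiv_eq_fderiv] at e4
  refine ContinuousAlternatingMap.ext fun v => ?_
  have e5 : ∀ w : TangentSpace I' x, fderiv ℝ (extChartAt I (f x) ∘ f ∘ (extChartAt I' x).symm)
      (extChartAt I' x x) (mfderiv I' 𝓘(ℝ, E') (extChartAt I' x) x w) =
      mfderiv I 𝓘(ℝ, E) (extChartAt I (f x)) (f x) (mfderiv I' I f x w) :=
    fun w => congrArg (fun L => L w) e4
  refine (congrArg (fun A => A fun i => mfderiv I' 𝓘(ℝ, E') (extChartAt I' x) x (v i)) h1).trans ?_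
  change extDeriv _ _ _ = extDeriv _ _ _
  congr 1
  funext i
  exact e5 (v i)

end Smooth

lemma inChart_congr {θ η : DiffForm I M k} {x : M} (h : ∀ᶠ z in 𝓝 x, θ z = η z) [I.Boundaryless] :
    θ.inChart x =ᶠ[𝓝 (extChartAt I x x)] η.inChart x := by
  have hc : Tendsto (extChartAt I x).symm (𝓝 (extChartAt I x x)) (𝓝 x) := by
    have := continuousAt_extChartAt_symm (I := I) x
    rwa [ContinuousAt, extChartAt_to_inv] at this
  filter_upwards [hc.eventually h] with y hy
  simp only [inChart]
  rw [hy]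

lemma SmoothAt.congr [I.Boundaryless] {θ η : DiffForm I M k} {x : M} (hθ : θ.SmoothAt x)
    (h : ∀ᶠ z in 𝓝 x, η z = θ z) : η.SmoothAt x :=
  ContDiffAt.congr_of_eventuallyEq hθ (inChart_congr h)

lemma IsSmooth.smoothAt [I.Boundaryless] {θ : DiffForm I M k} (h : θ.IsSmooth) (x : M) :
    θ.SmoothAt x :=
  (h x).contDiffAt (extChartAt_target_mem_nhds x)

/-- Smoothness at each point in its own chart passes to any other chart by pulling back along the
identity, with the target chart centred at the moving point. -/
lemma isSmooth_of_smoothAt [I.Boundaryless] [IsManifold I ∞ M] [FiniteDimensional ℝ E]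
    {θ : DiffForm I M k} (h : ∀ x, θ.SmoothAt x) : θ.IsSmooth := by
  intro x y hy
  have := contDiffAt_inChart_pullback (θ := θ) (f := id) (z := (extChartAt I x).symm y) hy
    contMDiffAt_id (mem_extChartAt_source _) (h _)
  rw [pullback_id] at this
  exact this.contDiffWithinAt

lemma inChart_vectorSpace (F : E → E [⋀^Fin k]→L[ℝ] ℝ) (x : E) :
    inChart (I := 𝓘(ℝ, E)) (M := E) F x = F := by
  funext y
  refine ContinuousAlternatingMap.ext fun v => ?_
  change F y (fun i => mfderiv 𝓘(ℝ, E) 𝓘(ℝ, E) id y (v i)) = _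
  rw [mfderiv_id]
  rfl

lemma d_vectorSpace (F : E → E [⋀^Fin k]→L[ℝ] ℝ) (x : E) :
    d (I := 𝓘(ℝ, E)) (M := E) F x = extDeriv F x := by
  refine ContinuousAlternatingMap.ext fun v => ?_
  change extDeriv (inChart (I := 𝓘(ℝ, E)) (M := E) F x) x
    (fun i => mfderiv 𝓘(ℝ, E) 𝓘(ℝ, E) id x (v i)) = _
  rw [mfderiv_id, inChart_vectorSpace]
  rfl

lemma smoothAt_vectorSpace {F : E → E [⋀^Fin k]→L[ℝ] ℝ} {x : E} :
    SmoothAt (I := 𝓘(ℝ, E)) (M := E) F x ↔ ContDiffAt ℝ ∞ F x := by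
  have h : SmoothAt (I := 𝓘(ℝ, E)) (M := E) F x ↔
      ContDiffAt ℝ ∞ (inChart (I := 𝓘(ℝ, E)) (M := E) F x) x := Iff.rfl
  rw [h, inChart_vectorSpace]

end DiffForm

end FormCalculus

/-! ### Smooth structure on the target of a local homeomorphism with smooth deck maps -/

section QuotientStructure

open Filter Topology

variable {E : Type*} [NormedAddCommGroup E] [NormedSpace ℝ E]
  {H : Type*} [TopologicalSpace H] (I : ModelWithCorners ℝ E H)
  {M : Type*} [TopologicalSpace M] [ChartedSpace H M] [IsManifold I ∞ M]
  {M' : Type*} [TopologicalSpace M']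

/-- The smooth deck transformations of `f` act transitively on the fibres. -/
def HasSmoothDeckMaps (f : M → M') : Prop :=
  ∀ a b : M, f a = f b → ∃ τ : M → M, ContMDiff I I ∞ τ ∧ τ a = b ∧ f ∘ τ = f

variable {I} {f : M → M'} (hf : IsLocalHomeomorph f)

include hf in
omit [IsManifold I ∞ M] in
-- Near `a` this composite coincides with the deck map carrying `a` to its image: both lift `f` and
-- take values in the sheet through `p`, on which `f` is injective.
lemma HasSmoothDeckMaps.contMDiffAt_localInverseAt_comp (hd : HasSmoothDeckMaps I f) (p : M)
    {a : M} (ha : f a ∈ (hf.localInverseAt p).source) :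
    ContMDiffAt I I ∞ (hf.localInverseAt p ∘ f) a := by
  obtain ⟨τ, hτ, hab, hfτ⟩ := hd a (hf.localInverseAt p (f a))
    (hf.apply_localInverseAt_of_mem ha).symm
  refine hτ.contMDiffAt.congr_of_eventuallyEq ?_
  have h1 : τ a ∈ (hf.localInverseAt p).target := by
    rw [hab]; exact (hf.localInverseAt p).map_source ha
  have h2 : ∀ᶠ x in 𝓝 a, τ x ∈ (hf.localInverseAt p).target :=
    hτ.continuous.continuousAt.eventually ((hf.localInverseAt p).open_target.mem_nhds h1)
  filter_upwards [h2] with x hx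
  have h3 := (hf.localInverseAt p).right_inv hx
  rw [hf.localInverseAt_symm] at h3
  rw [← h3]
  exact congrArg (hf.localInverseAt p) (congrFun hfτ x).symm

variable {g : M' → M} (hg : Function.RightInverse g f)

lemma HasSmoothDeckMaps.isManifold (hd : HasSmoothDeckMaps I f) :
    @IsManifold ℝ _ E _ _ H _ I ∞ M' _ (hf.chartedSpaceOfRightInverse hg) := by
  let _ : ChartedSpace H M' := hf.chartedSpaceOfRightInverse (H := H) hg
  refine isManifold_of_contDiffOn I ∞ M' ?_
  rintro _ _ ⟨p, rfl⟩ ⟨q, rfl⟩ y ⟨hy, hyr⟩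
  set s := hf.localInverseAt (g p)
  set t := hf.localInverseAt (g q)
  set φ := chartAt H (g p)
  set χ := chartAt H (g q)
  have hy' : I.symm y ∈ ((s.trans φ).symm.trans (t.trans χ)).source := hy
  simp only [OpenPartialHomeomorph.trans_source, OpenPartialHomeomorph.symm_source,
    Set.mem_inter_iff, Set.mem_preimage,
    OpenPartialHomeomorph.trans_symm_eq_symm_trans_symm, OpenPartialHomeomorph.coe_trans,
    Function.comp_apply] at hy'
  obtain ⟨⟨hφ, hs⟩, ht, hχ⟩ := hy'
  have hsf : ∀ x, s.symm x = f x := congrFun (hf.localInverseAt_symm _)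
  rw [hsf] at ht hχ
  have h1 : ContMDiffAt I I ∞ φ.symm (I.symm y) :=
    (contMDiffOn_chart_symm (x := g p)).contMDiffAt (φ.open_target.mem_nhds hφ)
  have h2 := hd.contMDiffAt_localInverseAt_comp hf (g q) ht
  have h3 : ContMDiffAt I I ∞ χ (t (f (φ.symm (I.symm y)))) :=
    (contMDiffOn_chart (x := g q)).contMDiffAt (χ.open_source.mem_nhds hχ)
  -- A transition map is a local inverse composed with `f`, read in charts of `M`; the middle factor
  -- is locally a deck map.
  have h4 := h3.comp (I.symm y) (h2.comp (I.symm y) h1)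
  have h5 := (I.contMDiff.contMDiffAt.comp (I.symm y) h4).comp_contMDiffWithinAt y
    (I.contMDiffOn_symm y hyr)
  refine ContDiffWithinAt.mono ?_ Set.inter_subset_right
  refine (contMDiffWithinAt_iff_contDiffWithinAt.1 h5).congr_of_eventuallyEq
    (Eventually.of_forall fun z => ?_) ?_ <;>
  simp [Function.comp_apply, s, t, φ, χ]

omit [IsManifold I ∞ M] in
lemma HasSmoothDeckMaps.contMDiff (hd : HasSmoothDeckMaps I f) :
    @ContMDiff ℝ _ E _ _ H _ I M _ _ E _ _ H _ I M' _ (hf.chartedSpaceOfRightInverse hg) ∞ f := by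
  let _ : ChartedSpace H M' := hf.chartedSpaceOfRightInverse (H := H) hg
  intro a
  rw [contMDiffAt_iff_target]
  refine ⟨hf.continuous.continuousAt, ?_⟩
  have ha : f a ∈ (hf.localInverseAt (g (f a))).source := by
    have := hf.apply_self_mem_localInverseAt_source (x := g (f a))
    rwa [hg] at this
  have h1 := hd.contMDiffAt_localInverseAt_comp hf (g (f a)) ha
  have h2 : hf.localInverseAt (g (f a)) (f a) = g (f a) := by
    have := hf.localInverseAt_apply_self (x := g (f a))
    rwa [hg] at this
  have h3 : ContMDiffAt I 𝓘(ℝ, E) ∞ (extChartAt I (g (f a)))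
      ((hf.localInverseAt (g (f a)) ∘ f) a) := by
    rw [Function.comp_apply, h2]; exact contMDiffAt_extChartAt
  exact h3.comp a h1

/-- The charts of `M'` use only the local inverse at the chosen preimage `g (f a)`. The local
inverse at an arbitrary `a` is that one followed by `f` and the local inverse at `a`, which together
are locally a deck map. -/
lemma HasSmoothDeckMaps.contMDiffAt_localInverseAt (hd : HasSmoothDeckMaps I f) (a : M) :
    @ContMDiffAt ℝ _ E _ _ H _ I M' _ (hf.chartedSpaceOfRightInverse hg) E _ _ H _ I M _ _ ∞
      (hf.localInverseAt a) (f a) := by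
  let _ : ChartedSpace H M' := hf.chartedSpaceOfRightInverse (H := H) hg
  have hgf : f a ∈ (hf.localInverseAt (g (f a))).source := by
    have := hf.apply_self_mem_localInverseAt_source (x := g (f a))
    rwa [hg] at this
  have h2 : hf.localInverseAt (g (f a)) (f a) = g (f a) := by
    have := hf.localInverseAt_apply_self (x := g (f a))
    rwa [hg] at this
  have hM : IsManifold I ∞ M' := hd.isManifold hf hg
  -- the section through the chosen point is read off the chart
  have h3 : ContMDiffAt I I ∞ (chartAt H (f a)) (f a) := contMDiffOn_chart.contMDiffAt
    ((chartAt H (f a)).open_source.mem_nhds (mem_chart_source H (f a)))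
  have h4 : chartAt H (f a) (f a) = chartAt H (g (f a)) (g (f a)) := by
    change chartAt H (g (f a)) (hf.localInverseAt (g (f a)) (f a)) = _
    rw [h2]
  have h5 : ContMDiffAt I I ∞ (chartAt H (g (f a))).symm (chartAt H (f a) (f a)) := by
    rw [h4]
    exact contMDiffOn_chart_symm.contMDiffAt ((chartAt H (g (f a))).open_target.mem_nhds
      (mem_chart_target H (g (f a))))
  have h6 : ContMDiffAt I I ∞ (hf.localInverseAt a ∘ f)
      ((chartAt H (g (f a))).symm (chartAt H (f a) (f a))) := by
    refine hd.contMDiffAt_localInverseAt_comp hf a ?_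
    rw [h4, OpenPartialHomeomorph.left_inv _ (mem_chart_source H (g (f a))), hg]
    simp
  refine (h6.comp (f a) (h5.comp (f a) h3)).congr_of_eventuallyEq ?_
  filter_upwards [(chartAt H (f a)).open_source.mem_nhds (mem_chart_source H (f a))] with x hx
  have hx' : x ∈ ((hf.localInverseAt (g (f a))).trans (chartAt H (g (f a)))).source := hx
  rw [OpenPartialHomeomorph.trans_source] at hx'
  change _ = hf.localInverseAt a (f ((chartAt H (g (f a))).symm
    (chartAt H (g (f a)) (hf.localInverseAt (g (f a)) x))))
  rw [OpenPartialHomeomorph.left_inv _ hx'.2, hf.apply_localInverseAt_of_mem hx'.1]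

end QuotientStructure

/-! ### `SH³` as a submanifold of `ℝ⁴ × ℝ⁴` and its tangent spaces -/

section ShapeOfSHyp3

open Filter Topology

namespace SHyp3

instance : Fact (Module.finrank ℝ (EuclideanSpace ℝ (Fin 3)) = 2 + 1) := ⟨by simp⟩

/-- The space `ℝ³ × S²` of coordinates on `SH³`. -/
abbrev CoordSpace : Type := EuclideanSpace ℝ (Fin 3) × S2

lemma hasSmoothDeckMaps_coords : HasSmoothDeckMaps I5 (coords : CoordSpace → SHyp3) := by
  intro a b h
  exact ⟨id, contMDiff_id, coords.injective h, rfl⟩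

/-- The homeomorphism `coords` is injective, so its deck maps are trivial. The right inverse
supplied here is the one underlying the chart structure of `SHyp3`. -/
instance : IsManifold I5 ∞ SHyp3 :=
  hasSmoothDeckMaps_coords.isManifold coords.isLocalHomeomorph
    coords.surjective.hasRightInverse.choose_spec

lemma contMDiff_coords : ContMDiff I5 I5 ∞ (coords : CoordSpace → SHyp3) :=
  hasSmoothDeckMaps_coords.contMDiff coords.isLocalHomeomorph
    coords.surjective.hasRightInverse.choose_spec

lemma contMDiff_coords_symm : ContMDiff I5 I5 ∞ (coords.symm : SHyp3 → CoordSpace) := by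
  intro q
  obtain ⟨p, rfl⟩ := coords.surjective q
  have h := hasSmoothDeckMaps_coords.contMDiffAt_localInverseAt coords.isLocalHomeomorph
    coords.surjective.hasRightInverse.choose_spec p
  refine h.congr_of_eventuallyEq ?_
  filter_upwards [(coords.isLocalHomeomorph.localInverseAt p).open_source.mem_nhds
    (coords.isLocalHomeomorph.apply_self_mem_localInverseAt_source)] with y hy
  rw [Homeomorph.symm_apply_eq]
  exact (coords.isLocalHomeomorph.apply_localInverseAt_of_mem hy).symm

lemma contDiff_liftPt : ContDiff ℝ ∞ liftPt := by
  rw [contDiff_pi]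
  intro i
  have h : ∀ j : Fin 3, ContDiff ℝ ∞ fun y : EuclideanSpace ℝ (Fin 3) => y j := fun j => by
    fun_prop
  fin_cases i
  · refine ContDiff.sqrt ?_ fun y => ?_
    · fun_prop
    · positivity
  · exact h 0
  · exact h 1
  · exact h 2

lemma contDiff_lightPt : ContDiff ℝ ∞ lightPt := by
  rw [contDiff_pi]
  intro i
  have h : ∀ j : Fin 3, ContDiff ℝ ∞ fun y : EuclideanSpace ℝ (Fin 3) => y j := fun j => by
    fun_prop
  fin_cases i
  · exact contDiff_const
  · exact h 0
  · exact h 1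
  · exact h 2

lemma contDiff_spatial : ContDiff ℝ ∞ spatial := by
  rw [contDiff_euclidean]
  intro i
  fin_cases i <;> simp only [spatial] <;> simp <;> fun_prop

lemma contDiff_lorentz : ContDiff ℝ ∞ fun p : R4 × R4 => lorentz p.1 p.2 := by
  unfold lorentz
  fun_prop

lemma contMDiff_foot : ContMDiff I5 𝓘(ℝ, R4) ∞ foot := by
  have h1 : ContMDiff I5 𝓘(ℝ, R4) ∞ fun p : CoordSpace => liftPt p.1 :=
    contDiff_liftPt.contMDiff.comp contMDiff_fst
  have h2 := h1.comp contMDiff_coords_symm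
  convert h2 using 1
  funext q
  exact (liftPt_spatial q.foot q.2.1.1 q.2.1.2).symm

lemma contMDiff_vec : ContMDiff I5 𝓘(ℝ, R4) ∞ vec := by
  have h1 : ContMDiff I5 𝓘(ℝ, R4) ∞ fun p : CoordSpace => liftPt p.1 :=
    contDiff_liftPt.contMDiff.comp contMDiff_fst
  have h2 : ContMDiff I5 𝓘(ℝ, R4) ∞ fun p : CoordSpace => lightPt p.2.1 :=
    contDiff_lightPt.contMDiff.comp
      ((contMDiff_coe_sphere (E := EuclideanSpace ℝ (Fin 3)) (n := 2)).comp contMDiff_snd)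
  have h3 : ContMDiff I5 𝓘(ℝ, ℝ) ∞ fun p : CoordSpace =>
      lorentz (liftPt p.1) (lightPt p.2.1) :=
    contDiff_lorentz.contMDiff.comp (h1.prodMk_space h2)
  have h4 : ContMDiff I5 𝓘(ℝ, ℝ) ∞ fun p : CoordSpace =>
      (-(lorentz (liftPt p.1) (lightPt p.2.1)))⁻¹ := fun p =>
    ContMDiffAt.comp (g := fun r : ℝ => (-r)⁻¹) (I' := 𝓘(ℝ, ℝ)) p
      (ContDiffAt.contMDiffAt (contDiffAt_id.neg.inv
        (neg_pos.mpr (lorentz_liftPt_lightPt p.1 p.2)).ne')) (h3 p)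
  have h5 := ((h4.smul h2).sub h1).comp contMDiff_coords_symm
  convert h5 using 1
  funext q
  exact congrArg vec (coords.apply_symm_apply q).symm

variable {E : Type*} [NormedAddCommGroup E] [NormedSpace ℝ E]
  {H : Type*} [TopologicalSpace H] {I : ModelWithCorners ℝ E H}
  {N : Type*} [TopologicalSpace N] [ChartedSpace H N] [IsManifold I ∞ N]

/-- The coordinates `(spatial x, direction)` are smooth expressions in `x` and `v`, the denominator
`x₀ + v₀` being positive. This gives smoothness of the isometries, the flow and the spherical
coordinates from their ambient formulas. -/
lemma contMDiff_of_foot_vec {f : N → SHyp3} (h1 : ContMDiff I 𝓘(ℝ, R4) ∞ fun x => (f x).foot)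
    (h2 : ContMDiff I 𝓘(ℝ, R4) ∞ fun x => (f x).vec) : ContMDiff I I5 ∞ f := by
  have hs : ContMDiff I (𝓡 3) ∞ fun x => spatial (f x).foot :=
    contDiff_spatial.contMDiff.comp h1
  have hsum : ContMDiff I (𝓡 3) ∞ fun x => spatial ((f x).foot + (f x).vec) :=
    contDiff_spatial.contMDiff.comp (h1.add h2)
  have hc0 : ContDiff ℝ ∞ fun x : R4 => x 0 := by fun_prop
  have h0 : ContMDiff I 𝓘(ℝ, ℝ) ∞ fun x => ((f x).foot 0 + (f x).vec 0) :=
    (hc0.contMDiff.comp h1).add (hc0.contMDiff.comp h2)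
  have hi : ContMDiff I 𝓘(ℝ, ℝ) ∞ fun x => ((f x).foot 0 + (f x).vec 0)⁻¹ := fun x =>
    ContMDiffAt.comp (g := fun r : ℝ => r⁻¹) (I' := 𝓘(ℝ, ℝ)) x
      (ContDiffAt.contMDiffAt (contDiffAt_id.inv (f x).add_pos.ne')) (h0 x)
  have hd : ContMDiff I (𝓡 2) ∞ fun x => (f x).direction :=
    (hi.smul hsum).codRestrict_sphere (n := 2) fun x => (f x).direction.2
  have h := contMDiff_coords.comp (hs.prodMk hd)
  convert h using 1
  funext x
  exact (coords.apply_symm_apply (f x)).symm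

/-- The inclusion of `SH³` in `ℝ⁴ × ℝ⁴`. -/
def incl (q : SHyp3) : R4 × R4 := (q.foot, q.vec)

lemma contMDiff_incl : ContMDiff I5 𝓘(ℝ, R4 × R4) ∞ incl :=
  contMDiff_foot.prodMk_space contMDiff_vec

lemma mdifferentiableAt_incl (q : SHyp3) : MDifferentiableAt I5 𝓘(ℝ, R4 × R4) incl q :=
  (contMDiff_incl q).mdifferentiableAt (by simp)

/-- The derivative of the inclusion. -/
def dincl (q : SHyp3) : TangentSpace I5 q →L[ℝ] R4 × R4 := mfderiv I5 𝓘(ℝ, R4 × R4) incl q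

lemma fst_dincl (q : SHyp3) (ξ : TangentSpace I5 q) : (q.dincl ξ).1 = q.hor ξ := by
  have h := mfderiv_comp (I' := 𝓘(ℝ, R4 × R4)) (I'' := 𝓘(ℝ, R4)) q
    (g := ContinuousLinearMap.fst ℝ R4 R4)
    (ContinuousLinearMap.mdifferentiableAt _) (mdifferentiableAt_incl q)
  rw [ContinuousLinearMap.mfderiv_eq] at h
  exact (congrArg (fun L => L ξ) h).symm

lemma snd_dincl (q : SHyp3) (ξ : TangentSpace I5 q) :
    (q.dincl ξ).2 = mfderiv I5 𝓘(ℝ, R4) vec q ξ := by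
  have h := mfderiv_comp (I' := 𝓘(ℝ, R4 × R4)) (I'' := 𝓘(ℝ, R4)) q
    (g := ContinuousLinearMap.snd ℝ R4 R4)
    (ContinuousLinearMap.mdifferentiableAt _) (mdifferentiableAt_incl q)
  rw [ContinuousLinearMap.mfderiv_eq] at h
  exact (congrArg (fun L => L ξ) h).symm

lemma ver_apply (q : SHyp3) (ξ : TangentSpace I5 q) :
    q.ver ξ = (q.dincl ξ).2 + lorentz q.foot (q.dincl ξ).2 • q.foot := by
  rw [snd_dincl]
  rfl

lemma lorentz_comm (x y : R4) : lorentz x y = lorentz y x := by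
  simp only [lorentz]; ring

lemma lorentz_add_right (x y z : R4) : lorentz x (y + z) = lorentz x y + lorentz x z :=
  (lorentzCLM x).map_add y z

lemma lorentz_smul_right (c : ℝ) (x y : R4) : lorentz x (c • y) = c * lorentz x y :=
  (lorentzCLM x).map_smul c y

lemma lorentz_add_left (x y z : R4) : lorentz (x + y) z = lorentz x z + lorentz y z := by
  rw [lorentz_comm, lorentz_add_right, lorentz_comm z, lorentz_comm z]

lemma lorentz_smul_left (c : ℝ) (x y : R4) : lorentz (c • x) y = c * lorentz x y := by
  rw [lorentz_comm, lorentz_smul_right, lorentz_comm]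

lemma lorentz_zero_right (x : R4) : lorentz x 0 = 0 := (lorentzCLM x).map_zero

lemma hasFDerivAt_lorentz (p : R4 × R4) :
    HasFDerivAt (fun p : R4 × R4 => lorentz p.1 p.2)
      ((lorentzCLM p.1).comp (ContinuousLinearMap.snd ℝ R4 R4) +
        (lorentzCLM p.2).comp (ContinuousLinearMap.fst ℝ R4 R4)) p := by
  have hc : ∀ i : Fin 4, HasFDerivAt (fun p : R4 × R4 => p.1 i)
      ((ContinuousLinearMap.proj i).comp (ContinuousLinearMap.fst ℝ R4 R4)) p := fun i =>
    ((ContinuousLinearMap.proj (R := ℝ) (φ := fun _ : Fin 4 => ℝ) i).comp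
      (ContinuousLinearMap.fst ℝ R4 R4)).hasFDerivAt
  have hd : ∀ i : Fin 4, HasFDerivAt (fun p : R4 × R4 => p.2 i)
      ((ContinuousLinearMap.proj i).comp (ContinuousLinearMap.snd ℝ R4 R4)) p := fun i =>
    ((ContinuousLinearMap.proj (R := ℝ) (φ := fun _ : Fin 4 => ℝ) i).comp
      (ContinuousLinearMap.snd ℝ R4 R4)).hasFDerivAt
  have h := (((((hc 0).mul (hd 0)).neg).add ((hc 1).mul (hd 1))).add
    ((hc 2).mul (hd 2))).add ((hc 3).mul (hd 3))
  refine h.congr_fderiv ?_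
  ext z
  · simp [lorentzCLM, lorentz]
  · simp [lorentzCLM, lorentz]

/-- Differentiating a constraint `⟨F, G⟩ = c` along the inclusion. -/
lemma lorentz_dincl_of_constant {F G : R4 × R4 →L[ℝ] R4} {c : ℝ}
    (h : ∀ q : SHyp3, lorentz (F q.incl) (G q.incl) = c) (q : SHyp3) (ξ : TangentSpace I5 q) :
    lorentz (F q.incl) (G (q.dincl ξ)) + lorentz (G q.incl) (F (q.dincl ξ)) = 0 := by
  have h1 : HasFDerivAt (fun p => lorentz (F p) (G p)) _ q.incl :=
    HasFDerivAt.comp (g := fun p : R4 × R4 => lorentz p.1 p.2) (f := F.prod G) q.incl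
      (hasFDerivAt_lorentz (F q.incl, G q.incl)) (F.prod G).hasFDerivAt
  have h2 := h1.hasMFDerivAt.comp q (mdifferentiableAt_incl q).hasMFDerivAt
  have h3 : (fun p => lorentz (F p) (G p)) ∘ incl = fun _ : SHyp3 => c := funext h
  rw [h3] at h2
  have h4 := hasMFDerivAt_unique h2 (hasMFDerivAt_const c q)
  exact congrArg (fun L => L ξ) h4

lemma lorentz_foot_foot (q : SHyp3) : lorentz q.foot q.foot = -1 := q.2.1.1
lemma lorentz_foot_vec (q : SHyp3) : lorentz q.foot q.vec = 0 := q.2.2.1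
lemma lorentz_vec_foot (q : SHyp3) : lorentz q.vec q.foot = 0 := by
  rw [lorentz_comm]; exact q.2.2.1
lemma lorentz_vec_vec (q : SHyp3) : lorentz q.vec q.vec = 1 := q.2.2.2

lemma lorentz_foot_hor (q : SHyp3) (ξ : TangentSpace I5 q) : lorentz q.foot (q.hor ξ) = 0 := by
  have h := lorentz_dincl_of_constant (F := ContinuousLinearMap.fst ℝ R4 R4)
    (G := ContinuousLinearMap.fst ℝ R4 R4) lorentz_foot_foot q ξ
  simp only [ContinuousLinearMap.coe_fst', fst_dincl] at h
  change lorentz q.foot _ + lorentz q.foot _ = 0 at h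
  linarith

/-- The derivative of the constraint `⟨x, v⟩ = 0`. -/
lemma lorentz_foot_dincl_snd (q : SHyp3) (ξ : TangentSpace I5 q) :
    lorentz q.foot (q.dincl ξ).2 = -lorentz q.vec (q.hor ξ) := by
  have h := lorentz_dincl_of_constant (F := ContinuousLinearMap.fst ℝ R4 R4)
    (G := ContinuousLinearMap.snd ℝ R4 R4) lorentz_foot_vec q ξ
  simp only [ContinuousLinearMap.coe_fst', ContinuousLinearMap.coe_snd', fst_dincl] at h
  change lorentz q.foot _ + lorentz q.vec _ = 0 at h
  linarith

lemma lorentz_vec_dincl_snd (q : SHyp3) (ξ : TangentSpace I5 q) :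
    lorentz q.vec (q.dincl ξ).2 = 0 := by
  have h := lorentz_dincl_of_constant (F := ContinuousLinearMap.snd ℝ R4 R4)
    (G := ContinuousLinearMap.snd ℝ R4 R4) lorentz_vec_vec q ξ
  simp only [ContinuousLinearMap.coe_snd'] at h
  change lorentz q.vec _ + lorentz q.vec _ = 0 at h
  linarith

/-- The ambient derivative of `v` and the covariant derivative differ by a normal term along `x`,
whose coefficient is fixed by `⟨x, v⟩ = 0`. -/
lemma dincl_snd (q : SHyp3) (ξ : TangentSpace I5 q) :
    (q.dincl ξ).2 = q.ver ξ + lorentz q.vec (q.hor ξ) • q.foot := by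
  rw [ver_apply, lorentz_foot_dincl_snd, neg_smul, neg_add_cancel_right]

lemma lorentz_foot_ver (q : SHyp3) (ξ : TangentSpace I5 q) : lorentz q.foot (q.ver ξ) = 0 := by
  rw [ver_apply, lorentz_add_right, lorentz_smul_right, lorentz_foot_foot]
  ring

lemma lorentz_vec_ver (q : SHyp3) (ξ : TangentSpace I5 q) : lorentz q.vec (q.ver ξ) = 0 := by
  rw [ver_apply, lorentz_add_right, lorentz_smul_right, lorentz_vec_foot, lorentz_vec_dincl_snd]
  ring

/-- The global coordinates factor through the inclusion: both are restrictions of maps that are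
smooth near `q.incl` in `ℝ⁴ × ℝ⁴`. A vector killed by `dincl` is thus killed by the differential of
a diffeomorphism. -/
lemma dincl_injective (q : SHyp3) : Function.Injective q.dincl := by
  rw [injective_iff_map_eq_zero]
  intro ξ hξ
  have hcs : MDifferentiableAt I5 I5 (coords.symm : SHyp3 → CoordSpace) q :=
    (contMDiff_coords_symm q).mdifferentiableAt (by simp)
  -- the differential of `coords.symm` is injective
  have hinj : mfderiv I5 I5 (coords.symm : SHyp3 → CoordSpace) q ξ = 0 → ξ = 0 := by
    intro h
    have h1 := mfderiv_comp q ((contMDiff_coords _).mdifferentiableAt (by simp)) hcs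
    have h2 : (coords ∘ coords.symm : SHyp3 → SHyp3) = id :=
      funext fun q => coords.apply_symm_apply q
    rw [h2, mfderiv_id] at h1
    have h3 := congrArg (fun L => L ξ) h1
    exact h3.trans ((congrArg (mfderiv I5 I5 coords (coords.symm q)) h).trans
      (map_zero (mfderiv I5 I5 coords (coords.symm q))))
  refine hinj ?_
  have hfst : MDifferentiableAt I5 (𝓡 3) (fun q : SHyp3 => spatial q.foot) q :=
    (contMDiff_fst.comp contMDiff_coords_symm q).mdifferentiableAt (by simp)
  have hsnd : MDifferentiableAt I5 (𝓡 2) direction q :=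
    (contMDiff_snd.comp contMDiff_coords_symm q).mdifferentiableAt (by simp)
  have h1 := mfderiv_prodMk hfst hsnd
  refine (congrArg (fun L => L ξ) h1).trans ?_
  refine Prod.ext ?_ ?_
  · have hS : MDifferentiableAt 𝓘(ℝ, R4 × R4) (𝓡 3) (fun p : R4 × R4 => spatial p.1) q.incl :=
      ((contDiff_spatial.comp contDiff_fst).differentiable (by simp) _).mdifferentiableAt
    have h2 := mfderiv_comp q hS (mdifferentiableAt_incl q)
    exact (congrArg (fun L => L ξ) h2).trans
      ((congrArg _ hξ).trans (ContinuousLinearMap.map_zero _))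
  · have hS : MDifferentiableAt 𝓘(ℝ, R4 × R4) (𝓡 3)
        (fun p : R4 × R4 => (p.1 0 + p.2 0)⁻¹ • spatial (p.1 + p.2)) q.incl := by
      refine (ContDiffAt.differentiableAt (n := ∞) ?_ (by simp)).mdifferentiableAt
      have h0 : ContDiff ℝ ∞ fun p : R4 × R4 => p.1 0 + p.2 0 := by fun_prop
      exact (h0.contDiffAt.inv q.add_pos.ne').smul
        (contDiff_spatial.comp (contDiff_fst.add contDiff_snd)).contDiffAt
    have h2 := mfderiv_comp q hS (mdifferentiableAt_incl q)
    have h3 := mfderiv_comp q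
      ((contMDiff_coe_sphere (E := EuclideanSpace ℝ (Fin 3)) (n := 2) (m := 1)
        q.direction).mdifferentiableAt (by simp)) hsnd
    -- The ambient formula for the direction takes values in `ℝ³`, so the sphere component is tested
    -- after the immersion `S² → ℝ³`.
    refine mfderiv_coe_sphere_injective (E := EuclideanSpace ℝ (Fin 3)) (n := 2) q.direction ?_
    refine Eq.trans ?_ (map_zero (mfderiv (𝓡 2) (𝓡 3) ((↑) : S2 → EuclideanSpace ℝ (Fin 3))
      q.direction)).symm
    have h4 : mfderiv 𝓘(ℝ, R4 × R4) (𝓡 3)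
        (fun p : R4 × R4 => (p.1 0 + p.2 0)⁻¹ • spatial (p.1 + p.2)) q.incl (q.dincl ξ) = 0 := by
      rw [hξ]
      exact map_zero (mfderiv 𝓘(ℝ, R4 × R4) (𝓡 3)
        (fun p : R4 × R4 => (p.1 0 + p.2 0)⁻¹ • spatial (p.1 + p.2)) q.incl)
    exact (congrArg (fun L => L ξ) (h3.symm.trans h2)).trans h4

lemma hor_ver_injective (q : SHyp3) :
    Function.Injective fun η : TangentSpace I5 q => (q.hor η, q.ver η) := by
  intro ξ η h
  obtain ⟨h1, h2⟩ := Prod.ext_iff.1 h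
  simp only at h1 h2
  refine q.dincl_injective (Prod.ext ?_ ?_)
  · rw [fst_dincl, fst_dincl, h1]
  · rw [dincl_snd, dincl_snd, h1, h2]

/-- The equations of the tangent space of `SH³`. -/
def tangentEquations (q : SHyp3) : R4 × R4 →ₗ[ℝ] ℝ × ℝ × ℝ :=
  (((lorentzCLM q.foot).comp (ContinuousLinearMap.fst ℝ R4 R4)).prod
    (((lorentzCLM q.foot).comp (ContinuousLinearMap.snd ℝ R4 R4)).prod
      ((lorentzCLM q.vec).comp (ContinuousLinearMap.snd ℝ R4 R4)))).toLinearMap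

lemma tangentEquations_apply (q : SHyp3) (p : R4 × R4) :
    q.tangentEquations p = (lorentz q.foot p.1, lorentz q.foot p.2, lorentz q.vec p.2) := rfl

/-- A dimension count: the pairs `(ξ_H, ξ_V)` form a 5-dimensional subspace of the solutions of
three independent equations in `ℝ⁸`. This supplies the test vectors used for `J`, for nondegeneracy
and for `ker ψ`. -/
lemma exists_hor_ver (q : SHyp3) {h w : R4} (hh : lorentz q.foot h = 0)
    (hw : lorentz q.foot w = 0) (hw' : lorentz q.vec w = 0) :
    ∃ ξ : TangentSpace I5 q, q.hor ξ = h ∧ q.ver ξ = w := by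
  let L : E5 →ₗ[ℝ] R4 × R4 := (ContinuousLinearMap.prod q.hor q.ver).toLinearMap
  have hL : LinearMap.ker L = ⊥ := LinearMap.ker_eq_bot.2 q.hor_ver_injective
  have hr : LinearMap.range L ≤ LinearMap.ker q.tangentEquations := by
    rintro _ ⟨ξ, rfl⟩
    rw [LinearMap.mem_ker, tangentEquations_apply]
    exact Prod.ext (lorentz_foot_hor q ξ) (Prod.ext (lorentz_foot_ver q ξ) (lorentz_vec_ver q ξ))
  have hs : LinearMap.range q.tangentEquations = ⊤ := by
    rw [LinearMap.range_eq_top]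
    rintro ⟨a, b, c⟩
    refine ⟨(-a • q.foot, -b • q.foot + c • q.vec), ?_⟩
    simp only [tangentEquations_apply, lorentz_add_right, lorentz_smul_right, lorentz_foot_foot,
      lorentz_foot_vec, lorentz_vec_foot, lorentz_vec_vec]
    simp
  have h1 := LinearMap.finrank_range_add_finrank_ker q.tangentEquations
  have h2 := LinearMap.finrank_range_add_finrank_ker L
  rw [hs, finrank_top] at h1
  rw [hL, finrank_bot] at h2
  simp at h1 h2
  have h3 := Submodule.eq_of_le_of_finrank_eq hr (by omega)
  have h4 : (h, w) ∈ LinearMap.range L := by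
    rw [h3, LinearMap.mem_ker, tangentEquations_apply, hh, hw, hw']
    rfl
  obtain ⟨ξ, hξ⟩ := h4
  exact ⟨ξ, congrArg Prod.fst hξ, congrArg Prod.snd hξ⟩

end SHyp3

end ShapeOfSHyp3

/-! ### Lorentzian linear algebra: determinants, the rotation `i(v)`, adapted frames -/

section LorentzAlgebra

namespace SHyp3

/-- The determinant of four vectors of `ℝ⁴`. -/
def det4 (a b c d : R4) : ℝ := Matrix.det (Matrix.of ![a, b, c, d])

/-- Laplace expansion along the first two rows. The explicit polynomial lets later determinant
identities be closed by `ring`. -/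
lemma det4_eq (a b c d : R4) : det4 a b c d =
    (a 0 * b 1 - a 1 * b 0) * (c 2 * d 3 - c 3 * d 2)
    - (a 0 * b 2 - a 2 * b 0) * (c 1 * d 3 - c 3 * d 1)
    + (a 0 * b 3 - a 3 * b 0) * (c 1 * d 2 - c 2 * d 1)
    + (a 1 * b 2 - a 2 * b 1) * (c 0 * d 3 - c 3 * d 0)
    - (a 1 * b 3 - a 3 * b 1) * (c 0 * d 2 - c 2 * d 0)
    + (a 2 * b 3 - a 3 * b 2) * (c 0 * d 1 - c 1 * d 0) := by
  unfold det4
  rw [Matrix.det_succ_row_zero]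
  simp [Fin.sum_univ_succ, Matrix.det_fin_three, Fin.succAbove]
  ring

/-- The sign on the zeroth coordinate in `rot` cancels that of the Lorentz form, so the pairing is
the expansion of the determinant along its last row. -/
lemma lorentz_rot (q : SHyp3) (w y : R4) : lorentz (q.rot w) y = det4 q.foot q.vec w y := by
  have h : ∀ k, q.rot w k =
      (if k = 0 then -1 else 1) * det4 q.foot q.vec w (Pi.single k 1) := fun k => rfl
  simp only [lorentz, h, det4_eq]
  simp
  ring

lemma lorentz_foot_rot (q : SHyp3) (w : R4) : lorentz q.foot (q.rot w) = 0 := by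
  rw [lorentz_comm, lorentz_rot, det4_eq]; ring

lemma lorentz_vec_rot (q : SHyp3) (w : R4) : lorentz q.vec (q.rot w) = 0 := by
  rw [lorentz_comm, lorentz_rot, det4_eq]; ring

/-- The Gram identity for `rot`. -/
lemma lorentz_rot_rot (q : SHyp3) {w y : R4} (hw : lorentz q.foot w = 0) :
    lorentz (q.rot w) (q.rot y) = lorentz w y - lorentz q.vec w * lorentz q.vec y := by
  -- The right side is the Gram determinant of `(x, v, w)` against `(x, v, y)`, expanded along its
  -- first column; the minus sign is the Lorentz signature. Orthogonality of `w` alone to `x`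
  -- suffices, since `⟨x, y⟩` occurs only multiplied by `⟨x, v⟩` or `⟨x, w⟩`.
  have key : ∀ x v w y : R4, -(det4 x v w (fun k => (if k = 0 then -1 else 1) *
      det4 x v y (Pi.single k 1))) =
      lorentz x x * (lorentz v v * lorentz w y - lorentz v w * lorentz v y)
      - lorentz x v * (lorentz x v * lorentz w y - lorentz v w * lorentz x y)
      + lorentz x w * (lorentz x v * lorentz v y - lorentz v v * lorentz x y) := by
    intro x v w y
    simp only [det4_eq, lorentz]
    simp
    ring
  have h := key q.foot q.vec w y
  rw [lorentz_foot_foot, lorentz_foot_vec, lorentz_vec_vec, hw] at h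
  have h2 : lorentz (q.rot w) (q.rot y) = det4 q.foot q.vec w (fun k => (if k = 0 then -1 else 1) *
      det4 q.foot q.vec y (Pi.single k 1)) := lorentz_rot q w _
  rw [h2]
  linarith

/-- The Lorentz form is positive definite on the orthogonal complement of a time-like vector. -/
lemma lorentz_self_pos {x u : R4} (hx : lorentz x x = -1) (hu : lorentz x u = 0) (hu0 : u ≠ 0) :
    0 < lorentz u u := by
  by_contra hneg
  rw [not_lt] at hneg
  simp only [lorentz] at hx hu hneg
  -- Cauchy–Schwarz for the spatial parts. Together with `|x|² = x₀² - 1` and the assumed `|u|² ≤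
  -- u₀²` it forces `u₀ = 0`, hence `u = 0`.
  have h1 : (x 0 * u 0) ^ 2 ≤ (x 1 ^ 2 + x 2 ^ 2 + x 3 ^ 2) * (u 1 ^ 2 + u 2 ^ 2 + u 3 ^ 2) := by
    rw [show x 0 * u 0 = x 1 * u 1 + x 2 * u 2 + x 3 * u 3 by linarith]
    nlinarith [sq_nonneg (x 1 * u 2 - x 2 * u 1), sq_nonneg (x 1 * u 3 - x 3 * u 1),
      sq_nonneg (x 2 * u 3 - x 3 * u 2)]
  have h2 : (x 1 ^ 2 + x 2 ^ 2 + x 3 ^ 2) * (u 1 ^ 2 + u 2 ^ 2 + u 3 ^ 2) ≤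
      (x 1 ^ 2 + x 2 ^ 2 + x 3 ^ 2) * u 0 ^ 2 :=
    mul_le_mul_of_nonneg_left (by nlinarith) (by positivity)
  have h3 : x 1 ^ 2 + x 2 ^ 2 + x 3 ^ 2 = x 0 ^ 2 - 1 := by linarith
  have h4 : u 0 ^ 2 ≤ 0 := by
    rw [h3] at h2; rw [h3] at h1; nlinarith
  have h5 : u 0 = 0 := by nlinarith
  rw [h5] at hneg
  refine hu0 (funext fun i => ?_)
  have a1 : u 1 = 0 := by nlinarith [sq_nonneg (u 1), sq_nonneg (u 2), sq_nonneg (u 3)]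
  have a2 : u 2 = 0 := by nlinarith [sq_nonneg (u 1), sq_nonneg (u 2), sq_nonneg (u 3)]
  have a3 : u 3 = 0 := by nlinarith [sq_nonneg (u 1), sq_nonneg (u 2), sq_nonneg (u 3)]
  fin_cases i
  · exact h5
  · exact a1
  · exact a2
  · exact a3

lemma eq_zero_of_lorentz_self_nonpos (q : SHyp3) {u : R4} (hu : lorentz q.foot u = 0)
    (h : lorentz u u ≤ 0) : u = 0 := by
  by_contra hne
  exact absurd (lorentz_self_pos q.lorentz_foot_foot hu hne) (not_lt.2 h)

lemma det4_vecMul (M : Matrix (Fin 4) (Fin 4) ℝ) (a b c d : R4) :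
    det4 (Matrix.vecMul a M) (Matrix.vecMul b M) (Matrix.vecMul c M) (Matrix.vecMul d M) =
      det4 a b c d * M.det := by
  unfold det4
  rw [← Matrix.det_mul]
  congr 1
  ext i j
  fin_cases i <;> rfl

/-- An oriented Lorentz frame `(x, v, e₁, e₂)` adapted to `(x, v)`. -/
lemma exists_frame (q : SHyp3) : ∃ M : Matrix (Fin 4) (Fin 4) ℝ, M.det = 1 ∧
    Matrix.vecMul ![1, 0, 0, 0] M = q.foot ∧ Matrix.vecMul ![0, 1, 0, 0] M = q.vec ∧
    (∀ a b, lorentz (Matrix.vecMul a M) (Matrix.vecMul b M) = lorentz a b) := by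
  obtain ⟨u, hu0, hu1, hu2⟩ : ∃ u : R4, u ≠ 0 ∧ lorentz q.foot u = 0 ∧ lorentz q.vec u = 0 := by
    have h := LinearMap.ker_ne_bot_of_finrank_lt
      (f := ((lorentzCLM q.foot).prod (lorentzCLM q.vec)).toLinearMap) (by simp)
    obtain ⟨u, hu, hu0⟩ := Submodule.exists_mem_ne_zero_of_ne_bot h
    exact ⟨u, hu0, congrArg Prod.fst hu, congrArg Prod.snd hu⟩
  have hpos := lorentz_self_pos q.lorentz_foot_foot hu1 hu0
  set e : R4 := (√(lorentz u u))⁻¹ • u with he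
  have he1 : lorentz q.foot e = 0 := by rw [he, lorentz_smul_right, hu1, mul_zero]
  have he2 : lorentz q.vec e = 0 := by rw [he, lorentz_smul_right, hu2, mul_zero]
  have hee : lorentz e e = 1 := by
    rw [he, lorentz_smul_right, lorentz_smul_left, ← mul_assoc, ← mul_inv,
      Real.mul_self_sqrt hpos.le, inv_mul_cancel₀ hpos.ne']
  have hr1 := q.lorentz_foot_rot e
  have hr2 := q.lorentz_vec_rot e
  have hrr : lorentz (q.rot e) (q.rot e) = 1 := by rw [lorentz_rot_rot q he1, hee, he2]; ring
  have her : lorentz e (q.rot e) = 0 := by rw [lorentz_comm, lorentz_rot, det4_eq]; ring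
  have hM : ∀ a : R4, Matrix.vecMul a (Matrix.of ![q.foot, q.vec, e, q.rot e]) =
      a 0 • q.foot + a 1 • q.vec + a 2 • e + a 3 • q.rot e := by
    intro a
    ext j
    simp [Matrix.vecMul, dotProduct, Fin.sum_univ_four]
  refine ⟨Matrix.of ![q.foot, q.vec, e, q.rot e], ?_, ?_, ?_, ?_⟩
  -- The determinant of the frame is `⟨i(v)e, i(v)e⟩ = 1`; choosing `i(v)e` as the last vector fixes
  -- the orientation.
  · have h := lorentz_rot q e (q.rot e)
    rw [hrr] at h
    exact h.symm
  · rw [hM]; simp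
  · rw [hM]; simp
  · intro a b
    rw [hM, hM]
    simp only [lorentz_add_left, lorentz_add_right, lorentz_smul_left, lorentz_smul_right,
      lorentz_foot_foot, lorentz_foot_vec, lorentz_vec_foot, lorentz_vec_vec, he1, he2, hee, hr1,
      hr2, hrr, her, lorentz_comm e q.foot, lorentz_comm e q.vec, lorentz_comm (q.rot e) q.foot,
      lorentz_comm (q.rot e) q.vec, lorentz_comm (q.rot e) e]
    simp only [lorentz]
    ring

end SHyp3

end LorentzAlgebra

/-! ### Explicit formulas for low-degree wedge products -/

section WedgeFormulas

section Alt

variable {V : Type*} [AddCommGroup V] [Module ℝ V] [TopologicalSpace V]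
  {W : Type*} [AddCommGroup W] [Module ℝ W] [TopologicalSpace W] {k l : ℕ}

lemma altWedge_apply (a : V [⋀^Fin k]→L[ℝ] ℝ) (b : V [⋀^Fin l]→L[ℝ] ℝ) (u : Fin (k + l) → V) :
    altWedge a b u = (k.factorial * l.factorial : ℝ)⁻¹ * ∑ σ : Equiv.Perm (Fin (k + l)),
      Equiv.Perm.sign σ • (a (fun i => u (σ (Fin.castAdd l i))) *
        b (fun j => u (σ (Fin.natAdd k j)))) := by
  change (k.factorial * l.factorial : ℝ)⁻¹ •
    ContinuousMultilinearMap.alternatization (altTensor a b) u = _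
  rw [ContinuousMultilinearMap.alternatization_apply_apply, smul_eq_mul]
  rfl

lemma altWedge_compContinuousLinearMap (a : V [⋀^Fin k]→L[ℝ] ℝ) (b : V [⋀^Fin l]→L[ℝ] ℝ)
    (L : W →L[ℝ] V) : altWedge (a.compContinuousLinearMap L) (b.compContinuousLinearMap L) =
      (altWedge a b).compContinuousLinearMap L := by
  refine ContinuousAlternatingMap.ext fun u => ?_
  rw [altWedge_apply, ContinuousAlternatingMap.compContinuousLinearMap_apply, altWedge_apply]
  rfl

lemma alt_two_eta (b : V [⋀^Fin 2]→L[ℝ] ℝ) (f : Fin 2 → V) : b f = b ![f 0, f 1] := by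
  congr 1
  funext i
  fin_cases i <;> rfl

lemma alt_one_eta (a : V [⋀^Fin 1]→L[ℝ] ℝ) (f : Fin 1 → V) : a f = a ![f 0] := by
  congr 1
  funext i
  fin_cases i; rfl

lemma alt_two_swap (b : V [⋀^Fin 2]→L[ℝ] ℝ) (x y : V) : b ![x, y] = -b ![y, x] := by
  have h := b.toAlternatingMap.map_swap ![y, x] (i := 0) (j := 1) (by decide)
  have h2 : (![y, x] ∘ Equiv.swap (0 : Fin 2) 1) = ![x, y] := by
    funext i
    fin_cases i <;> rfl
  rw [h2] at h
  exact h

lemma sum_perm_fin_succ {n : ℕ} (F : Equiv.Perm (Fin (n + 1)) → ℝ) :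
    ∑ σ, F σ = ∑ p : Fin (n + 1), ∑ e : Equiv.Perm (Fin n),
      F (Equiv.Perm.decomposeFin.symm (p, e)) := by
  rw [← Equiv.sum_comp Equiv.Perm.decomposeFin.symm, Fintype.sum_prod_type]

lemma sum_sign_perm_fin_three (F : Fin 3 → Fin 3 → Fin 3 → ℝ) :
    ∑ σ : Equiv.Perm (Fin 3), Equiv.Perm.sign σ • F (σ 0) (σ 1) (σ 2) =
      F 0 1 2 - F 0 2 1 - F 1 0 2 + F 1 2 0 + F 2 0 1 - F 2 1 0 := by
  have h3 : ∀ (p : Fin 3) (e : Equiv.Perm (Fin 2)),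
      Equiv.Perm.decomposeFin.symm (p, e) 2 = Equiv.swap 0 p (e 1).succ := fun p e =>
    Equiv.Perm.decomposeFin_symm_apply_succ e p 1
  simp only [sum_perm_fin_succ, Fin.sum_univ_succ, Equiv.Perm.decomposeFin.symm_sign]
  simp [h3, Equiv.swap_apply_def]
  ring

/-- A permutation is split into the image of `0` and a permutation of three letters; a nontrivial
image contributes a transposition and hence a sign. -/
lemma sum_sign_perm_fin_four (F : Fin 4 → Fin 4 → Fin 4 → Fin 4 → ℝ) :
    ∑ σ : Equiv.Perm (Fin 4), Equiv.Perm.sign σ • F (σ 0) (σ 1) (σ 2) (σ 3) =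
      F 0 1 2 3 - F 0 1 3 2 - F 0 2 1 3 + F 0 2 3 1 + F 0 3 1 2 - F 0 3 2 1
      - F 1 0 2 3 + F 1 0 3 2 + F 1 2 0 3 - F 1 2 3 0 - F 1 3 0 2 + F 1 3 2 0
      + F 2 0 1 3 - F 2 0 3 1 - F 2 1 0 3 + F 2 1 3 0 + F 2 3 0 1 - F 2 3 1 0
      - F 3 0 1 2 + F 3 0 2 1 + F 3 1 0 2 - F 3 1 2 0 - F 3 2 0 1 + F 3 2 1 0 := by
  have hp : ∀ (p : Fin 4) (e : Equiv.Perm (Fin 3)),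
      Equiv.Perm.sign (Equiv.Perm.decomposeFin.symm (p, e)) •
        F (Equiv.Perm.decomposeFin.symm (p, e) 0) (Equiv.Perm.decomposeFin.symm (p, e) 1)
          (Equiv.Perm.decomposeFin.symm (p, e) 2) (Equiv.Perm.decomposeFin.symm (p, e) 3) =
      Equiv.Perm.sign e • (fun i j k => (if p = 0 then (1 : ℝ) else -1) *
        F p (Equiv.swap 0 p i.succ) (Equiv.swap 0 p j.succ) (Equiv.swap 0 p k.succ))
          (e 0) (e 1) (e 2) := by
    intro p e
    have h1 := Equiv.Perm.decomposeFin_symm_apply_succ e p 0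
    have h2 := Equiv.Perm.decomposeFin_symm_apply_succ e p 1
    have h3 := Equiv.Perm.decomposeFin_symm_apply_succ e p 2
    rw [Equiv.Perm.decomposeFin.symm_sign, Equiv.Perm.decomposeFin_symm_apply_zero]
    change _ = Equiv.Perm.sign e • (_ * F p _ _ _)
    rw [← h1, ← h2, ← h3]
    split_ifs <;> simp [Units.smul_def]
  rw [sum_perm_fin_succ]
  refine (Finset.sum_congr rfl fun p _ => (Finset.sum_congr rfl fun e _ => hp p e).trans
    (sum_sign_perm_fin_three fun i j k => (if p = 0 then (1 : ℝ) else -1) *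
      F p (Equiv.swap 0 p i.succ) (Equiv.swap 0 p j.succ) (Equiv.swap 0 p k.succ))).trans ?_
  rw [Fin.sum_univ_four]
  simp [Equiv.swap_apply_def]
  ring

/-- The 24 permutations fall into three classes of eight, one for each pairing of the arguments; the
normalization `1/(2! 2!)` leaves the factor 2. -/
lemma altWedge_two_two (a : V [⋀^Fin 2]→L[ℝ] ℝ) (u : Fin 4 → V) :
    altWedge a a u = 2 * (a ![u 0, u 1] * a ![u 2, u 3] - a ![u 0, u 2] * a ![u 1, u 3]
      + a ![u 0, u 3] * a ![u 1, u 2]) := by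
  refine (altWedge_apply a a u).trans ?_
  have h := sum_sign_perm_fin_four fun i j k l => a ![u i, u j] * a ![u k, u l]
  have h2 : ∀ σ : Equiv.Perm (Fin 4), (a (fun i => u (σ (Fin.castAdd 2 i))) *
        a (fun j => u (σ (Fin.natAdd 2 j)))) =
        a ![u (σ 0), u (σ 1)] * a ![u (σ 2), u (σ 3)] := by
    intro σ
    exact congrArg₂ (· * ·) (alt_two_eta a _) (alt_two_eta a _)
  refine (congrArg _ ((Finset.sum_congr rfl fun σ _ => congrArg _ (h2 σ)).trans h)).trans ?_
  rw [alt_two_swap a (u 1) (u 0), alt_two_swap a (u 2) (u 0), alt_two_swap a (u 3) (u 0),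
    alt_two_swap a (u 2) (u 1), alt_two_swap a (u 3) (u 1), alt_two_swap a (u 3) (u 2)]
  simp
  ring

lemma altWedge_one_two (a : V [⋀^Fin 1]→L[ℝ] ℝ) (b : V [⋀^Fin 2]→L[ℝ] ℝ) (u : Fin 3 → V) :
    altWedge a b u = a ![u 0] * b ![u 1, u 2] - a ![u 1] * b ![u 0, u 2]
      + a ![u 2] * b ![u 0, u 1] := by
  refine (altWedge_apply a b u).trans ?_
  have h := sum_sign_perm_fin_three fun i j k => a ![u i] * b ![u j, u k]
  have h2 : ∀ σ : Equiv.Perm (Fin 3), (a (fun i => u (σ (Fin.castAdd 2 i))) *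
        b (fun j => u (σ (Fin.natAdd 1 j)))) = a ![u (σ 0)] * b ![u (σ 1), u (σ 2)] := by
    intro σ
    rw [alt_one_eta, alt_two_eta b]
    rfl
  refine (congrArg _ ((Finset.sum_congr rfl fun σ _ => congrArg _ (h2 σ)).trans h)).trans ?_
  rw [alt_two_swap b (u 2) (u 1), alt_two_swap b (u 2) (u 0), alt_two_swap b (u 1) (u 0)]
  simp
  ring

end Alt

lemma DiffForm.pullback_wedge {E : Type*} [NormedAddCommGroup E] [NormedSpace ℝ E]
    {H : Type*} [TopologicalSpace H] {I : ModelWithCorners ℝ E H}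
    {M : Type*} [TopologicalSpace M] [ChartedSpace H M]
    {E' : Type*} [NormedAddCommGroup E'] [NormedSpace ℝ E']
    {H' : Type*} [TopologicalSpace H'] {I' : ModelWithCorners ℝ E' H'}
    {N : Type*} [TopologicalSpace N] [ChartedSpace H' N] {k l : ℕ} (f : N → M)
    (θ : DiffForm I M k) (η : DiffForm I M l) :
    ((θ.wedge η).pullback f : DiffForm I' N (k + l)) =
      DiffForm.wedge (θ.pullback f : DiffForm I' N k) (η.pullback f : DiffForm I' N l) :=
  funext fun x => (altWedge_compContinuousLinearMap (θ (f x)) (η (f x)) (mfderiv I' I f x)).symm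

end WedgeFormulas

/-! ### Polynomial forms on `ℝ⁴ × ℝ⁴` and their exterior derivatives -/

section AmbientForms

open Filter Topology

/-- The derivative of a function which is quadratic along a line. -/
lemma fderiv_apply_eq_of_quadratic {V : Type*} [NormedAddCommGroup V] [NormedSpace ℝ V]
    {F : V → ℝ} {p v : V} {a b : ℝ} (hF : DifferentiableAt ℝ F p)
    (h : ∀ t : ℝ, F (p + t • v) = F p + t * a + t ^ 2 * b) : fderiv ℝ F p v = a := by
  rw [← hF.lineDeriv_eq_fderiv, lineDeriv]
  have h2 : HasDerivAt (fun t : ℝ => F p + t * a + t ^ 2 * b) (0 + 1 * a + 2 * 0 ^ 1 * 1 * b) 0 :=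
    ((hasDerivAt_const _ _).add ((hasDerivAt_id 0).mul_const a)).add
      (((hasDerivAt_id (0 : ℝ)).pow 2).mul_const b)
  rw [funext h, h2.deriv]
  simp

namespace SHyp3

/-- The 1-form `⟨v, dx⟩` on `ℝ⁴ × ℝ⁴`. -/
def ambAlpha (p : R4 × R4) : (R4 × R4) [⋀^Fin 1]→L[ℝ] ℝ :=
  ContinuousAlternatingMap.ofSubsingleton ℝ (R4 × R4) ℝ (0 : Fin 1)
    ((lorentzCLM p.2).comp (ContinuousLinearMap.fst ℝ R4 R4))

lemma ambAlpha_apply (p : R4 × R4) (u : Fin 1 → R4 × R4) :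
    ambAlpha p u = lorentz p.2 (u 0).1 := rfl

/-- The 2-form `det(x, v, dx, dx) - det(x, v, dv, dv)` on `ℝ⁴ × ℝ⁴`. -/
def ambPsi (p : R4 × R4) : (R4 × R4) [⋀^Fin 2]→L[ℝ] ℝ where
  __ := ((Matrix.detRowAlternating.curryLeft p.1).curryLeft p.2).compLinearMap
      (LinearMap.fst ℝ R4 R4) -
    ((Matrix.detRowAlternating.curryLeft p.1).curryLeft p.2).compLinearMap
      (LinearMap.snd ℝ R4 R4)
  cont := by
    change Continuous fun u : Fin 2 → R4 × R4 =>
      Matrix.det (Matrix.vecCons p.1 (Matrix.vecCons p.2 fun i => (u i).1)) -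
      Matrix.det (Matrix.vecCons p.1 (Matrix.vecCons p.2 fun i => (u i).2))
    refine Continuous.sub (Continuous.matrix_det ?_) (Continuous.matrix_det ?_)
    · exact continuous_const.matrixVecCons (continuous_const.matrixVecCons (by fun_prop))
    · exact continuous_const.matrixVecCons (continuous_const.matrixVecCons (by fun_prop))

lemma ambPsi_apply (p : R4 × R4) (u : Fin 2 → R4 × R4) :
    ambPsi p u = det4 p.1 p.2 (u 0).1 (u 1).1 - det4 p.1 p.2 (u 0).2 (u 1).2 := by
  change Matrix.det (Matrix.vecCons p.1 (Matrix.vecCons p.2 fun i => (u i).1)) -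
      Matrix.det (Matrix.vecCons p.1 (Matrix.vecCons p.2 fun i => (u i).2)) = _
  unfold det4
  congr 2 <;>
  · ext i j
    fin_cases i <;> rfl

lemma contDiff_alternating_iff {E F : Type*} [NormedAddCommGroup E] [NormedSpace ℝ E]
    [NormedAddCommGroup F] [NormedSpace ℝ F] [FiniteDimensional ℝ E] {k : ℕ} {n : ℕ∞ω}
    {G : F → E [⋀^Fin k]→L[ℝ] ℝ} :
    ContDiff ℝ n G ↔ ∀ v : Fin k → E, ContDiff ℝ n fun y => G y v := by
  simp only [contDiff_iff_contDiffAt]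
  exact ⟨fun h v y => contDiffAt_alternating_iff.1 (h y) v,
    fun h y => contDiffAt_alternating_iff.2 fun v => h v y⟩

lemma contDiff_ambAlpha : ContDiff ℝ ∞ ambAlpha := by
  rw [contDiff_alternating_iff]
  intro u
  simp only [ambAlpha_apply, lorentz]
  fun_prop

lemma contDiff_ambPsi : ContDiff ℝ ∞ ambPsi := by
  rw [contDiff_alternating_iff]
  intro u
  simp only [ambPsi_apply, det4_eq]
  fun_prop

lemma extDeriv_ambAlpha (p : R4 × R4) (u : Fin 2 → R4 × R4) :
    extDeriv ambAlpha p u = lorentz (u 0).2 (u 1).1 - lorentz (u 1).2 (u 0).1 := by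
  have hd : Differentiable ℝ ambAlpha := contDiff_ambAlpha.differentiable (by simp)
  have hv : ∀ (w : Fin 1 → R4 × R4) (z : R4 × R4),
      fderiv ℝ (fun p => ambAlpha p w) p z = lorentz z.2 (w 0).1 := fun w z => by
    refine fderiv_apply_eq_of_quadratic (b := 0) ?_ fun t => ?_
    · exact ((contDiff_alternating_iff.1 contDiff_ambAlpha w).differentiable (by simp)) p
    · simp only [ambAlpha_apply, lorentz, Prod.snd_add, Prod.smul_snd, Pi.add_apply,
        Pi.smul_apply, smul_eq_mul]
      ring
  rw [extDeriv_apply (hd p), Fin.sum_univ_two, hv, hv]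
  simp [Fin.removeNth]
  ring

lemma extDeriv_ambPsi (p : R4 × R4) (u : Fin 3 → R4 × R4) :
    extDeriv ambPsi p u =
      (det4 (u 0).1 p.2 (u 1).1 (u 2).1 + det4 p.1 (u 0).2 (u 1).1 (u 2).1
        - det4 (u 0).1 p.2 (u 1).2 (u 2).2 - det4 p.1 (u 0).2 (u 1).2 (u 2).2)
      - (det4 (u 1).1 p.2 (u 0).1 (u 2).1 + det4 p.1 (u 1).2 (u 0).1 (u 2).1
        - det4 (u 1).1 p.2 (u 0).2 (u 2).2 - det4 p.1 (u 1).2 (u 0).2 (u 2).2)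
      + (det4 (u 2).1 p.2 (u 0).1 (u 1).1 + det4 p.1 (u 2).2 (u 0).1 (u 1).1
        - det4 (u 2).1 p.2 (u 0).2 (u 1).2 - det4 p.1 (u 2).2 (u 0).2 (u 1).2) := by
  have hd : Differentiable ℝ ambPsi := contDiff_ambPsi.differentiable (by simp)
  have hv : ∀ (w : Fin 2 → R4 × R4) (z : R4 × R4),
      fderiv ℝ (fun p => ambPsi p w) p z = det4 z.1 p.2 (w 0).1 (w 1).1 +
        det4 p.1 z.2 (w 0).1 (w 1).1 - det4 z.1 p.2 (w 0).2 (w 1).2 -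
        det4 p.1 z.2 (w 0).2 (w 1).2 := fun w z => by
    refine fderiv_apply_eq_of_quadratic
      -- The coefficient is bilinear in `(x, v)`; `b` is its second-order term along `z`.
      (b := det4 z.1 z.2 (w 0).1 (w 1).1 - det4 z.1 z.2 (w 0).2 (w 1).2) ?_ fun t => ?_
    · exact ((contDiff_alternating_iff.1 contDiff_ambPsi w).differentiable (by simp)) p
    · simp only [ambPsi_apply, det4_eq, Prod.snd_add, Prod.fst_add, Prod.smul_fst, Prod.smul_snd,
        Pi.add_apply, Pi.smul_apply, smul_eq_mul]
      ring
  rw [extDeriv_apply (hd p), Fin.sum_univ_three, hv, hv, hv]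
  simp [Fin.removeNth, Fin.succAbove]
  ring

/-- The 3-form `α ∧ dα` on `ℝ⁴ × ℝ⁴`. -/
def ambBeta (p : R4 × R4) : (R4 × R4) [⋀^Fin 3]→L[ℝ] ℝ :=
  altWedge (ambAlpha p) (extDeriv ambAlpha p)

lemma ambBeta_apply (p : R4 × R4) (u : Fin 3 → R4 × R4) : ambBeta p u =
    lorentz p.2 (u 0).1 * (lorentz (u 1).2 (u 2).1 - lorentz (u 2).2 (u 1).1)
    - lorentz p.2 (u 1).1 * (lorentz (u 0).2 (u 2).1 - lorentz (u 2).2 (u 0).1)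
    + lorentz p.2 (u 2).1 * (lorentz (u 0).2 (u 1).1 - lorentz (u 1).2 (u 0).1) := by
  refine (altWedge_one_two _ _ u).trans ?_
  simp only [extDeriv_ambAlpha, ambAlpha_apply]
  rfl

lemma contDiff_ambBeta : ContDiff ℝ ∞ ambBeta := by
  rw [contDiff_alternating_iff]
  intro u
  simp only [ambBeta_apply, lorentz]
  fun_prop

/-- The form `dα` has constant coefficients and `α` is linear in the base point, so `α∧dα` is linear
in the base point too and its derivative along `z` is its value at `z`. -/
lemma extDeriv_ambBeta (p : R4 × R4) :
    extDeriv ambBeta p = altWedge (extDeriv ambAlpha p) (extDeriv ambAlpha p) := by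
  refine ContinuousAlternatingMap.ext fun (u : Fin 4 → R4 × R4) => ?_
  have hd : Differentiable ℝ ambBeta := contDiff_ambBeta.differentiable (by simp)
  have hv : ∀ (w : Fin 3 → R4 × R4) (z : R4 × R4),
      fderiv ℝ (fun p => ambBeta p w) p z = ambBeta z w := fun w z => by
    refine fderiv_apply_eq_of_quadratic (b := 0) ?_ fun t => ?_
    · exact ((contDiff_alternating_iff.1 contDiff_ambBeta w).differentiable (by simp)) p
    · simp only [ambBeta_apply, Prod.snd_add, Prod.smul_snd, lorentz_add_left, lorentz_smul_left]
      ring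
  refine Eq.trans ?_ (altWedge_two_two _ u).symm
  rw [extDeriv_apply (hd p), Fin.sum_univ_four, hv, hv, hv, hv]
  simp only [ambBeta_apply, extDeriv_ambAlpha]
  simp [Fin.removeNth, Fin.succAbove]
  ring

end SHyp3

end AmbientForms

/-! ### The forms `α` and `ψ` on `SH³` -/

section FormsOnSHyp3

open Filter Topology

namespace SHyp3

lemma det4_add_smul (x v a b : R4) (s t : ℝ) :
    det4 x v (a + s • x) (b + t • x) = det4 x v a b := by
  simp only [det4_eq, Pi.add_apply, Pi.smul_apply, smul_eq_mul]; ring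

lemma alpha_apply (q : SHyp3) (ξ : TangentSpace I5 q) :
    alpha q ![ξ] = lorentz q.vec (q.hor ξ) := rfl

/-- The restriction to `SH³` of a form on `ℝ⁴ × ℝ⁴`. -/
def inclPullback {k : ℕ} (F : R4 × R4 → (R4 × R4) [⋀^Fin k]→L[ℝ] ℝ) : DiffForm I5 SHyp3 k :=
  fun q => (F q.incl).compContinuousLinearMap q.dincl

lemma inclPullback_apply {k : ℕ} (F : R4 × R4 → (R4 × R4) [⋀^Fin k]→L[ℝ] ℝ) (q : SHyp3)
    (u : Fin k → TangentSpace I5 q) : inclPullback F q u = F q.incl fun i => q.dincl (u i) := rfl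

lemma inclPullback_wedge {k l : ℕ} (F : R4 × R4 → (R4 × R4) [⋀^Fin k]→L[ℝ] ℝ)
    (G : R4 × R4 → (R4 × R4) [⋀^Fin l]→L[ℝ] ℝ) :
    (inclPullback F).wedge (inclPullback G) = inclPullback fun p => altWedge (F p) (G p) :=
  funext fun q => altWedge_compContinuousLinearMap (F q.incl) (G q.incl) q.dincl

lemma alpha_eq_pullback :
    alpha = inclPullback ambAlpha := by
  ext q u
  change lorentz q.vec (q.hor (u 0)) = lorentz q.vec (q.dincl (u 0)).1
  rw [fst_dincl]

lemma smoothAt_pullback_incl {k : ℕ} {F : R4 × R4 → (R4 × R4) [⋀^Fin k]→L[ℝ] ℝ}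
    (hF : ContDiff ℝ ∞ F) (q : SHyp3) :
    (inclPullback F).SmoothAt q :=
  DiffForm.SmoothAt.pullback (DiffForm.smoothAt_vectorSpace.2 hF.contDiffAt) (contMDiff_incl q)

lemma d_pullback_incl {k : ℕ} {F : R4 × R4 → (R4 × R4) [⋀^Fin k]→L[ℝ] ℝ}
    (hF : ContDiff ℝ ∞ F) :
    (inclPullback F).d =
      inclPullback (extDeriv F) := by
  funext q
  refine (DiffForm.SmoothAt.d_pullback (DiffForm.smoothAt_vectorSpace.2 hF.contDiffAt)
    (contMDiff_incl q)).trans ?_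
  exact congrArg (fun A : (R4 × R4) [⋀^Fin (k + 1)]→L[ℝ] ℝ =>
    A.compContinuousLinearMap q.dincl) (DiffForm.d_vectorSpace F q.incl)

lemma smoothAt_alpha (q : SHyp3) : alpha.SmoothAt q := by
  rw [alpha_eq_pullback]
  exact smoothAt_pullback_incl contDiff_ambAlpha q

lemma d_alpha_eq_pullback : alpha.d =
    inclPullback (extDeriv ambAlpha) := by
  rw [alpha_eq_pullback, d_pullback_incl contDiff_ambAlpha]

/-- Passing from `dv` to the vertical component drops a multiple of `x`, which is orthogonal to
every horizontal component. -/
lemma d_alpha_apply (q : SHyp3) (ξ η : TangentSpace I5 q) :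
    alpha.d q ![ξ, η] = lorentz (q.ver ξ) (q.hor η) - lorentz (q.ver η) (q.hor ξ) := by
  rw [d_alpha_eq_pullback, inclPullback_apply]
  refine (extDeriv_ambAlpha q.incl _).trans ?_
  change lorentz (q.dincl ξ).2 (q.dincl η).1 - lorentz (q.dincl η).2 (q.dincl ξ).1 = _
  rw [dincl_snd, dincl_snd, fst_dincl, fst_dincl]
  simp only [lorentz_add_left, lorentz_smul_left, lorentz_foot_hor]
  ring

/-- The 2-form `ψ` on `SH³`. -/
def psi : DiffForm I5 SHyp3 2 :=
  inclPullback ambPsi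

lemma smoothAt_psi (q : SHyp3) : psi.SmoothAt q := smoothAt_pullback_incl contDiff_ambPsi q

lemma psi_apply (q : SHyp3) (ξ η : TangentSpace I5 q) :
    psi q ![ξ, η] = det4 q.foot q.vec (q.hor ξ) (q.hor η) -
      det4 q.foot q.vec (q.ver ξ) (q.ver η) := by
  rw [psi, inclPullback_apply]
  refine (ambPsi_apply q.incl _).trans ?_
  change det4 q.foot q.vec (q.dincl ξ).1 (q.dincl η).1 -
    det4 q.foot q.vec (q.dincl ξ).2 (q.dincl η).2 = _
  rw [dincl_snd, dincl_snd, fst_dincl, fst_dincl, det4_add_smul]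

/-- The values of `rot` are orthogonal to `x` and `v`, so the pair satisfies the tangent equations.
The `Function.invFun` in `J` therefore returns a genuine preimage. -/
lemma hor_ver_J (q : SHyp3) (ξ : TangentSpace I5 q) :
    q.hor (q.J ξ) = q.rot (q.ver ξ) ∧ q.ver (q.J ξ) = q.rot (q.hor ξ) := by
  obtain ⟨η, h1, h2⟩ := exists_hor_ver q (h := q.rot (q.ver ξ)) (w := q.rot (q.hor ξ))
    (lorentz_foot_rot q _) (lorentz_foot_rot q _) (lorentz_vec_rot q _)
  have h := Function.invFun_eq (f := fun η : TangentSpace I5 q => (q.hor η, q.ver η))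
    (b := (q.rot (q.ver ξ), q.rot (q.hor ξ))) ⟨η, Prod.ext h1 h2⟩
  exact ⟨congrArg Prod.fst h, congrArg Prod.snd h⟩

lemma psi_eq_d_alpha_J (q : SHyp3) (ξ η : TangentSpace I5 q) :
    psi q ![ξ, η] = alpha.d q ![q.J ξ, η] := by
  rw [psi_apply, d_alpha_apply, (hor_ver_J q ξ).1, (hor_ver_J q ξ).2, lorentz_comm (q.ver η),
    lorentz_rot, lorentz_rot]

/-- Coordinates of a tangent vector in an adapted frame. -/
lemma exists_frame_coords (q : SHyp3) : ∃ M : Matrix (Fin 4) (Fin 4) ℝ, M.det = 1 ∧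
    Matrix.vecMul ![1, 0, 0, 0] M = q.foot ∧ Matrix.vecMul ![0, 1, 0, 0] M = q.vec ∧
    (∀ a b, lorentz (Matrix.vecMul a M) (Matrix.vecMul b M) = lorentz a b) ∧
    ∀ ξ : TangentSpace I5 q, ∃ a h₁ h₂ v₁ v₂ : ℝ,
      q.hor ξ = Matrix.vecMul ![0, a, h₁, h₂] M ∧ q.ver ξ = Matrix.vecMul ![0, 0, v₁, v₂] M := by
  obtain ⟨M, hM, h0, h1, hl⟩ := exists_frame q
  refine ⟨M, hM, h0, h1, hl, fun ξ => ?_⟩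
  have hinv : ∀ y : R4, Matrix.vecMul (Matrix.vecMul y M⁻¹) M = y := fun y => by
    rw [Matrix.vecMul_vecMul, Matrix.nonsing_inv_mul _ (by rw [hM]; exact isUnit_one),
      Matrix.vecMul_one]
  set h := Matrix.vecMul (q.hor ξ) M⁻¹ with hh
  set w := Matrix.vecMul (q.ver ξ) M⁻¹ with hw
  have e1 : lorentz ![1, 0, 0, 0] h = 0 := by
    rw [← hl, h0, hh, hinv, lorentz_foot_hor]
  have e2 : lorentz ![1, 0, 0, 0] w = 0 := by
    rw [← hl, h0, hw, hinv, lorentz_foot_ver]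
  have e3 : lorentz ![0, 1, 0, 0] w = 0 := by
    rw [← hl, h1, hw, hinv, lorentz_vec_ver]
  simp [lorentz] at e1 e2 e3
  refine ⟨h 1, h 2, h 3, w 2, w 3, ?_, ?_⟩
  · rw [← hinv (q.hor ξ), ← hh]
    congr 1
    funext i; fin_cases i <;> simp [e1]
  · rw [← hinv (q.ver ξ), ← hw]
    congr 1
    funext i; fin_cases i <;> simp [e2, e3]

/-- The ambient form is not closed; only its restriction is. On tangent vectors `det(dx, v, dx, dx)`
and `det(x, dv, dv, dv)` vanish for lack of rank, and the remaining terms `det(x, dv, dx, dx)` and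
`-det(dx, v, dv, dv)` cancel because the `v`-component of `dx` equals the `x`-component of `dv`. -/
lemma d_psi : psi.d = 0 := by
  ext q u
  rw [psi, d_pullback_incl contDiff_ambPsi, inclPullback_apply]
  refine (extDeriv_ambPsi q.incl _).trans ?_
  obtain ⟨M, hM, h0, h1, hl, hc⟩ := exists_frame_coords q
  obtain ⟨a, b, c, d, e, hu, wu⟩ := hc (u 0)
  obtain ⟨a', b', c', d', e', hu', wu'⟩ := hc (u 1)
  obtain ⟨a'', b'', c'', d'', e'', hu'', wu''⟩ := hc (u 2)
  have key : ∀ ξ : TangentSpace I5 q, q.dincl ξ =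
      (q.hor ξ, q.ver ξ + lorentz q.vec (q.hor ξ) • q.foot) := fun ξ =>
    Prod.ext (fst_dincl q ξ) (dincl_snd q ξ)
  simp only [key]
  change _ = (0 : ℝ)
  rw [hu, hu', hu'', wu, wu', wu'']
  -- The frame matrix preserves the Lorentz form and has determinant one, so it disappears and a
  -- polynomial identity in the frame coordinates is left.
  simp only [incl, ← h0, ← h1, hl, ← Matrix.smul_vecMul, ← Matrix.add_vecMul, det4_vecMul, hM]
  simp only [det4_eq, lorentz]
  simp
  ring

lemma d_alpha_wedge_d_alpha :
    (alpha.wedge alpha.d).d = (psi.wedge psi : DiffForm I5 SHyp3 4) := by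
  have hβ : alpha.wedge alpha.d =
      inclPullback ambBeta := by
    rw [d_alpha_eq_pullback]
    nth_rw 1 [alpha_eq_pullback]
    rw [inclPullback_wedge]
    rfl
  refine (congrArg DiffForm.d hβ).trans ?_
  refine (d_pullback_incl contDiff_ambBeta).trans ?_
  have h1 : inclPullback (extDeriv ambBeta) =
      DiffForm.wedge alpha.d alpha.d := by
    rw [d_alpha_eq_pullback, inclPullback_wedge]
    exact congrArg inclPullback (funext extDeriv_ambBeta)
  refine h1.trans ?_
  funext q
  refine ContinuousAlternatingMap.ext fun (u : Fin 4 → TangentSpace I5 q) => ?_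
  refine (altWedge_two_two _ u).trans (Eq.trans ?_ (altWedge_two_two _ u).symm)
  obtain ⟨M, hM, h0, h1, hl, hc⟩ := exists_frame_coords q
  obtain ⟨a, b, c, d, e, hu, wu⟩ := hc (u 0)
  obtain ⟨a', b', c', d', e', hu', wu'⟩ := hc (u 1)
  obtain ⟨a'', b'', c'', d'', e'', hu'', wu''⟩ := hc (u 2)
  obtain ⟨a3, b3, c3, d3, e3, hu3, wu3⟩ := hc (u 3)
  simp only [d_alpha_apply, psi_apply]
  rw [hu, hu', hu'', wu, wu', wu'', hu3, wu3]
  simp only [← h0, ← h1, hl, det4_vecMul, hM]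
  simp only [det4_eq, lorentz]
  simp
  ring

lemma smoothAt_alpha_wedge_d_alpha (q : SHyp3) : (alpha.wedge alpha.d).SmoothAt q := by
  have hβ : alpha.wedge alpha.d =
      inclPullback ambBeta := by
    rw [d_alpha_eq_pullback]
    nth_rw 1 [alpha_eq_pullback]
    rw [inclPullback_wedge]
    rfl
  rw [hβ]
  exact smoothAt_pullback_incl contDiff_ambBeta q

end SHyp3

end FormsOnSHyp3

/-! ### Invariance under isometries and the flow; the covering `SH³ → SM` -/

section Descent

open Filter Topology

namespace SHyp3

/-- If `f : SH³ → SH³` is the restriction of the linear map `L`, so is its differential. -/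
lemma dincl_mfderiv {f : SHyp3 → SHyp3} (hf : ContMDiff I5 I5 ∞ f)
    (L : R4 × R4 →L[ℝ] R4 × R4) (hL : ∀ q, (f q).incl = L q.incl) (q : SHyp3)
    (ξ : TangentSpace I5 q) : (f q).dincl (mfderiv I5 I5 f q ξ) = L (q.dincl ξ) := by
  have h1 := mfderiv_comp q (mdifferentiableAt_incl (f q))
    ((hf q).mdifferentiableAt (by simp))
  have h2 := mfderiv_comp (I' := 𝓘(ℝ, R4 × R4)) (I'' := 𝓘(ℝ, R4 × R4)) q
    (L.mdifferentiableAt) (mdifferentiableAt_incl q)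
  rw [ContinuousLinearMap.mfderiv_eq] at h2
  have h3 : incl ∘ f = L ∘ incl := funext hL
  rw [h3] at h1
  exact congrArg (fun T => T ξ) (h1.symm.trans h2)

lemma pullback_inclPullback {f : SHyp3 → SHyp3} (hf : ContMDiff I5 I5 ∞ f)
    (L : R4 × R4 →L[ℝ] R4 × R4) (hL : ∀ q, (f q).incl = L q.incl) {k : ℕ}
    {F : R4 × R4 → (R4 × R4) [⋀^Fin k]→L[ℝ] ℝ} (hF : ∀ p u, F (L p) (fun i => L (u i)) = F p u) :
    ((inclPullback F).pullback f : DiffForm I5 SHyp3 k) = inclPullback F := by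
  ext q u
  rw [DiffForm.pullback_apply, inclPullback_apply, inclPullback_apply, hL]
  simp only [dincl_mfderiv hf L hL]
  exact hF _ _

/-- The linear map of `ℝ⁴ × ℝ⁴` induced by an isometry. -/
def smulCLM (A : HypIsom) : R4 × R4 →L[ℝ] R4 × R4 :=
  (Matrix.mulVecLin A.1.1).toContinuousLinearMap.prodMap
    (Matrix.mulVecLin A.1.1).toContinuousLinearMap

lemma smulCLM_apply (A : HypIsom) (p : R4 × R4) :
    smulCLM A p = (A.1.1.mulVec p.1, A.1.1.mulVec p.2) := rfl

lemma incl_smul (A : HypIsom) (q : SHyp3) : (A • q).incl = smulCLM A q.incl := rfl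

lemma foot_smul (A : HypIsom) (q : SHyp3) : (A • q).foot = A.1.1.mulVec q.foot := rfl

lemma vec_smul (A : HypIsom) (q : SHyp3) : (A • q).vec = A.1.1.mulVec q.vec := rfl

lemma contMDiff_smul (A : HypIsom) : ContMDiff I5 I5 ∞ fun q : SHyp3 => A • q :=
  contMDiff_of_foot_vec
    ((Matrix.mulVecLin A.1.1).toContinuousLinearMap.contDiff.contMDiff.comp contMDiff_foot)
    ((Matrix.mulVecLin A.1.1).toContinuousLinearMap.contDiff.contMDiff.comp contMDiff_vec)

lemma lorentz_mulVec (A : HypIsom) (x y : R4) :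
    lorentz (A.1.1.mulVec x) (A.1.1.mulVec y) = lorentz x y := A.2.1 x y

lemma det4_mulVec (A : HypIsom) (a b c d : R4) :
    det4 (A.1.1.mulVec a) (A.1.1.mulVec b) (A.1.1.mulVec c) (A.1.1.mulVec d) =
      det4 a b c d := by
  simp only [← Matrix.vecMul_transpose]
  rw [det4_vecMul, Matrix.det_transpose, A.1.2, mul_one]

lemma hor_smul (A : HypIsom) (q : SHyp3) (ξ : TangentSpace I5 q) :
    (A • q).hor (mfderiv I5 I5 (fun q : SHyp3 => A • q) q ξ) = A.1.1.mulVec (q.hor ξ) := by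
  rw [← fst_dincl, dincl_mfderiv (contMDiff_smul A) (smulCLM A) (incl_smul A), smulCLM_apply,
    fst_dincl]

lemma ver_smul (A : HypIsom) (q : SHyp3) (ξ : TangentSpace I5 q) :
    (A • q).ver (mfderiv I5 I5 (fun q : SHyp3 => A • q) q ξ) = A.1.1.mulVec (q.ver ξ) := by
  rw [ver_apply, dincl_mfderiv (contMDiff_smul A) (smulCLM A) (incl_smul A), smulCLM_apply,
    ver_apply, foot_smul]
  simp only [lorentz_mulVec, Matrix.mulVec_add, Matrix.mulVec_smul]

lemma eq_of_lorentz_eq {x y : R4} (h : ∀ z, lorentz x z = lorentz y z) : x = y := by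
  funext i
  have h0 := h (Pi.single 0 1)
  have h1 := h (Pi.single 1 1)
  have h2 := h (Pi.single 2 1)
  have h3 := h (Pi.single 3 1)
  simp [lorentz] at h0 h1 h2 h3
  fin_cases i
  exacts [h0, h1, h2, h3]

/-- Pairing with an arbitrary vector reduces this to invariance of the determinant. Here
preservation of orientation enters: `det A = 1`, not merely `±1`. -/
lemma rot_smul (A : HypIsom) (q : SHyp3) (w : R4) :
    (A • q).rot (A.1.1.mulVec w) = A.1.1.mulVec (q.rot w) := by
  refine eq_of_lorentz_eq fun z => ?_
  obtain ⟨y, rfl⟩ : ∃ y, A.1.1.mulVec y = z := ⟨(A⁻¹).1.1.mulVec z, by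
    rw [Matrix.mulVec_mulVec, ← Matrix.SpecialLinearGroup.coe_mul, ← Subgroup.coe_mul,
      mul_inv_cancel, Subgroup.coe_one, Matrix.SpecialLinearGroup.coe_one, Matrix.one_mulVec]⟩
  rw [lorentz_rot, lorentz_mulVec, lorentz_rot, foot_smul, vec_smul, det4_mulVec]

lemma J_smul (A : HypIsom) (q : SHyp3) (ξ : TangentSpace I5 q) :
    (A • q).J (mfderiv I5 I5 (fun q : SHyp3 => A • q) q ξ) =
      mfderiv I5 I5 (fun q : SHyp3 => A • q) q (q.J ξ) := by
  refine (A • q).hor_ver_injective (Prod.ext ?_ ?_)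
  · change (A • q).hor _ = (A • q).hor _
    rw [(hor_ver_J _ _).1, ver_smul, rot_smul, hor_smul, (hor_ver_J _ _).1]
  · change (A • q).ver _ = (A • q).ver _
    rw [(hor_ver_J _ _).2, hor_smul, rot_smul, ver_smul, (hor_ver_J _ _).2]

lemma alpha_pullback_smul (A : HypIsom) :
    (alpha.pullback (fun q : SHyp3 => A • q) : DiffForm I5 SHyp3 1) = alpha := by
  rw [alpha_eq_pullback]
  refine pullback_inclPullback (contMDiff_smul A) (smulCLM A) (incl_smul A) fun p u => ?_
  exact lorentz_mulVec A _ _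

lemma psi_pullback_smul (A : HypIsom) :
    (psi.pullback (fun q : SHyp3 => A • q) : DiffForm I5 SHyp3 2) = psi := by
  refine pullback_inclPullback (contMDiff_smul A) (smulCLM A) (incl_smul A) fun p u => ?_
  simp only [ambPsi_apply, smulCLM_apply, det4_mulVec]

/-- The linear map of `ℝ⁴ × ℝ⁴` inducing the geodesic flow. -/
def flowCLM (t : ℝ) : R4 × R4 →L[ℝ] R4 × R4 :=
  (Real.cosh t • ContinuousLinearMap.fst ℝ R4 R4 +
    Real.sinh t • ContinuousLinearMap.snd ℝ R4 R4).prod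
  (Real.sinh t • ContinuousLinearMap.fst ℝ R4 R4 + Real.cosh t • ContinuousLinearMap.snd ℝ R4 R4)

lemma flowCLM_apply (t : ℝ) (p : R4 × R4) : flowCLM t p =
    (Real.cosh t • p.1 + Real.sinh t • p.2, Real.sinh t • p.1 + Real.cosh t • p.2) := rfl

lemma incl_geodesicFlow (t : ℝ) (q : SHyp3) : (geodesicFlow t q).incl = flowCLM t q.incl := rfl

lemma contMDiff_geodesicFlow (t : ℝ) : ContMDiff I5 I5 ∞ (geodesicFlow t) :=
  contMDiff_of_foot_vec
    ((Real.cosh t • ContinuousLinearMap.fst ℝ R4 R4 +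
      Real.sinh t • ContinuousLinearMap.snd ℝ R4 R4).contDiff.contMDiff.comp contMDiff_incl)
    ((Real.sinh t • ContinuousLinearMap.fst ℝ R4 R4 +
      Real.cosh t • ContinuousLinearMap.snd ℝ R4 R4).contDiff.contMDiff.comp contMDiff_incl)

lemma psi_pullback_geodesicFlow (t : ℝ) :
    (psi.pullback (geodesicFlow t) : DiffForm I5 SHyp3 2) = psi := by
  refine pullback_inclPullback (contMDiff_geodesicFlow t) (flowCLM t) (incl_geodesicFlow t)
    fun p u => ?_
  -- One factor `c² - s²` comes from mixing `x` and `v` in the first two rows. The other comes from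
  -- the difference of the two determinants, in which the mixed terms in `a, b'` and `b, a'` cancel.
  -- Both equal 1 for `c = cosh t`, `s = sinh t`.
  have key : ∀ (c s : ℝ) (x v a b a' b' : R4),
      det4 (c • x + s • v) (s • x + c • v) (c • a + s • b) (c • a' + s • b') -
        det4 (c • x + s • v) (s • x + c • v) (s • a + c • b) (s • a' + c • b') =
      (c ^ 2 - s ^ 2) * (c ^ 2 - s ^ 2) * (det4 x v a a' - det4 x v b b') := by
    intro c s x v a b a' b'
    simp only [det4_eq, Pi.add_apply, Pi.smul_apply, smul_eq_mul]
    ring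
  simp only [ambPsi_apply, flowCLM_apply, key, Real.cosh_sq']
  ring

end SHyp3

namespace SM

variable (Γ : Subgroup HypIsom)

lemma cover_smul (γ : Γ) (q : SHyp3) : cover Γ (γ.1 • q) = cover Γ q :=
  Quotient.sound ⟨γ, rfl⟩

lemma exists_smul_of_cover_eq {a b : SHyp3} (h : cover Γ a = cover Γ b) :
    ∃ γ : Γ, γ.1 • a = b := by
  obtain ⟨γ, hγ⟩ := Quotient.exact h.symm
  exact ⟨γ, hγ⟩

lemma cover_surjective : Function.Surjective (cover Γ) := Quotient.mk_surjective

lemma hasSmoothDeckMaps_cover : HasSmoothDeckMaps I5 (cover Γ) := by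
  intro a b h
  obtain ⟨γ, hγ⟩ := exists_smul_of_cover_eq Γ h
  exact ⟨fun q => γ.1 • q, SHyp3.contMDiff_smul γ.1, hγ, funext fun q => cover_smul Γ γ q⟩

variable [ProperlyDiscontinuousSMul Γ Hyp3] [IsCancelSMul Γ Hyp3]

lemma isLocalHomeomorph_cover : IsLocalHomeomorph (cover Γ) :=
  (isQuotientCoveringMap_quotientMk_of_properlyDiscontinuousSMul
    (G := Γ) (E := SHyp3)).isCoveringMap.isLocalHomeomorph

instance : IsManifold I5 ∞ (SM Γ) :=
  (hasSmoothDeckMaps_cover Γ).isManifold (isLocalHomeomorph_cover Γ)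
    (Quotient.mk_surjective (s := MulAction.orbitRel Γ SHyp3)).hasRightInverse.choose_spec

lemma contMDiff_cover : ContMDiff I5 I5 ∞ (cover Γ) :=
  (hasSmoothDeckMaps_cover Γ).contMDiff (isLocalHomeomorph_cover Γ)
    (Quotient.mk_surjective (s := MulAction.orbitRel Γ SHyp3)).hasRightInverse.choose_spec

lemma mdifferentiableAt_cover (q : SHyp3) : MDifferentiableAt I5 I5 (cover Γ) q :=
  (contMDiff_cover Γ q).mdifferentiableAt (by simp)

/-- The section of the covering through `q`. -/
def localSection (q : SHyp3) : SM Γ → SHyp3 := (isLocalHomeomorph_cover Γ).localInverseAt q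

lemma contMDiffAt_localSection (q : SHyp3) :
    ContMDiffAt I5 I5 ∞ (localSection Γ q) (cover Γ q) :=
  (hasSmoothDeckMaps_cover Γ).contMDiffAt_localInverseAt (isLocalHomeomorph_cover Γ)
    (Quotient.mk_surjective (s := MulAction.orbitRel Γ SHyp3)).hasRightInverse.choose_spec q

lemma localSection_cover (q : SHyp3) : localSection Γ q (cover Γ q) = q :=
  (isLocalHomeomorph_cover Γ).localInverseAt_apply_self

lemma cover_localSection (q : SHyp3) : ∀ᶠ y in 𝓝 (cover Γ q), cover Γ (localSection Γ q y) = y := by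
  filter_upwards [((isLocalHomeomorph_cover Γ).localInverseAt q).open_source.mem_nhds
    (isLocalHomeomorph_cover Γ).apply_self_mem_localInverseAt_source] with y hy
  exact (isLocalHomeomorph_cover Γ).apply_localInverseAt_of_mem hy

lemma localSection_comp_cover (q : SHyp3) : localSection Γ q ∘ cover Γ =ᶠ[𝓝 q] id := by
  filter_upwards [((isLocalHomeomorph_cover Γ).localInverseAt q).open_target.mem_nhds
    (isLocalHomeomorph_cover Γ).self_mem_localInverseAt_target] with x hx
  have h := ((isLocalHomeomorph_cover Γ).localInverseAt q).right_inv hx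
  rwa [(isLocalHomeomorph_cover Γ).localInverseAt_symm] at h

end SM

end Descent

/-! ### Forms on the quotient `SM` -/

section FormsOnSM

open Filter Topology

namespace DiffForm

variable {E : Type*} [NormedAddCommGroup E] [NormedSpace ℝ E]
  {H : Type*} [TopologicalSpace H] {I : ModelWithCorners ℝ E H}
  {M : Type*} [TopologicalSpace M] [ChartedSpace H M]

lemma pullback_apply_two {E' : Type*} [NormedAddCommGroup E'] [NormedSpace ℝ E']
    {H' : Type*} [TopologicalSpace H'] {I' : ModelWithCorners ℝ E' H'}
    {N : Type*} [TopologicalSpace N] [ChartedSpace H' N] (f : N → M) (θ : DiffForm I M 2) (x : N)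
    (u w : TangentSpace I' x) : (θ.pullback f : DiffForm I' N 2) x ![u, w] =
      θ (f x) ![mfderiv I' I f x u, mfderiv I' I f x w] :=
  alt_two_eta (θ (f x)) _

lemma pullback_apply_one {E' : Type*} [NormedAddCommGroup E'] [NormedSpace ℝ E']
    {H' : Type*} [TopologicalSpace H'] {I' : ModelWithCorners ℝ E' H'}
    {N : Type*} [TopologicalSpace N] [ChartedSpace H' N] (f : N → M) (θ : DiffForm I M 1) (x : N)
    (u : TangentSpace I' x) : (θ.pullback f : DiffForm I' N 1) x ![u] =
      θ (f x) ![mfderiv I' I f x u] :=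
  alt_one_eta (θ (f x)) _

lemma mem_kernel_two {θ : DiffForm I M 2} {x : M} {ξ : TangentSpace I x} :
    ξ ∈ θ.kernel x ↔ ∀ η : TangentSpace I x, θ x ![ξ, η] = 0 := by
  constructor
  · intro h η
    exact congrArg (fun A : E [⋀^Fin 1]→L[ℝ] ℝ => A ![η]) h
  · intro h
    refine ContinuousAlternatingMap.ext fun (u : Fin 1 → E) => ?_
    refine Eq.trans ?_ (h (u 0))
    exact alt_two_eta (θ x) _

end DiffForm

namespace SM

variable (Γ : Subgroup HypIsom) [ProperlyDiscontinuousSMul Γ Hyp3] [IsCancelSMul Γ Hyp3]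

/-- The differential of the covering. -/
def dcover (q : SHyp3) : E5 →L[ℝ] E5 := mfderiv I5 I5 (cover Γ) q

/-- The local section through `q` is a smooth left inverse of the covering near `q`. -/
lemma dcover_injective (q : SHyp3) : Function.Injective (dcover Γ q) := by
  have h1 := mfderiv_comp q ((contMDiffAt_localSection Γ q).mdifferentiableAt (by simp))
    (mdifferentiableAt_cover Γ q)
  rw [(localSection_comp_cover Γ q).mfderiv_eq, mfderiv_id] at h1
  intro ξ η h
  have h2 : ∀ ζ : E5, ζ = mfderiv I5 I5 (localSection Γ q) (cover Γ q) (dcover Γ q ζ) := fun ζ =>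
    congrArg (fun L => L ζ) h1
  rw [h2 ξ, h2 η, h]

lemma dcover_surjective (q : SHyp3) : Function.Surjective (dcover Γ q) :=
  (LinearMap.injective_iff_surjective (f := (dcover Γ q).toLinearMap)).1 (dcover_injective Γ q)

lemma inverse_dcover (q : SHyp3) (ξ : E5) :
    ContinuousLinearMap.inverse (dcover Γ q) (dcover Γ q ξ) = ξ := by
  let e : E5 ≃L[ℝ] E5 := (LinearEquiv.ofBijective (dcover Γ q).toLinearMap
    ⟨dcover_injective Γ q, dcover_surjective Γ q⟩).toContinuousLinearEquiv
  have he : (e : E5 →L[ℝ] E5) = dcover Γ q := 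
    ContinuousLinearMap.ext fun ζ => rfl
  rw [← he, ContinuousLinearMap.inverse_equiv]
  exact e.symm_apply_apply ξ

lemma dcover_smul (γ : Γ) (q : SHyp3) (ξ : E5) :
    dcover Γ (γ.1 • q) (mfderiv I5 I5 (fun q : SHyp3 => γ.1 • q) q ξ) = dcover Γ q ξ := by
  have h1 := mfderiv_comp q (mdifferentiableAt_cover Γ (γ.1 • q))
    ((SHyp3.contMDiff_smul γ.1 q).mdifferentiableAt (by simp))
  have h2 : cover Γ ∘ (fun q : SHyp3 => γ.1 • q) = cover Γ := funext fun q => cover_smul Γ γ q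
  rw [h2] at h1
  exact (congrArg (fun L => L ξ) h1).symm

/-- Lifting a tangent vector at `cover q` amounts to moving its lift at `q` by an element of the
group. -/
lemma exists_lift_eq (q : SHyp3) : ∃ γ : Γ, γ.1 • q = Quotient.out (cover Γ q) ∧
    ∀ ξ : E5, lift Γ (cover Γ q) (dcover Γ q ξ) =
      mfderiv I5 I5 (fun q : SHyp3 => γ.1 • q) q ξ := by
  obtain ⟨γ, hγ⟩ := exists_smul_of_cover_eq Γ (a := q) (b := Quotient.out (cover Γ q))
    (Quotient.out_eq (cover Γ q)).symm
  refine ⟨γ, hγ, fun ξ => ?_⟩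
  have key : ∀ p, γ.1 • q = p → ContinuousLinearMap.inverse (dcover Γ p) (dcover Γ q ξ) =
      mfderiv I5 I5 (fun q : SHyp3 => γ.1 • q) q ξ := by
    rintro _ rfl
    rw [← dcover_smul Γ γ q ξ]
    exact inverse_dcover Γ (γ.1 • q) _
  exact key _ hγ

/-- The form on `SM` induced by an invariant form on `SH³`. -/
def descend {k : ℕ} (θ : DiffForm I5 SHyp3 k) : DiffForm I5 (SM Γ) k := fun y =>
  (θ (Quotient.out y)).compContinuousLinearMap (lift Γ y)

/-- At `q` the lift lives at the chosen representative of its orbit, which differs from `q` by a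
group element; invariance of `θ` absorbs that element. -/
lemma pullback_descend {k : ℕ} {θ : DiffForm I5 SHyp3 k}
    (hθ : ∀ A : HypIsom, (θ.pullback (fun q : SHyp3 => A • q) : DiffForm I5 SHyp3 k) = θ) :
    ((descend Γ θ).pullback (cover Γ) : DiffForm I5 SHyp3 k) = θ := by
  ext q u
  obtain ⟨γ, hγ, hl⟩ := exists_lift_eq Γ q
  have key : ∀ p, γ.1 • q = p →
      θ p (fun i => mfderiv I5 I5 (fun q : SHyp3 => γ.1 • q) q (u i)) = θ q u := by
    rintro _ rfl
    exact congrArg (fun A : DiffForm I5 SHyp3 k => A q u) (hθ γ.1)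
  refine Eq.trans ?_ (key _ hγ)
  change θ (Quotient.out (cover Γ q)) (fun i => lift Γ (cover Γ q) (dcover Γ q (u i))) = _
  congr 1
  funext i
  exact hl (u i)

lemma form_ext {k : ℕ} {θ η : DiffForm I5 (SM Γ) k}
    (h : (θ.pullback (cover Γ) : DiffForm I5 SHyp3 k) = η.pullback (cover Γ)) : θ = η := by
  ext y v
  obtain ⟨q, rfl⟩ := cover_surjective Γ y
  choose u hu using fun i => dcover_surjective Γ q (v i)
  have h1 : v = fun i => dcover Γ q (u i) := funext fun i => (hu i).symm
  rw [h1]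
  exact congrArg (fun A : DiffForm I5 SHyp3 k => A q u) h

/-- Near `cover Γ q`, pulling back by the covering and then by the smooth local section returns `θ`.
-/
lemma smoothAt_of_pullback {k : ℕ} {θ : DiffForm I5 (SM Γ) k} {q : SHyp3}
    (h : (θ.pullback (cover Γ) : DiffForm I5 SHyp3 k).SmoothAt q) : θ.SmoothAt (cover Γ q) := by
  have hs := contMDiffAt_localSection Γ q
  have h1 : ((θ.pullback (cover Γ) : DiffForm I5 SHyp3 k).pullback (localSection Γ q) :
      DiffForm I5 (SM Γ) k).SmoothAt (cover Γ q) :=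
    DiffForm.SmoothAt.pullback (by rwa [localSection_cover]) hs
  refine h1.congr ?_
  filter_upwards [eventually_eventually_nhds.2 (cover_localSection Γ q),
    (contMDiffAt_iff_contMDiffAt_nhds (n := 1) (by simp)).1 (hs.of_le (by simp))] with y hy hy'
  have e1 := θ.pullback_comp_at (I'' := I5) (mdifferentiableAt_cover Γ (localSection Γ q y))
    (hy'.mdifferentiableAt (by simp))
  have e2 := θ.pullback_congr (I' := I5) (f := cover Γ ∘ localSection Γ q) (g := id) hy
  rw [DiffForm.pullback_id] at e2
  exact e2.symm.trans e1

lemma d_pullback_cover {k : ℕ} {θ : DiffForm I5 (SM Γ) k} (h : ∀ y, θ.SmoothAt y) :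
    (θ.d.pullback (cover Γ) : DiffForm I5 SHyp3 (k + 1)) =
      (θ.pullback (cover Γ) : DiffForm I5 SHyp3 k).d :=
  funext fun q => (DiffForm.SmoothAt.d_pullback (h (cover Γ q)) (contMDiff_cover Γ q)).symm

lemma J_dcover (q : SHyp3) (ξ : E5) : J Γ (cover Γ q) (dcover Γ q ξ) = dcover Γ q (q.J ξ) := by
  obtain ⟨γ, hγ, hl⟩ := exists_lift_eq Γ q
  have key : ∀ p, γ.1 • q = p →
      dcover Γ p (p.J (mfderiv I5 I5 (fun q : SHyp3 => γ.1 • q) q ξ)) = dcover Γ q (q.J ξ) := by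
    rintro _ rfl
    exact (congrArg (dcover Γ (γ.1 • q)) (SHyp3.J_smul γ.1 q ξ)).trans
      (dcover_smul Γ γ q (q.J ξ))
  refine Eq.trans ?_ (key _ hγ)
  change dcover Γ (Quotient.out (cover Γ q)) (SHyp3.J _ (lift Γ (cover Γ q) (dcover Γ q ξ))) = _
  rw [hl]

lemma pullback_alpha : (alpha Γ).pullback (cover Γ) = SHyp3.alpha :=
  pullback_descend Γ SHyp3.alpha_pullback_smul

lemma smoothAt_alpha (y : SM Γ) : (alpha Γ).SmoothAt y := by
  obtain ⟨q, rfl⟩ := cover_surjective Γ y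
  exact smoothAt_of_pullback Γ (by rw [pullback_alpha]; exact SHyp3.smoothAt_alpha q)

lemma pullback_d_alpha :
    ((alpha Γ).d.pullback (cover Γ) : DiffForm I5 SHyp3 2) = SHyp3.alpha.d := by
  refine (d_pullback_cover Γ (smoothAt_alpha Γ)).trans ?_
  rw [pullback_alpha]

/-- The 2-form `ψ` on `SM`. -/
def psi : DiffForm I5 (SM Γ) 2 := descend Γ SHyp3.psi

lemma pullback_psi : ((psi Γ).pullback (cover Γ) : DiffForm I5 SHyp3 2) = SHyp3.psi :=
  pullback_descend Γ SHyp3.psi_pullback_smul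

lemma smoothAt_psi (y : SM Γ) : (psi Γ).SmoothAt y := by
  obtain ⟨q, rfl⟩ := cover_surjective Γ y
  exact smoothAt_of_pullback Γ (by rw [pullback_psi]; exact SHyp3.smoothAt_psi q)

lemma alpha_dcover (q : SHyp3) (ξ : E5) :
    alpha Γ (cover Γ q) ![dcover Γ q ξ] = SHyp3.alpha q ![ξ] := by
  rw [← pullback_alpha Γ]
  exact (DiffForm.pullback_apply_one (cover Γ) (alpha Γ) q ξ).symm

lemma d_alpha_dcover (q : SHyp3) (ξ η : E5) :
    (alpha Γ).d (cover Γ q) ![dcover Γ q ξ, dcover Γ q η] = SHyp3.alpha.d q ![ξ, η] := by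
  rw [← pullback_d_alpha Γ]
  exact (DiffForm.pullback_apply_two (cover Γ) (alpha Γ).d q ξ η).symm

lemma psi_dcover (q : SHyp3) (ξ η : E5) :
    psi Γ (cover Γ q) ![dcover Γ q ξ, dcover Γ q η] = SHyp3.psi q ![ξ, η] := by
  rw [← pullback_psi Γ]
  exact (DiffForm.pullback_apply_two (cover Γ) (psi Γ) q ξ η).symm

lemma psi_eq (y : SM Γ) (ξ η : E5) : psi Γ y ![ξ, η] = (alpha Γ).d y ![J Γ y ξ, η] := by
  obtain ⟨q, rfl⟩ := cover_surjective Γ y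
  obtain ⟨ξ, rfl⟩ := dcover_surjective Γ q ξ
  obtain ⟨η, rfl⟩ := dcover_surjective Γ q η
  rw [J_dcover]
  exact (psi_dcover Γ q ξ η).trans ((SHyp3.psi_eq_d_alpha_J q ξ η).trans
    (d_alpha_dcover Γ q (q.J ξ) η).symm)

lemma isClosed_psi : (psi Γ).IsClosed := by
  refine form_ext Γ ?_
  refine (d_pullback_cover Γ (smoothAt_psi Γ)).trans ?_
  rw [pullback_psi]
  exact SHyp3.d_psi

lemma isExact_psi_wedge_psi : ((psi Γ).wedge (psi Γ)).IsExact := by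
  have hp : (((alpha Γ).wedge (alpha Γ).d).pullback (cover Γ) : DiffForm I5 SHyp3 (1 + 2)) =
      SHyp3.alpha.wedge SHyp3.alpha.d := by
    rw [DiffForm.pullback_wedge, pullback_alpha, pullback_d_alpha]
  have hs : ∀ y : SM Γ, ((alpha Γ).wedge (alpha Γ).d).SmoothAt y := by
    intro y
    obtain ⟨q, rfl⟩ := cover_surjective Γ y
    refine smoothAt_of_pullback Γ ?_
    rw [hp]
    exact SHyp3.smoothAt_alpha_wedge_d_alpha q
  -- The primitive is `α∧dα`, since `ψ∧ψ = dα∧dα` already holds on `SH³`.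
  refine ⟨(alpha Γ).wedge (alpha Γ).d, DiffForm.isSmooth_of_smoothAt hs, ?_⟩
  refine form_ext Γ ?_
  refine (d_pullback_cover Γ hs).trans ?_
  refine (congrArg DiffForm.d hp).trans (SHyp3.d_alpha_wedge_d_alpha.trans ?_)
  rw [DiffForm.pullback_wedge, pullback_psi]

lemma contMDiff_geodesicFlow (t : ℝ) : ContMDiff I5 I5 ∞ (geodesicFlow Γ t) := by
  intro y
  obtain ⟨q, rfl⟩ := cover_surjective Γ y
  have h : ContMDiffAt I5 I5 ∞
      ((cover Γ ∘ SHyp3.geodesicFlow t) ∘ localSection Γ q) (cover Γ q) :=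
    ((contMDiff_cover Γ).comp (SHyp3.contMDiff_geodesicFlow t)).contMDiffAt.comp _
      (contMDiffAt_localSection Γ q)
  refine h.congr_of_eventuallyEq ?_
  filter_upwards [cover_localSection Γ q] with y hy
  nth_rw 1 [← hy]
  rfl

lemma psi_pullback_geodesicFlow (t : ℝ) : (psi Γ).pullback (geodesicFlow Γ t) = psi Γ := by
  refine form_ext Γ (funext fun q => ?_)
  have h1 := (psi Γ).pullback_comp_at (I'' := I5) (f := geodesicFlow Γ t) (g := cover Γ) (x := q)
    ((contMDiff_geodesicFlow Γ t _).mdifferentiableAt (by simp)) (mdifferentiableAt_cover Γ q)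
  have h2 := (psi Γ).pullback_comp_at (I'' := I5) (f := cover Γ) (g := SHyp3.geodesicFlow t)
    (x := q) (mdifferentiableAt_cover Γ _)
    ((SHyp3.contMDiff_geodesicFlow t q).mdifferentiableAt (by simp))
  refine h1.symm.trans (h2.trans ?_)
  rw [pullback_psi, SHyp3.psi_pullback_geodesicFlow]

end SM

end FormsOnSM

/-! ### The generator of the flow, the contact condition and the kernel of `ψ` -/

section ReebField

open Filter Topology

lemma lorentz_sub_right (x y z : R4) : lorentz x (y - z) = lorentz x y - lorentz x z :=
  (lorentzCLM x).map_sub y z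

namespace SHyp3

lemma hasFDerivAt_incl_geodesicFlow (q : SHyp3) : HasFDerivAt
    (fun t : ℝ => (geodesicFlow t q).incl)
    (ContinuousLinearMap.smulRight (1 : ℝ →L[ℝ] ℝ) (q.vec, q.foot)) 0 := by
  have h1 : HasDerivAt (fun t : ℝ => Real.cosh t • q.foot + Real.sinh t • q.vec)
      (Real.sinh 0 • q.foot + Real.cosh 0 • q.vec) 0 :=
    ((Real.hasDerivAt_cosh 0).smul_const _).add ((Real.hasDerivAt_sinh 0).smul_const _)
  have h2 : HasDerivAt (fun t : ℝ => Real.sinh t • q.foot + Real.cosh t • q.vec)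
      (Real.cosh 0 • q.foot + Real.sinh 0 • q.vec) 0 :=
    ((Real.hasDerivAt_sinh 0).smul_const _).add ((Real.hasDerivAt_cosh 0).smul_const _)
  have h := h1.prodMk h2
  simp only [Real.sinh_zero, Real.cosh_zero, zero_smul, one_smul, zero_add, add_zero] at h
  exact h.hasFDerivAt

lemma contMDiff_geodesicFlow_time (q : SHyp3) :
    ContMDiff 𝓘(ℝ, ℝ) I5 ∞ (fun t : ℝ => geodesicFlow t q) := by
  have hc : ContDiff ℝ ∞ Real.cosh := Real.contDiff_cosh
  have hs : ContDiff ℝ ∞ Real.sinh := Real.contDiff_sinh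
  exact contMDiff_of_foot_vec
    ((hc.smul contDiff_const).add (hs.smul contDiff_const)).contMDiff
    ((hs.smul contDiff_const).add (hc.smul contDiff_const)).contMDiff

/-- The generator of the geodesic flow. -/
def geodesicField (q : SHyp3) : TangentSpace I5 q :=
  (mfderiv 𝓘(ℝ, ℝ) I5 (fun t : ℝ => geodesicFlow t q) 0 (1 : ℝ) : E5)

lemma geodesicFlow_zero (q : SHyp3) : geodesicFlow 0 q = q := by
  refine Subtype.ext (Prod.ext ?_ ?_)
  · change Real.cosh 0 • q.foot + Real.sinh 0 • q.vec = q.foot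
    simp
  · change Real.sinh 0 • q.foot + Real.cosh 0 • q.vec = q.vec
    simp

lemma dincl_geodesicField (q : SHyp3) : q.dincl q.geodesicField = (q.vec, q.foot) := by
  have h1 := mfderiv_comp (0 : ℝ) (mdifferentiableAt_incl (geodesicFlow 0 q))
    ((contMDiff_geodesicFlow_time q 0).mdifferentiableAt (by simp))
  have h2 : mfderiv 𝓘(ℝ, ℝ) 𝓘(ℝ, R4 × R4) (incl ∘ fun t : ℝ => geodesicFlow t q) 0 =
      ContinuousLinearMap.smulRight (1 : ℝ →L[ℝ] ℝ) (q.vec, q.foot) :=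
    (hasFDerivAt_incl_geodesicFlow q).hasMFDerivAt.mfderiv
  have h3 : (geodesicFlow 0 q).dincl (mfderiv 𝓘(ℝ, ℝ) I5 (fun t : ℝ => geodesicFlow t q) 0 (1 : ℝ))
      = (q.vec, q.foot) := by
    refine (congrArg (fun L : ℝ →L[ℝ] R4 × R4 => L 1) (h1.symm.trans h2)).trans ?_
    exact one_smul ℝ (q.vec, q.foot)
  have key : ∀ (p : SHyp3) (ξ : E5), geodesicFlow 0 q = p →
      (geodesicFlow 0 q).dincl ξ = p.dincl ξ := by
    rintro _ ξ rfl; rfl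
  exact (key q _ (geodesicFlow_zero q)).symm.trans h3

lemma hor_geodesicField (q : SHyp3) : q.hor q.geodesicField = q.vec := by
  rw [← fst_dincl, dincl_geodesicField]

lemma ver_geodesicField (q : SHyp3) : q.ver q.geodesicField = 0 := by
  rw [ver_apply, dincl_geodesicField, lorentz_foot_foot]
  simp

lemma d_alpha_nondegenerate (q : SHyp3) {ξ : TangentSpace I5 q} (h0 : alpha q ![ξ] = 0)
    (h : ∀ η : TangentSpace I5 q, alpha q ![η] = 0 → alpha.d q ![ξ, η] = 0) : ξ = 0 := by
  rw [alpha_apply] at h0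
  -- The test vectors are `η = (ξ_V, ξ_H)` and `ζ = (0, ξ_H)`, with `dα(ξ, η) = |ξ_V|² - |ξ_H|²` and
  -- `dα(ξ, ζ) = -|ξ_H|²`. Having `ξ_H` as a vertical component requires `α(ξ) = 0`.
  obtain ⟨η, h1, h2⟩ := exists_hor_ver q (lorentz_foot_ver q ξ) (lorentz_foot_hor q ξ) h0
  have h3 := h η (by rw [alpha_apply, h1, lorentz_vec_ver])
  obtain ⟨ζ, h4, h5⟩ := exists_hor_ver q (lorentz_zero_right q.foot) (lorentz_foot_hor q ξ) h0
  have h6 := h ζ (by rw [alpha_apply, h4, lorentz_zero_right])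
  rw [d_alpha_apply] at h3 h6
  rw [h1, h2] at h3
  rw [h4, h5, lorentz_zero_right] at h6
  have hh : q.hor ξ = 0 :=
    eq_zero_of_lorentz_self_nonpos q (lorentz_foot_hor q ξ) (by linarith)
  have hv : q.ver ξ = 0 :=
    eq_zero_of_lorentz_self_nonpos q (lorentz_foot_ver q ξ) (by linarith)
  refine q.hor_ver_injective (Prod.ext ?_ ?_)
  · exact hh.trans (map_zero q.hor).symm
  · exact hv.trans (map_zero q.ver).symm

lemma d_alpha_geodesicField (q : SHyp3) (η : TangentSpace I5 q) :
    alpha.d q ![q.geodesicField, η] = 0 := by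
  rw [d_alpha_apply, hor_geodesicField, ver_geodesicField, lorentz_comm, lorentz_zero_right,
    lorentz_comm, lorentz_vec_ver, sub_zero]

lemma alpha_geodesicField (q : SHyp3) : alpha q ![q.geodesicField] = 1 := by
  rw [alpha_apply, hor_geodesicField, lorentz_vec_vec]

lemma psi_geodesicField (q : SHyp3) (η : TangentSpace I5 q) :
    psi q ![q.geodesicField, η] = 0 := by
  rw [psi_apply, hor_geodesicField, ver_geodesicField, det4_eq, det4_eq]
  simp only [Pi.zero_apply]
  ring

/-- The kernel of `ψ` is spanned by the generator of the geodesic flow. -/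
lemma eq_smul_geodesicField (q : SHyp3) {ξ : TangentSpace I5 q}
    (h : ∀ η : TangentSpace I5 q, psi q ![ξ, η] = 0) :
    ξ = alpha q ![ξ] • q.geodesicField := by
  -- With `η = (i(v)ξ_H, 0)` and `ζ = (0, i(v)ξ_V)` one has `ψ(ξ, η) = |ξ_H|² - ⟨v, ξ_H⟩²` and `ψ(ξ,
  -- ζ) = -|ξ_V|²`. Hence `ξ_V = 0`, and the part of `ξ_H` orthogonal to `v` vanishes.
  obtain ⟨η, h1, h2⟩ := exists_hor_ver q (lorentz_foot_rot q (q.hor ξ))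
    (lorentz_zero_right q.foot) (lorentz_zero_right q.vec)
  obtain ⟨ζ, h3, h4⟩ := exists_hor_ver q (lorentz_zero_right q.foot)
    (lorentz_foot_rot q (q.ver ξ)) (lorentz_vec_rot q (q.ver ξ))
  have e1 := h η
  have e2 := h ζ
  rw [psi_apply, h1, h2, ← lorentz_rot, ← lorentz_rot, lorentz_zero_right,
    lorentz_rot_rot q (lorentz_foot_hor q ξ)] at e1
  rw [psi_apply, h3, h4, ← lorentz_rot, ← lorentz_rot, lorentz_zero_right,
    lorentz_rot_rot q (lorentz_foot_ver q ξ), lorentz_vec_ver] at e2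
  have hv : q.ver ξ = 0 :=
    eq_zero_of_lorentz_self_nonpos q (lorentz_foot_ver q ξ) (by linarith)
  have hh : q.hor ξ - lorentz q.vec (q.hor ξ) • q.vec = 0 := by
    refine eq_zero_of_lorentz_self_nonpos q ?_ ?_
    · rw [lorentz_sub_right, lorentz_smul_right, lorentz_foot_hor, lorentz_foot_vec]
      ring
    · rw [lorentz_sub_right, lorentz_comm, lorentz_comm _ (_ • _), lorentz_smul_left,
        lorentz_sub_right, lorentz_sub_right, lorentz_smul_right, lorentz_smul_right,
        lorentz_vec_vec, lorentz_comm (q.hor ξ) q.vec]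
      linarith
  refine q.hor_ver_injective (Prod.ext ?_ ?_)
  · change q.hor ξ = q.hor (_ • q.geodesicField)
    rw [map_smul, hor_geodesicField]
    exact sub_eq_zero.1 hh
  · change q.ver ξ = q.ver (_ • q.geodesicField)
    rw [map_smul, ver_geodesicField, smul_zero]
    exact hv

end SHyp3

namespace SM

variable (Γ : Subgroup HypIsom) [ProperlyDiscontinuousSMul Γ Hyp3] [IsCancelSMul Γ Hyp3]

lemma geodesicField_cover (q : SHyp3) :
    geodesicField Γ (cover Γ q) = dcover Γ q q.geodesicField := by
  have h1 := mfderiv_comp (0 : ℝ) (mdifferentiableAt_cover Γ (SHyp3.geodesicFlow 0 q))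
    ((SHyp3.contMDiff_geodesicFlow_time q 0).mdifferentiableAt (by simp))
  have h2 : geodesicField Γ (cover Γ q) =
      dcover Γ (SHyp3.geodesicFlow 0 q) q.geodesicField :=
    congrArg (fun L : ℝ →L[ℝ] E5 => L 1) h1
  -- The chain rule gives the differential at `geodesicFlow 0 q`; this transports it to `q`.
  have key : ∀ p, SHyp3.geodesicFlow 0 q = p →
      dcover Γ (SHyp3.geodesicFlow 0 q) q.geodesicField = dcover Γ p q.geodesicField := by
    rintro _ rfl; rfl
  exact h2.trans (key q (SHyp3.geodesicFlow_zero q))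

lemma alpha_geodesicField (y : SM Γ) : alpha Γ y ![geodesicField Γ y] = 1 := by
  obtain ⟨q, rfl⟩ := cover_surjective Γ y
  rw [geodesicField_cover]
  exact (alpha_dcover Γ q q.geodesicField).trans (SHyp3.alpha_geodesicField q)

lemma geodesicField_mem_kernel_d_alpha (y : SM Γ) :
    geodesicField Γ y ∈ (alpha Γ).d.kernel y := by
  refine DiffForm.mem_kernel_two.2 fun η => ?_
  obtain ⟨q, rfl⟩ := cover_surjective Γ y
  obtain ⟨η, rfl⟩ := dcover_surjective Γ q η
  rw [geodesicField_cover]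
  exact (d_alpha_dcover Γ q q.geodesicField η).trans (SHyp3.d_alpha_geodesicField q η)

lemma geodesicField_mem_kernel_psi (y : SM Γ) : geodesicField Γ y ∈ (psi Γ).kernel y := by
  refine DiffForm.mem_kernel_two.2 fun η => ?_
  obtain ⟨q, rfl⟩ := cover_surjective Γ y
  obtain ⟨η, rfl⟩ := dcover_surjective Γ q η
  rw [geodesicField_cover]
  exact (psi_dcover Γ q q.geodesicField η).trans (SHyp3.psi_geodesicField q η)

lemma eq_smul_of_mem_kernel_psi {y : SM Γ} {ξ : E5} (h : ξ ∈ (psi Γ).kernel y) :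
    ∃ c : ℝ, c • (geodesicField Γ y : E5) = ξ := by
  obtain ⟨q, rfl⟩ := cover_surjective Γ y
  obtain ⟨ξ, rfl⟩ := dcover_surjective Γ q ξ
  refine ⟨SHyp3.alpha q ![ξ], ?_⟩
  have h1 := SHyp3.eq_smul_geodesicField q (ξ := ξ) fun η =>
    (psi_dcover Γ q ξ η).symm.trans (DiffForm.mem_kernel_two.1 h (dcover Γ q η))
  refine Eq.trans ?_ (congrArg (dcover Γ q) h1).symm
  refine Eq.trans ?_ ((dcover Γ q).map_smul _ _).symm
  exact congrArg (fun η : E5 => SHyp3.alpha q ![ξ] • η) (geodesicField_cover Γ q)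

lemma isReeb_d_alpha : DiffForm.IsReeb (alpha Γ).d (alpha Γ) (geodesicField Γ) := fun y =>
  ⟨alpha_geodesicField Γ y, geodesicField_mem_kernel_d_alpha Γ y⟩

lemma isReeb_psi : DiffForm.IsReeb (psi Γ) (alpha Γ) (geodesicField Γ) := fun y =>
  ⟨alpha_geodesicField Γ y, geodesicField_mem_kernel_psi Γ y⟩

lemma geodesicField_ne_zero (y : SM Γ) : geodesicField Γ y ≠ 0 := by
  intro h
  have h1 := alpha_geodesicField Γ y
  have h2 : alpha Γ y ![geodesicField Γ y] = 0 :=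
    (alpha Γ y).map_coord_zero (0 : Fin 1) h
  rw [h2] at h1
  exact zero_ne_one h1

lemma isContact_alpha : (alpha Γ).IsContact where
  smooth := DiffForm.isSmooth_of_smoothAt (smoothAt_alpha Γ)
  ne_zero y h := by
    have h1 := alpha_geodesicField Γ y
    rw [h] at h1
    exact zero_ne_one h1
  nondegenerate y ξ h0 h := by
    obtain ⟨q, rfl⟩ := cover_surjective Γ y
    obtain ⟨ξ, rfl⟩ := dcover_surjective Γ q ξ
    have h1 : (ξ : E5) = 0 := SHyp3.d_alpha_nondegenerate q (ξ := ξ)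
      ((alpha_dcover Γ q ξ).symm.trans h0)
      fun η hη => (d_alpha_dcover Γ q ξ η).symm.trans
        (h (dcover Γ q η) ((alpha_dcover Γ q η).trans hη))
    rw [h1]
    exact map_zero (dcover Γ q)

lemma isHamiltonianStructure_psi : (psi Γ).IsHamiltonianStructure where
  smooth := DiffForm.isSmooth_of_smoothAt (smoothAt_psi Γ)
  closed := isClosed_psi Γ
  finrank_kernel y := by
    refine finrank_eq_one (⟨geodesicField Γ y, geodesicField_mem_kernel_psi Γ y⟩ :
      (psi Γ).kernel y) ?_ ?_
    · exact fun h => geodesicField_ne_zero Γ y (congrArg Subtype.val h)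
    · rintro ⟨ξ, hξ⟩
      obtain ⟨c, hc⟩ := eq_smul_of_mem_kernel_psi Γ hξ
      exact ⟨c, Subtype.ext hc⟩

lemma isStabilizing_alpha : (psi Γ).IsStabilizing (alpha Γ) where
  smooth := DiffForm.isSmooth_of_smoothAt (smoothAt_alpha Γ)
  ne_zero_on_kernel y := ⟨geodesicField Γ y, geodesicField_mem_kernel_psi Γ y, by
    rw [alpha_geodesicField]; exact one_ne_zero⟩
  kernel_le y ξ hξ := by
    obtain ⟨c, rfl⟩ := eq_smul_of_mem_kernel_psi Γ hξ
    exact Submodule.smul_mem _ c (geodesicField_mem_kernel_d_alpha Γ y)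

lemma exists_J_dcover (q : SHyp3) (ξ : TangentSpace I5 q) : ∃ η : TangentSpace I5 q,
    q.hor η = q.rot (q.ver ξ) ∧ q.ver η = q.rot (q.hor ξ) ∧
      J Γ (cover Γ q) (mfderiv I5 I5 (cover Γ) q ξ) = mfderiv I5 I5 (cover Γ) q η :=
  ⟨q.J ξ, (SHyp3.hor_ver_J q ξ).1, (SHyp3.hor_ver_J q ξ).2, J_dcover Γ q ξ⟩

end SM

end ReebField

/-! ### Non-exactness of `ψ` by Stokes' theorem on a fibre sphere -/

section NonExactness

open Filter Topology MeasureTheory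

/-- Stokes' theorem on a rectangle for a 1-form whose contributions from the vertical sides cancel
and which vanishes along the horizontal sides. -/
lemma integral_extDeriv_eq_zero {θ : ℝ × ℝ → (ℝ × ℝ) [⋀^Fin 1]→L[ℝ] ℝ} (hθ : ContDiff ℝ ∞ θ)
    {a₁ b₁ a₂ b₂ : ℝ} (hside : ∀ y, θ (b₁, y) ![(0, 1)] = θ (a₁, y) ![(0, 1)])
    (hbot : ∀ x, θ (x, a₂) ![(1, 0)] = 0) (htop : ∀ x, θ (x, b₂) ![(1, 0)] = 0) :
    ∫ x in a₁..b₁, ∫ y in a₂..b₂, extDeriv θ (x, y) ![(1, 0), (0, 1)] = 0 := by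
  have hs : ∀ v, ContDiff ℝ ∞ fun z => θ z v := SHyp3.contDiff_alternating_iff.1 hθ
  have hf : ContDiff ℝ ∞ fun z => θ z ![(0, 1)] := hs _
  -- The coefficient of `dθ` is the divergence of `(θ(∂_y), -θ(∂_x))`, the form required by the
  -- divergence theorem on a rectangle.
  have hg : ContDiff ℝ ∞ fun z => -θ z ![(1, 0)] := (hs _).neg
  have hd : ∀ z, extDeriv θ z ![(1, 0), (0, 1)] =
      fderiv ℝ (fun z => θ z ![(0, 1)]) z (1, 0) +
        fderiv ℝ (fun z => -θ z ![(1, 0)]) z (0, 1) := by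
    intro z
    have h1 : Fin.removeNth (1 : Fin 2) ![((1 : ℝ), (0 : ℝ)), (0, 1)] = ![(1, 0)] := by
      funext i; fin_cases i; rfl
    have h0 : Fin.removeNth (0 : Fin 2) ![((1 : ℝ), (0 : ℝ)), (0, 1)] = ![(0, 1)] := by
      funext i; fin_cases i; rfl
    rw [extDeriv_apply (hθ.differentiable (by simp) z), Fin.sum_univ_two, h0, h1, fderiv_fun_neg]
    simp
  have hcont : Continuous fun z => fderiv ℝ (fun z => θ z ![(0, 1)]) z (1, 0) +
      fderiv ℝ (fun z => -θ z ![(1, 0)]) z (0, 1) :=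
    ((hf.continuous_fderiv (by simp)).clm_apply continuous_const).add
      ((hg.continuous_fderiv (by simp)).clm_apply continuous_const)
  have h := integral2_divergence_prod_of_hasFDerivAt _ _ _ _ a₁ a₂ b₁ b₂
    hf.continuous.continuousOn hg.continuous.continuousOn
    (fun z _ => (hf.differentiable (by simp) z).hasFDerivAt)
    (fun z _ => (hg.differentiable (by simp) z).hasFDerivAt)
    (hcont.continuousOn.integrableOn_compact (isCompact_uIcc.prod isCompact_uIcc))
  simp only [hd]
  rw [h]
  simp [hside, hbot, htop]

namespace SHyp3

/-- Spherical coordinates on the fibre of `SH³` over the base point. -/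
def sphericalPt (z : ℝ × ℝ) : SHyp3 :=
  ⟨(![1, 0, 0, 0], ![0, Real.sin z.2 * Real.cos z.1, Real.sin z.2 * Real.sin z.1, Real.cos z.2]),
    ⟨by simp [lorentz], by simp⟩, by simp [lorentz], by
      have h1 := Real.sin_sq_add_cos_sq z.1
      have h2 := Real.sin_sq_add_cos_sq z.2
      simp only [lorentz, Matrix.cons_val]
      linear_combination Real.sin z.2 ^ 2 * h1 + h2⟩

lemma hasFDerivAt_vec_sphericalPt (z : ℝ × ℝ) : ∃ L : ℝ × ℝ →L[ℝ] R4,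
    HasFDerivAt (fun z => (sphericalPt z).vec) L z ∧
      L (1, 0) = ![0, -(Real.sin z.2 * Real.sin z.1), Real.sin z.2 * Real.cos z.1, 0] ∧
      L (0, 1) = ![0, Real.cos z.2 * Real.cos z.1, Real.cos z.2 * Real.sin z.1,
        -Real.sin z.2] := by
  have hf : HasFDerivAt (fun z : ℝ × ℝ => z.1) (ContinuousLinearMap.fst ℝ ℝ ℝ) z := hasFDerivAt_fst
  have hs : HasFDerivAt (fun z : ℝ × ℝ => z.2) (ContinuousLinearMap.snd ℝ ℝ ℝ) z := hasFDerivAt_snd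
  have h : ∀ i : Fin 4, ∃ L : ℝ × ℝ →L[ℝ] ℝ,
      HasFDerivAt (fun z => (sphericalPt z).vec i) L z ∧
      L (1, 0) = (![0, -(Real.sin z.2 * Real.sin z.1), Real.sin z.2 * Real.cos z.1, 0] : R4) i ∧
      L (0, 1) = (![0, Real.cos z.2 * Real.cos z.1, Real.cos z.2 * Real.sin z.1,
        -Real.sin z.2] : R4) i := by
    intro i
    fin_cases i
    · exact ⟨_, hasFDerivAt_const 0 z, rfl, rfl⟩
    · exact ⟨_, hs.sin.mul hf.cos, by simp, by simp; ring⟩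
    · exact ⟨_, hs.sin.mul hf.sin, by simp, by simp; ring⟩
    · exact ⟨_, hs.cos, by simp, by simp⟩
  choose L h0 h1 h2 using h
  exact ⟨ContinuousLinearMap.pi L, hasFDerivAt_pi.2 h0, funext h1, funext h2⟩

lemma contMDiff_sphericalPt : ContMDiff 𝓘(ℝ, ℝ × ℝ) I5 ∞ sphericalPt := by
  refine contMDiff_of_foot_vec contMDiff_const (ContDiff.contMDiff (contDiff_pi.2 fun i => ?_))
  have h1 : ContDiff ℝ ∞ fun z : ℝ × ℝ => Real.sin z.1 := Real.contDiff_sin.comp contDiff_fst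
  have h2 : ContDiff ℝ ∞ fun z : ℝ × ℝ => Real.cos z.1 := Real.contDiff_cos.comp contDiff_fst
  have h3 : ContDiff ℝ ∞ fun z : ℝ × ℝ => Real.sin z.2 := Real.contDiff_sin.comp contDiff_snd
  have h4 : ContDiff ℝ ∞ fun z : ℝ × ℝ => Real.cos z.2 := Real.contDiff_cos.comp contDiff_snd
  fin_cases i
  · exact contDiff_const
  · exact h3.mul h2
  · exact h3.mul h1
  · exact h4

lemma mdifferentiableAt_sphericalPt (z : ℝ × ℝ) :
    MDifferentiableAt 𝓘(ℝ, ℝ × ℝ) I5 sphericalPt z :=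
  (contMDiff_sphericalPt z).mdifferentiableAt (by simp)

lemma dincl_mfderiv_sphericalPt (z : ℝ × ℝ) {L : ℝ × ℝ →L[ℝ] R4}
    (hL : HasFDerivAt (fun z => (sphericalPt z).vec) L z) (u : ℝ × ℝ) :
    (sphericalPt z).dincl (mfderiv 𝓘(ℝ, ℝ × ℝ) I5 sphericalPt z u) = (0, L u) := by
  have h1 := mfderiv_comp z (mdifferentiableAt_incl (sphericalPt z))
    (mdifferentiableAt_sphericalPt z)
  have h2 : HasFDerivAt (incl ∘ sphericalPt) ((0 : ℝ × ℝ →L[ℝ] R4).prod L) z :=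
    (hasFDerivAt_const (![1, 0, 0, 0] : R4) z).prodMk hL
  exact congrArg (fun T : ℝ × ℝ →L[ℝ] R4 × R4 => T u) (h1.symm.trans h2.hasMFDerivAt.mfderiv)

/-- The foot point is constant along the fibre, so only `-det(x, v, dv, dv)` survives; in spherical
coordinates it is the area density. -/
lemma psi_pullback_sphericalPt (z : ℝ × ℝ) :
    (psi.pullback sphericalPt : DiffForm 𝓘(ℝ, ℝ × ℝ) (ℝ × ℝ) 2) z
      ![((1, 0) : ℝ × ℝ), ((0, 1) : ℝ × ℝ)] = Real.sin z.2 := by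
  obtain ⟨L, hL, h1, h2⟩ := hasFDerivAt_vec_sphericalPt z
  refine (DiffForm.pullback_apply_two (I' := 𝓘(ℝ, ℝ × ℝ)) sphericalPt psi z
    ((1, 0) : ℝ × ℝ) ((0, 1) : ℝ × ℝ)).trans ?_
  refine (inclPullback_apply ambPsi _ _).trans ((ambPsi_apply _ _).trans ?_)
  change det4 (sphericalPt z).foot (sphericalPt z).vec
    ((sphericalPt z).dincl (mfderiv 𝓘(ℝ, ℝ × ℝ) I5 sphericalPt z ((1, 0) : ℝ × ℝ))).1
    ((sphericalPt z).dincl (mfderiv 𝓘(ℝ, ℝ × ℝ) I5 sphericalPt z ((0, 1) : ℝ × ℝ))).1 -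
    det4 (sphericalPt z).foot (sphericalPt z).vec
    ((sphericalPt z).dincl (mfderiv 𝓘(ℝ, ℝ × ℝ) I5 sphericalPt z ((1, 0) : ℝ × ℝ))).2
    ((sphericalPt z).dincl (mfderiv 𝓘(ℝ, ℝ × ℝ) I5 sphericalPt z ((0, 1) : ℝ × ℝ))).2 = _
  rw [dincl_mfderiv_sphericalPt z hL, dincl_mfderiv_sphericalPt z hL, h1, h2]
  have e1 := Real.sin_sq_add_cos_sq z.1
  have e2 := Real.sin_sq_add_cos_sq z.2
  simp only [det4_eq, sphericalPt, foot, vec, Matrix.cons_val, Pi.zero_apply]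
  linear_combination Real.sin z.2 * (Real.sin z.2 ^ 2 + Real.cos z.2 ^ 2) * e1 +
    Real.sin z.2 * e2

/-- At the poles the circle of longitude collapses, so a pulled-back 1-form vanishes along the
horizontal sides of the coordinate rectangle. -/
lemma mfderiv_sphericalPt_of_sin_eq_zero {z : ℝ × ℝ} (hz : Real.sin z.2 = 0) :
    mfderiv 𝓘(ℝ, ℝ × ℝ) I5 sphericalPt z ((1, 0) : ℝ × ℝ) = 0 := by
  obtain ⟨L, hL, h1, -⟩ := hasFDerivAt_vec_sphericalPt z
  refine dincl_injective _ ?_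
  refine (dincl_mfderiv_sphericalPt z hL (1, 0)).trans (Eq.trans ?_ (map_zero _).symm)
  rw [h1, hz]
  refine Prod.ext rfl (funext fun i => ?_)
  fin_cases i <;> simp

lemma sphericalPt_periodic :
    sphericalPt ∘ (fun z : ℝ × ℝ => z + (2 * Real.pi, 0)) = sphericalPt := by
  refine funext fun z => Subtype.ext (Prod.ext rfl (funext fun i => ?_))
  fin_cases i <;> simp [sphericalPt]

/-- The coordinate map has period `2π` in the longitude, so the two vertical sides of the rectangle
contribute opposite terms to Stokes' theorem. -/
lemma pullback_sphericalPt_periodic {k : ℕ} (β : DiffForm I5 SHyp3 k) (z : ℝ × ℝ)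
    (u : Fin k → ℝ × ℝ) :
    (β.pullback sphericalPt : DiffForm 𝓘(ℝ, ℝ × ℝ) (ℝ × ℝ) k) (z + (2 * Real.pi, 0)) u =
      (β.pullback sphericalPt : DiffForm 𝓘(ℝ, ℝ × ℝ) (ℝ × ℝ) k) z u := by
  have hτ : HasMFDerivAt 𝓘(ℝ, ℝ × ℝ) 𝓘(ℝ, ℝ × ℝ) (fun z : ℝ × ℝ => z + (2 * Real.pi, 0)) z
      (ContinuousLinearMap.id ℝ (ℝ × ℝ)) := ((hasFDerivAt_id z).add_const _).hasMFDerivAt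
  have h := β.pullback_comp_at (I'' := 𝓘(ℝ, ℝ × ℝ)) (x := z)
    (mdifferentiableAt_sphericalPt (z + (2 * Real.pi, 0))) hτ.mdifferentiableAt
  rw [sphericalPt_periodic] at h
  rw [h]
  change _ = (β.pullback sphericalPt : DiffForm 𝓘(ℝ, ℝ × ℝ) (ℝ × ℝ) k) (z + (2 * Real.pi, 0))
    fun i => mfderiv 𝓘(ℝ, ℝ × ℝ) 𝓘(ℝ, ℝ × ℝ) (fun z : ℝ × ℝ => z + (2 * Real.pi, 0)) z (u i)
  rw [hτ.mfderiv]
  rfl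

/-- A primitive of `ψ` on `SH³` would give, by Stokes' theorem, a vanishing area of the fibre. -/
lemma d_ne_psi {β : DiffForm I5 SHyp3 1} (hβ : ∀ q, β.SmoothAt q) : β.d ≠ psi := by
  intro h
  let θ : ℝ × ℝ → (ℝ × ℝ) [⋀^Fin 1]→L[ℝ] ℝ :=
    (β.pullback sphericalPt : DiffForm 𝓘(ℝ, ℝ × ℝ) (ℝ × ℝ) 1)
  have hθ : ContDiff ℝ ∞ θ := contDiff_iff_contDiffAt.2 fun z =>
    DiffForm.smoothAt_vectorSpace.1 ((hβ (sphericalPt z)).pullback (contMDiff_sphericalPt z))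
  have hd : ∀ z, extDeriv θ z ![(1, 0), (0, 1)] = Real.sin z.2 := fun z => by
    rw [← psi_pullback_sphericalPt z, ← h]
    have h1 := DiffForm.d_vectorSpace θ z
    have h2 := DiffForm.SmoothAt.d_pullback (hβ (sphericalPt z)) (contMDiff_sphericalPt z)
    exact congrArg (fun A : (ℝ × ℝ) [⋀^Fin 2]→L[ℝ] ℝ => A ![(1, 0), (0, 1)]) (h1.symm.trans h2)
  have hzero : ∀ z : ℝ × ℝ, Real.sin z.2 = 0 → θ z ![(1, 0)] = 0 := fun z hz =>
    (β (sphericalPt z)).map_coord_zero (0 : Fin 1) (mfderiv_sphericalPt_of_sin_eq_zero hz)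
  have hint := integral_extDeriv_eq_zero hθ (a₁ := 0) (b₁ := 2 * Real.pi) (a₂ := 0)
    (b₂ := Real.pi) (fun y => by
      have := pullback_sphericalPt_periodic β (0, y) ![(0, 1)]
      rwa [Prod.mk_add_mk, zero_add, add_zero] at this)
    (fun x => hzero _ Real.sin_zero) (fun x => hzero _ Real.sin_pi)
  -- The integral evaluates to the area `4π` of the unit sphere, which Stokes' theorem claims to be
  -- zero.
  simp only [hd, integral_sin, Real.cos_zero, Real.cos_pi, intervalIntegral.integral_const,
    smul_eq_mul] at hint
  linarith [Real.pi_pos]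

end SHyp3

namespace SM

variable (Γ : Subgroup HypIsom) [ProperlyDiscontinuousSMul Γ Hyp3] [IsCancelSMul Γ Hyp3]

lemma not_isExact_psi : ¬ (psi Γ).IsExact := by
  rintro ⟨β, hβ, h⟩
  refine SHyp3.d_ne_psi (β := β.pullback (cover Γ)) (fun q =>
    (hβ.smoothAt (cover Γ q)).pullback (contMDiff_cover Γ q)) ?_
  rw [← d_pullback_cover Γ hβ.smoothAt, h, pullback_psi]

end SM

end NonExactness

end

theorem mainTheorem3 (Γ : Subgroup HypIsom) [ProperlyDiscontinuousSMul Γ Hyp3]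
    [IsCancelSMul Γ Hyp3] [CompactSpace (HypManifold Γ)] :
    -- the 1-form `α` and the endomorphism `J` of `SH³` descend to `SM`
    (SM.alpha Γ).pullback (SM.cover Γ) = SHyp3.alpha ∧
    (∀ (q : SHyp3) (ξ : TangentSpace I5 q), ∃ η : TangentSpace I5 q,
      q.hor η = q.rot (q.ver ξ) ∧ q.ver η = q.rot (q.hor ξ) ∧
      SM.J Γ (SM.cover Γ q) (mfderiv I5 I5 (SM.cover Γ) q ξ) =
        mfderiv I5 I5 (SM.cover Γ) q η) ∧
    (SM.alpha Γ).IsContact ∧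
    -- the 2-form `ψ(ξ, η) = dα(Jξ, η)`
    ∃ ψ : DiffForm I5 (SM Γ) 2,
      (∀ (y : SM Γ) (ξ η : TangentSpace I5 y),
        ψ y ![ξ, η] = (SM.alpha Γ).d y ![SM.J Γ y ξ, η]) ∧
      (∀ t : ℝ, ψ.pullback (SM.geodesicFlow Γ t) = ψ) ∧
      ψ.IsClosed ∧
      ¬ ψ.IsExact ∧
      (ψ.wedge ψ).IsExact ∧
      ψ.IsHamiltonianStructure ∧
      ψ.IsStabilizing (SM.alpha Γ) ∧
      DiffForm.IsReeb (SM.alpha Γ).d (SM.alpha Γ) (SM.geodesicField Γ) ∧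
      DiffForm.IsReeb ψ (SM.alpha Γ) (SM.geodesicField Γ) :=
  ⟨SM.pullback_alpha Γ, SM.exists_J_dcover Γ, SM.isContact_alpha Γ, SM.psi Γ, SM.psi_eq Γ,
    SM.psi_pullback_geodesicFlow Γ, SM.isClosed_psi Γ, SM.not_isExact_psi Γ,
    SM.isExact_psi_wedge_psi Γ, SM.isHamiltonianStructure_psi Γ, SM.isStabilizing_alpha Γ,
    SM.isReeb_d_alpha Γ, SM.isReeb_psi Γ⟩
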